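/- Let $p$ be a prime and let $K/\mathbb{Q}_p$ be a complete perfectoid field extension containing all $p$-power roots of unity, with ring of integers $\mathcal{O}_K$. Fix a compatible system $1,\zeta_p,\zeta_{p^2},\dots$ of primitive $p$-power roots of unity in $K$, and let $\epsilon=(1,\zeta_p,\zeta_{p^2},\dots)\in\mathcal{O}_K^\flat$. Let $\mathrm{A_{inf}}=W(\mathcal{O}_K^\flat)$, with Witt vector Frobenius $\varphi$, let $\mathrm{B}_{\mathrm{dR}}^+$ be the completion of $\mathrm{A_{inf}}[1/p]$ along the kernel of Fontaine's map $\theta:\mathrm{A_{inf}}[1/p]\to K$, and let $\xi=\frac{[\epsilon]-1}{\varphi^{-1}([\epsilon])-1}\in\mathrm{A_{inf}}$. For $e\in\mathbb{N}$ put $\mathrm{A_{inf,e}}=\mathrm{A_{inf}}/\xi^e$ and $\mathrm{B}_{\mathrm{dR},e}^+=\mathrm{B}_{\mathrm{dR}}^+/\xi^e=\mathrm{A_{inf,e}}[1/p]$. For a finite set $X$, let $\mathrm{A_{inf,e}}\langle X\rangle$ be the ring of power series over $\mathrm{A_{inf,e}}$ whose coefficients tend to $0$ $p$-adically, and let $\mathrm{B}_{\mathrm{dR},e}^+\langle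 X\rangle=\mathrm{A_{inf,e}}\langle X\rangle[1/p]$ and $\mathrm{B}_{\mathrm{dR}}^+\langle X\rangle=\varprojlim_e \mathrm{B}_{\mathrm{dR},e}^+\langle X\rangle$. Let $A$ be one of $\mathrm{A_{inf,e}}$, $\mathrm{B}_{\mathrm{dR},e}^+$ (for some $e\in\mathbb{N}$) or $\mathrm{B}_{\mathrm{dR}}^+$. Let $B$ be a topologically finitely presented $A$-algebra, i.e. $B\cong A\langle x_1,\dots,x_n\rangle/J$ for some $n$ and some finitely generated ideal $J$, and let $I\subset B$ be a finitely generated ideal. If $A=\mathrm{A_{inf,e}}$, assume moreover that $B/I$ is $p$-torsion free. Then there is a simplicial pair $(P_\bullet,J_\bullet)$, that is, a simplicial commutative $A$-algebra $P_\bullet$ with a simplicial ideal $J_\bullet\subset P_\bullet$ (every simplicial structure map sends $J_n$ into $J_m$), together with a map $(P_\bullet,J_\bullet)\to(B,I)$ to the constant simplicial pair, such that * for every $n\ge 0$ there are finite sets $X_n,Y_n$ and an isomorphism of pairs over $A$ $(P_n,J_n)\cong(A\langle X_n,Y_n\rangle,(Y_n))$, where $(Y_n)$ is the ideal generated by the variables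 in $Y_n$; * the map is a quasi-isomorphism of pairs: both $P_\bullet\to B$ and $J_\bullet\to I$ induce quasi-isomorphisms on the associated (alternating sum of faces) chain complexes. -/

import Mathlib

open CategoryTheory

universe u

noncomputable section

namespace TateRes

/-! ### The ring of integers of a nonarchimedean field over `ℚ_p` -/

/-- The ring of integers `O_K = {x | ‖x‖ ≤ 1}` of a nonarchimedean normed field. -/
abbrev OK (K : Type u) [NormedField K] [IsUltrametricDist K] : Subring K :=
  (NormedField.valuation (K := K)).integer

lemma norm_natCast_p (K : Type u) [NormedField K] (p : ℕ) [Fact p.Prime] [NormedAlgebra ℚ_[p] K] :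
    ‖(p : K)‖ = (p : ℝ)⁻¹ := by
  have h : (p : K) = algebraMap ℚ_[p] K (p : ℚ_[p]) := by simp
  rw [h, norm_algebraMap', Padic.norm_p]

section Integers

variable {K : Type u} [NormedField K] [IsUltrametricDist K]

lemma mem_OK {x : K} : x ∈ OK K ↔ ‖x‖ ≤ 1 := by
  rw [Valuation.mem_integer_iff, NormedField.valuation_apply, ← NNReal.coe_le_coe]
  rfl

variable (p : ℕ) [Fact p.Prime] [NormedAlgebra ℚ_[p] K]

lemma norm_natCast_p_pos : 0 < ‖(p : K)‖ := by
  rw [norm_natCast_p]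
  exact inv_pos.2 (by exact_mod_cast (Fact.out : p.Prime).pos)

lemma norm_natCast_p_lt_one : ‖(p : K)‖ < 1 := by
  rw [norm_natCast_p]
  exact inv_lt_one_of_one_lt₀ (by exact_mod_cast (Fact.out : p.Prime).one_lt)

lemma mem_span_pow {x : OK K} {n : ℕ} :
    x ∈ Ideal.span {(p : OK K)} ^ n ↔ ‖(x : K)‖ ≤ ‖(p : K)‖ ^ n := by
  have hp := norm_natCast_p_pos (K := K) p
  rw [Ideal.span_singleton_pow, Ideal.mem_span_singleton]
  constructor
  · rintro ⟨y, rfl⟩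
    have hy := mem_OK.1 y.2
    push_cast
    rw [norm_mul, norm_pow]
    exact mul_le_of_le_one_right (by positivity) hy
  · intro h
    have hp0 : (p : K) ≠ 0 := norm_pos_iff.1 hp
    refine ⟨⟨(x : K) / (p : K) ^ n, mem_OK.2 ?_⟩, ?_⟩
    · rw [norm_div, norm_pow]
      exact div_le_one_of_le₀ h (by positivity)
    · apply Subtype.ext
      push_cast
      field_simp

instance fact_not_isUnit : Fact (¬ IsUnit (p : OK K)) := ⟨fun h ↦ by
  have h1 : (1 : OK K) ∈ Ideal.span {(p : OK K)} ^ 1 := by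
    rw [pow_one, Ideal.span_singleton_eq_top.2 h]
    trivial
  rw [mem_span_pow] at h1
  have h2 := norm_natCast_p_lt_one (K := K) p
  simp at h1
  linarith⟩

instance isAdicComplete_OK [CompleteSpace K] :
    IsAdicComplete (Ideal.span {(p : OK K)}) (OK K) where
  haus' x hx := by
    have h : ∀ n : ℕ, ‖(x : K)‖ ≤ ‖(p : K)‖ ^ n := fun n ↦ by
      have := hx n
      rw [SModEq.zero, smul_eq_mul, Ideal.mul_top] at this
      exact (mem_span_pow p).1 this
    have h0 := ge_of_tendsto' (tendsto_pow_atTop_nhds_zero_of_lt_one (norm_nonneg _)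
      (norm_natCast_p_lt_one (K := K) p)) h
    exact Subtype.ext (norm_le_zero_iff.1 h0)
  prec' f hf := by
    have h : ∀ m n : ℕ, m ≤ n → ‖(f n : K) - f m‖ ≤ ‖(p : K)‖ ^ m := fun m n hmn ↦ by
      have := hf hmn
      rw [SModEq.sub_mem, smul_eq_mul, Ideal.mul_top, mem_span_pow] at this
      rw [norm_sub_rev]
      exact_mod_cast this
    have ht := tendsto_pow_atTop_nhds_zero_of_lt_one (norm_nonneg _)
      (norm_natCast_p_lt_one (K := K) p)
    have hc : CauchySeq (fun n ↦ (f n : K)) := by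
      refine cauchySeq_of_le_tendsto_0' (fun n ↦ ‖(p : K)‖ ^ n) (fun m n hmn ↦ ?_) ht
      rw [dist_comm, dist_eq_norm]
      exact h m n hmn
    obtain ⟨L, hL⟩ := cauchySeq_tendsto_of_complete hc
    have hL1 : L ∈ OK K := mem_OK.2
      (le_of_tendsto' hL.norm fun n ↦ mem_OK.1 (f n).2)
    refine ⟨⟨L, hL1⟩, fun n ↦ ?_⟩
    rw [SModEq.sub_mem, smul_eq_mul, Ideal.mul_top, mem_span_pow]
    push_cast
    rw [norm_sub_rev]
    refine le_of_tendsto (hL.sub_const (f n : K)).norm ?_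
    filter_upwards [Filter.eventually_ge_atTop n] with k hk
    exact h n k hk

end Integers

/-- `K` (a complete nonarchimedean field over `ℚ_p`) is perfectoid: its value group is not
discrete, and the `p`-power map on `O_K / p` is surjective. -/
structure IsPerfectoid (p : ℕ) (K : Type u) [NormedField K] [IsUltrametricDist K] : Prop where
  nondiscrete : ∀ r : ℝ, r < 1 → ∃ x : K, r < ‖x‖ ∧ ‖x‖ < 1
  frobenius_surjective :
    Function.Surjective fun x : OK K ⧸ Ideal.span {(p : OK K)} ↦ x ^ p

/-- A compatible system `1, ζ_p, ζ_{p²}, …` of primitive `p`-power roots of unity of `K`.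
Such a system exists if and only if `K` contains all `p`-power roots of unity. -/
structure RootSystem (p : ℕ) (K : Type u) [NormedField K] [IsUltrametricDist K] where
  root : ℕ → OK K
  root_zero : root 0 = 1
  root_succ_pow : ∀ n, root (n + 1) ^ p = root n
  root_one_ne : root 1 ≠ 1

/-! ### Period rings -/

section PeriodRings

variable (p : ℕ) [Fact p.Prime] {K : Type u} [NormedField K] [IsUltrametricDist K]
  [NormedAlgebra ℚ_[p] K]

/-- The tilt `O_K^♭`. -/
abbrev Tilt (K : Type u) [NormedField K] [IsUltrametricDist K]
    [NormedAlgebra ℚ_[p] K] : Type u :=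
  PreTilt (OK K) p

/-- `A_inf = W(O_K^♭)`. -/
abbrev Ainf (K : Type u) [NormedField K] [IsUltrametricDist K]
    [NormedAlgebra ℚ_[p] K] : Type u :=
  WittVector p (Tilt p K)

variable {p}

/-- The element `ε = (1, ζ_p, ζ_{p²}, …)` of the tilt. -/
def RootSystem.eps (ζ : RootSystem p K) : Tilt p K :=
  ⟨fun n ↦ Ideal.Quotient.mk _ (ζ.root n), fun n ↦ by
    rw [← map_pow, ζ.root_succ_pow]⟩

/-- `[φ⁻¹(ε)] = φ⁻¹([ε])` in `A_inf`. -/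
def RootSystem.teichEpsRoot (ζ : RootSystem p K) : Ainf p K :=
  WittVector.teichmuller p ((frobeniusEquiv (Tilt p K) p).symm ζ.eps)

/-- The element `ξ = ([ε] - 1) / (φ⁻¹[ε] - 1)` of `A_inf`, written without a division as
`1 + φ⁻¹[ε] + ⋯ + (φ⁻¹[ε])^(p - 1)`. -/
def RootSystem.xi (ζ : RootSystem p K) : Ainf p K :=
  ∑ i ∈ Finset.range p, ζ.teichEpsRoot ^ i

lemma RootSystem.xi_mul (ζ : RootSystem p K) :
    ζ.xi * (ζ.teichEpsRoot - 1) = WittVector.teichmuller p ζ.eps - 1 := by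
  rw [RootSystem.xi, geom_sum_mul, RootSystem.teichEpsRoot, ← map_pow]
  congr 2
  exact (frobeniusEquiv (Tilt p K) p).apply_symm_apply ζ.eps

/-- `A_inf,e = A_inf / ξ^e`. -/
abbrev AinfE (ζ : RootSystem p K) (e : ℕ) : Type u :=
  Ainf p K ⧸ Ideal.span {ζ.xi ^ e}

variable [CompleteSpace K]

variable (p K) in
/-- Fontaine's ring `B_dR^+`. -/
abbrev BdR : Type u := BDeRhamPlus (OK K) p

variable (p K) in
/-- The natural map `A_inf → A_inf[1/p] → B_dR^+`. -/
def ainfToBdR : Ainf p K →+* BdR p K :=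
  RingHom.comp
    (algebraMap (Localization.Away (p : Ainf p K))
      (AdicCompletion (RingHom.ker (fontaineThetaInvertP (OK K) p))
        (Localization.Away (p : Ainf p K))) :
      Localization.Away (p : Ainf p K) →+* BDeRhamPlus (OK K) p)
    (algebraMap (Ainf p K) (Localization.Away (p : Ainf p K)))

/-- `ξ` as an element of `B_dR^+`. -/
def RootSystem.xiBdR (ζ : RootSystem p K) : BdR p K := ainfToBdR p K ζ.xi

/-- `B_dR,e^+ = B_dR^+ / ξ^e`. -/
abbrev BdRE (ζ : RootSystem p K) (e : ℕ) : Type u :=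
  BdR p K ⧸ Ideal.span {ζ.xiBdR ^ e}

/-- The natural map `A_inf,e → B_dR,e^+`. -/
def ainfEToBdRE (ζ : RootSystem p K) (e : ℕ) : AinfE ζ e →+* BdRE ζ e :=
  Ideal.quotientMap _ (ainfToBdR p K) (by
    rw [Ideal.span_singleton_le_iff_mem, Ideal.mem_comap, map_pow]
    exact Ideal.mem_span_singleton_self _)

/-- The transition map `B_dR,e+1^+ → B_dR,e^+`. -/
def bdRETransition (ζ : RootSystem p K) (e : ℕ) : BdRE ζ (e + 1) →+* BdRE ζ e :=
  Ideal.Quotient.factor (by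
    rw [Ideal.span_singleton_le_span_singleton]
    exact pow_dvd_pow _ (Nat.le_succ e))

end PeriodRings

/-! ### Tate algebras -/

section Tate

/-- `R⟨σ⟩` for a `p`-adically complete ring `R`: the power series whose coefficients tend to
zero `p`-adically. -/
def restricted (R : Type u) [CommRing R] (p : ℕ) (σ : Type) :
    Subalgebra R (MvPowerSeries σ R) where
  carrier := {f | ∀ n : ℕ,
    {m : σ →₀ ℕ | MvPowerSeries.coeff m f ∉ Ideal.span {(p : R)} ^ n}.Finite}
  mul_mem' {f g} hf hg n := by
    classical
    refine (((hf n).prod (hg n)).image fun x ↦ x.1 + x.2).subset fun m hm ↦ ?_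
    by_contra hcon
    refine hm ?_
    rw [MvPowerSeries.coeff_mul]
    refine Ideal.sum_mem _ fun x hx ↦ ?_
    by_cases h1 : MvPowerSeries.coeff x.1 f ∈ Ideal.span {(p : R)} ^ n
    · exact Ideal.mul_mem_right _ _ h1
    by_cases h2 : MvPowerSeries.coeff x.2 g ∈ Ideal.span {(p : R)} ^ n
    · exact Ideal.mul_mem_left _ _ h2
    exact absurd ⟨x, ⟨h1, h2⟩, Finset.HasAntidiagonal.mem_antidiagonal.1 hx⟩ hcon
  add_mem' {f g} hf hg n := by
    refine ((hf n).union (hg n)).subset fun m hm ↦ ?_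
    by_contra hcon
    simp only [Set.mem_union, Set.mem_ofPred_eq, not_or, not_not] at hcon
    exact hm (by rw [map_add]; exact Ideal.add_mem _ hcon.1 hcon.2)
  algebraMap_mem' r n := by
    classical
    refine (Set.finite_singleton (0 : σ →₀ ℕ)).subset fun m hm ↦ ?_
    by_contra hcon
    refine hm ?_
    rw [MvPowerSeries.algebraMap_apply, MvPowerSeries.coeff_C,
      if_neg fun h ↦ hcon (Set.mem_singleton_iff.2 h)]
    exact Ideal.zero_mem _

lemma X_mem_restricted (R : Type u) [CommRing R] (p : ℕ) (σ : Type) (s : σ) :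
    (MvPowerSeries.X s : MvPowerSeries σ R) ∈ restricted R p σ := fun n ↦ by
  classical
  refine (Set.finite_singleton (Finsupp.single s 1)).subset fun m hm ↦ ?_
  by_contra hcon
  refine hm ?_
  rw [MvPowerSeries.coeff_X, if_neg fun h ↦ hcon (Set.mem_singleton_iff.2 h)]
  exact Ideal.zero_mem _

variable {p : ℕ} [Fact p.Prime] {K : Type u} [NormedField K] [IsUltrametricDist K]
  [NormedAlgebra ℚ_[p] K] [CompleteSpace K]

/-- `B_dR,e^+⟨σ⟩ = A_inf,e⟨σ⟩[1/p]`, realised as the `B_dR,e^+`-subalgebra of the power series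
ring over `B_dR,e^+` generated by the image of `A_inf,e⟨σ⟩` (recall `B_dR,e^+ = A_inf,e[1/p]`). -/
def bdRETate (ζ : RootSystem p K) (e : ℕ) (σ : Type) :
    Subalgebra (BdRE ζ e) (MvPowerSeries σ (BdRE ζ e)) :=
  Algebra.adjoin (BdRE ζ e)
    (MvPowerSeries.map (ainfEToBdRE ζ e) '' (restricted (AinfE ζ e) p σ : Set _))

lemma X_mem_bdRETate (ζ : RootSystem p K) (e : ℕ) (σ : Type) (s : σ) :
    (MvPowerSeries.X s : MvPowerSeries σ (BdRE ζ e)) ∈ bdRETate ζ e σ :=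
  Algebra.subset_adjoin ⟨MvPowerSeries.X s, X_mem_restricted _ p σ s, MvPowerSeries.map_X _ s⟩

/-- `B_dR^+⟨σ⟩ = lim_e B_dR,e^+⟨σ⟩`: the compatible families in `∏_e B_dR,e^+⟨σ⟩`. -/
def bdRTate (ζ : RootSystem p K) (σ : Type) :
    Subalgebra (BdR p K) (∀ e : ℕ, MvPowerSeries σ (BdRE ζ e)) where
  carrier := {F | (∀ e, F e ∈ bdRETate ζ e σ) ∧
    ∀ e, MvPowerSeries.map (bdRETransition ζ e) (F (e + 1)) = F e}
  mul_mem' {F G} hF hG := ⟨fun e ↦ mul_mem (hF.1 e) (hG.1 e), fun e ↦ by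
    rw [Pi.mul_apply, map_mul, hF.2, hG.2, Pi.mul_apply]⟩
  add_mem' {F G} hF hG := ⟨fun e ↦ add_mem (hF.1 e) (hG.1 e), fun e ↦ by
    rw [Pi.add_apply, map_add, hF.2, hG.2, Pi.add_apply]⟩
  algebraMap_mem' r := by
    refine ⟨fun e ↦ ?_, fun e ↦ ?_⟩
    · rw [Pi.algebraMap_apply, MvPowerSeries.algebraMap_apply]
      exact (bdRETate ζ e σ).algebraMap_mem (Ideal.Quotient.mk _ r)
    · simp only [Pi.algebraMap_apply, MvPowerSeries.algebraMap_apply, MvPowerSeries.map_C]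
      rfl

lemma X_mem_bdRTate (ζ : RootSystem p K) (σ : Type) (s : σ) :
    (fun e ↦ (MvPowerSeries.X s : MvPowerSeries σ (BdRE ζ e))) ∈ bdRTate ζ σ :=
  ⟨fun e ↦ X_mem_bdRETate ζ e σ s, fun _ ↦ MvPowerSeries.map_X _ s⟩

end Tate

/-- A family of "Tate algebras" over `R`, one for each set of variables, with the variables as
distinguished elements.  Only the three instances below are used. -/
structure TateFamily (R : Type u) [CommRing R] where
  alg : Type → Type u
  [commRing : ∀ σ, CommRing (alg σ)]
  [algebra : ∀ σ, Algebra R (alg σ)]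
  var : ∀ {σ : Type}, σ → alg σ

attribute [instance] TateFamily.commRing TateFamily.algebra

section Families

variable {p : ℕ} [Fact p.Prime] {K : Type u} [NormedField K] [IsUltrametricDist K]
  [NormedAlgebra ℚ_[p] K]

/-- The Tate algebras `A_inf,e⟨σ⟩`. -/
def ainfEFamily (ζ : RootSystem p K) (e : ℕ) : TateFamily (AinfE ζ e) where
  alg σ := restricted (AinfE ζ e) p σ
  var s := ⟨MvPowerSeries.X s, X_mem_restricted _ _ _ s⟩

variable [CompleteSpace K]

/-- The Tate algebras `B_dR,e^+⟨σ⟩`. -/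
def bdREFamily (ζ : RootSystem p K) (e : ℕ) : TateFamily (BdRE ζ e) where
  alg σ := bdRETate ζ e σ
  var s := ⟨MvPowerSeries.X s, X_mem_bdRETate _ _ _ s⟩

/-- The Tate algebras `B_dR^+⟨σ⟩`. -/
def bdRFamily (ζ : RootSystem p K) : TateFamily (BdR p K) where
  alg σ := bdRTate ζ σ
  var s := ⟨fun _ ↦ MvPowerSeries.X s, X_mem_bdRTate _ _ s⟩

end Families

/-- `B` is topologically finitely presented: `B ≅ R⟨x_1, …, x_n⟩ / J` with `J` finitely
generated. -/
def TateFamily.IsTopFinitelyPresented {R : Type u} [CommRing R] (T : TateFamily R)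
    (B : Type u) [CommRing B] [Algebra R B] : Prop :=
  ∃ (n : ℕ) (f : T.alg (Fin n) →ₐ[R] B),
    Function.Surjective f ∧ (RingHom.ker f).FG

/-! ### Pairs, simplicial pairs and resolutions -/

section Pairs

variable (R : Type u) [CommRing R]

/-- A pair: a commutative `R`-algebra together with an ideal. -/
structure AlgPair where
  alg : Type u
  [commRing : CommRing alg]
  [algebra : Algebra R alg]
  ideal : Ideal alg

attribute [instance] AlgPair.commRing AlgPair.algebra

variable {R}

/-- Maps of pairs: `R`-algebra maps sending the ideal into the ideal. -/
@[ext]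
structure AlgPair.Hom (P Q : AlgPair R) where
  toAlgHom : P.alg →ₐ[R] Q.alg
  map_mem : ∀ x ∈ P.ideal, toAlgHom x ∈ Q.ideal

instance : Category (AlgPair R) where
  Hom := AlgPair.Hom
  id P := ⟨AlgHom.id R P.alg, fun _ hx ↦ hx⟩
  comp f g := ⟨g.toAlgHom.comp f.toAlgHom, fun x hx ↦ g.map_mem _ (f.map_mem x hx)⟩

/-- The map induced on ideals by a map of pairs. -/
def AlgPair.Hom.idealMap {P Q : AlgPair R} (f : AlgPair.Hom P Q) :
    P.ideal.restrictScalars R →ₗ[R] Q.ideal.restrictScalars R :=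
  f.toAlgHom.toLinearMap.restrict f.map_mem

variable (R)

/-- The functor sending a pair `(A, I)` to the `R`-module `A`. -/
def algFunctor : AlgPair R ⥤ ModuleCat.{u} R where
  obj P := ModuleCat.of R P.alg
  map f := ModuleCat.ofHom f.toAlgHom.toLinearMap

/-- The functor sending a pair `(A, I)` to the `R`-module `I`. -/
def idealFunctor : AlgPair R ⥤ ModuleCat.{u} R where
  obj P := ModuleCat.of R (P.ideal.restrictScalars R)
  map f := ModuleCat.ofHom f.idealMap

variable {R}

/-- A map of simplicial `R`-modules is a quasi-isomorphism if it is one on the associated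
(alternating face map) chain complexes, that is, if it is bijective on all homotopy groups. -/
def IsSimplicialQuasiIso {M N : SimplicialObject (ModuleCat.{u} R)} (f : M ⟶ N) : Prop :=
  QuasiIso ((AlgebraicTopology.alternatingFaceMapComplex (ModuleCat.{u} R)).map f)

/-- A map of simplicial pairs is a quasi-isomorphism if it is one on the simplicial algebras and
on the simplicial ideals. -/
def IsPairQuasiIso {P Q : SimplicialObject (AlgPair R)} (f : P ⟶ Q) : Prop :=
  IsSimplicialQuasiIso (Functor.whiskerRight f (algFunctor R)) ∧
  IsSimplicialQuasiIso (Functor.whiskerRight f (idealFunctor R))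

/-- The pair `(R⟨X, Y⟩, (Y))`. -/
def TateFamily.pair (T : TateFamily R) (X Y : Type) : AlgPair R where
  alg := T.alg (X ⊕ Y)
  ideal := Ideal.span (Set.range fun y : Y ↦ T.var (Sum.inr y : X ⊕ Y))

/-- `(B, I)` admits a simplicial resolution `(R⟨X_•, Y_•⟩, (Y_•)) → (B, I)`, where every `X_n` and
every `Y_n` is finite, and `(B, I)` is regarded as a constant simplicial pair. -/
def TateFamily.HasResolution (T : TateFamily R) (Q : AlgPair R) : Prop :=
  ∃ (P : SimplicialObject (AlgPair R)) (f : P ⟶ (SimplicialObject.const (AlgPair R)).obj Q),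
    (∀ n : ℕ, ∃ (X Y : Type) (_ : Finite X) (_ : Finite Y),
      Nonempty (P.obj (Opposite.op (SimplexCategory.mk n)) ≅ T.pair X Y)) ∧
    IsPairQuasiIso f

end Pairs

end TateRes

end

/-! The resolution is built by attaching cells, as one kills homotopy groups. Start from a constant
simplicial Tate algebra `A⟨X, Y⟩` that maps onto `B` and carries `(Y)` onto `I`. In stage `n`,
attach cells of dimension `n + 1` along generators of the ideal of cycles of degree `n` and, with
distinguished variables, along generators of its intersection with the ideal of the pair
(`Stage.exists_cells`, `Stage.Cells.exists_filling`). Stage `n` does not change the degrees up to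
`n`, so the colimit has finitely many variables in each degree. The Dold–Kan projector turns the
filling of cycles into exactness of the alternating face complexes (`exists_d_eq`).

The difficulty is finite generation, since `O_K` is not Noetherian. In positive degree the cycles
are the common kernel of face maps into `p`-torsion free rings, hence a `p`-saturated ideal.
Saturated ideals of `O_K⟨X⟩` are finitely generated by a Gröbner division argument that looks only
at coefficients of norm one (`exists_division`, `OK.fg_of_saturated`). Evaluation in square-zero
extensions passes from ideals to submodules of finite free modules (`satFG_restricted`), and
dévissage along `ξ` passes from `O_K` to `A_inf,e` (`SatFG.of_nilpotent_thickening`). Submodules are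
needed for this dévissage, and also show that intersections of finitely generated ideals are
finitely generated (`SatFG.inf_fg`). The inputs from `A_inf` are that `p, ξ` is a regular sequence
and that `ξ` generates the kernel of `θ`; both come from norms of `p`-power roots of unity.

After inverting `p`, every ideal has a saturated contraction, so `B_dR,e^+⟨X⟩` is Noetherian;
`B_dR^+⟨X⟩` is `ξ`-adically complete with Noetherian reduction, so it is Noetherian too
(`isNoetherianRing_of_adic`).

Homomorphisms out of `A_inf,e⟨X⟩` are evaluations, by `p`-adic completeness. Once `p` is inverted,
the variables are sent only to elements that are integral up to nilpotents (`almostIntegral`).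
Uniqueness is used in a strong form: the difference of two homomorphisms takes values in the ideal
generated by the differences on the variables. `TateFamily.Calculus` collects what the attachment of
cells needs, so that the three base rings are treated together. -/

noncomputable section

set_option linter.unusedSectionVars false

namespace TateRes

/-! ### `p`-adically separated and complete groups -/

section PAdic

/-- `M` is `a`-adically separated. -/
def PSep {R : Type*} [Semiring R] (a : R) (M : Type*) [AddCommGroup M] [Module R M] : Prop :=
  ∀ x : M, (∀ n : ℕ, ∃ y : M, x = a ^ n • y) → x = 0

/-- Every series `∑ a ^ k • g k` in `M` converges `a`-adically. -/
def PSum {R : Type*} [Semiring R] (a : R) (M : Type*) [AddCommGroup M] [Module R M] : Prop :=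
  ∀ g : ℕ → M, ∃ s : M, ∀ n : ℕ, ∃ y : M, s = ∑ k ∈ Finset.range n, a ^ k • g k + a ^ n • y

variable {p : ℕ} {M N : Type*} [AddCommGroup M] [AddCommGroup N]

/-- Completeness is split into two halves because they have different permanence: convergence of
series passes to quotients, separatedness to subgroups. `PSum` does not ask the sum to be unique. -/
lemma PSum.of_surjective (φ : M →+ N) (hφ : Function.Surjective φ) (hM : PSum p M) :
    PSum p N := fun g ↦ by
  choose f hf using fun k ↦ hφ (g k)
  obtain ⟨s, hs⟩ := hM f
  refine ⟨φ s, fun n ↦ ?_⟩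
  obtain ⟨y, hy⟩ := hs n
  exact ⟨φ y, by rw [hy]; simp [hf]⟩

lemma PSep.of_injective (φ : M →+ N) (hφ : Function.Injective φ) (hN : PSep p N) :
    PSep p M := fun x hx ↦ by
  refine hφ ?_
  rw [map_zero]
  refine hN _ fun n ↦ ?_
  obtain ⟨y, hy⟩ := hx n
  exact ⟨φ y, by rw [hy, map_nsmul]⟩

/-- Successive approximation: the errors `b^[k] y` give a series of partial preimages, whose sum
maps to `y`. Only convergence in the source and separatedness in the target enter. The scalar `a` is
`p` in most applications and `ξ` over `B_dR^+`. -/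
lemma surjective_of_approx_linear {R : Type*} [Semiring R] {a : R} [Module R M] [Module R N]
    (φ : M →ₗ[R] N) (hM : PSum a M) (hN : PSep a N)
    (h : ∀ y : N, ∃ (x : M) (z : N), y = φ x + a • z) : Function.Surjective φ := fun y ↦ by
  choose f b hab using h
  obtain ⟨s, hs⟩ := hM fun k ↦ f (b^[k] y)
  have hg : ∀ n, y = φ (∑ k ∈ Finset.range n, a ^ k • f (b^[k] y)) + a ^ n • b^[n] y := fun n ↦ by
    induction n with
    | zero => simp
    | succ n ih =>
      rw [Finset.sum_range_succ, map_add, map_smul, add_assoc, pow_succ, mul_smul,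
        Function.iterate_succ_apply', ← smul_add, ← hab]
      exact ih
  refine ⟨s, (sub_eq_zero.1 (hN _ fun n ↦ ?_))⟩
  obtain ⟨t, ht⟩ := hs n
  refine ⟨φ t - b^[n] y, ?_⟩
  have h1 := hg n
  rw [ht, map_add, map_smul, smul_sub, sub_eq_sub_iff_add_eq_add, add_right_comm, ← h1, add_comm]

lemma surjective_of_approx (φ : M →+ N) (hM : PSum p M) (hN : PSep p N)
    (h : ∀ y : N, ∃ (x : M) (z : N), y = φ x + p • z) : Function.Surjective φ :=
  surjective_of_approx_linear φ.toNatLinearMap hM hN h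

lemma mem_span_natCast_pow {R : Type*} [CommRing R] {x : R} {n : ℕ} :
    x ∈ Ideal.span {(p : R)} ^ n ↔ ∃ y, x = p ^ n • y := by
  rw [Ideal.span_singleton_pow, Ideal.mem_span_singleton]
  simp [dvd_def, nsmul_eq_mul]

lemma PSep.of_isAdicComplete (R : Type*) [CommRing R] [IsAdicComplete (Ideal.span {(p : R)}) R] :
    PSep p R := fun x hx ↦ by
  refine IsHausdorff.haus (I := Ideal.span {(p : R)}) inferInstance x fun n ↦ ?_
  rw [SModEq.zero, smul_eq_mul, Ideal.mul_top, mem_span_natCast_pow]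
  exact hx n

lemma PSum.of_isAdicComplete (R : Type*) [CommRing R] [IsAdicComplete (Ideal.span {(p : R)}) R] :
    PSum p R := fun g ↦ by
  obtain ⟨s, hs⟩ := IsPrecomplete.prec (I := Ideal.span {(p : R)}) inferInstance
    (f := fun n ↦ ∑ k ∈ Finset.range n, p ^ k • g k) (fun {m n} hmn ↦ by
      rw [SModEq.sub_mem, smul_eq_mul, Ideal.mul_top, ← neg_mem_iff, neg_sub,
        ← Finset.sum_Ico_eq_sub _ hmn]
      refine Ideal.sum_mem _ fun k hk ↦ ?_
      rw [mem_span_natCast_pow]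
      refine ⟨p ^ (k - m) • g k, ?_⟩
      rw [← mul_smul, ← pow_add, Nat.add_sub_cancel' (Finset.mem_Ico.1 hk).1])
  refine ⟨s, fun n ↦ ?_⟩
  have := hs n
  rw [SModEq.sub_mem, smul_eq_mul, Ideal.mul_top, ← neg_mem_iff, neg_sub,
    mem_span_natCast_pow] at this
  obtain ⟨y, hy⟩ := this
  exact ⟨y, by rw [← hy]; abel⟩

end PAdic

/-! ### Multiplication by `p` and `ξ` on `A_inf` -/

section Tilt

variable {p : ℕ} [Fact p.Prime] {K : Type u} [NormedField K] [IsUltrametricDist K]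
  [NormedAlgebra ℚ_[p] K] [CompleteSpace K]

lemma OK.p_torsionFree (x : OK K) (hx : p • x = 0) : x = 0 := by
  have hp : (p : K) ≠ 0 := norm_pos_iff.1 (norm_natCast_p_pos (K := K) p)
  have := congrArg (Subtype.val) hx
  simp only [nsmul_eq_mul, Subring.coe_mul, ZeroMemClass.coe_zero, mul_eq_zero] at this
  exact Subtype.ext (this.resolve_left (by simpa using hp))

lemma OK.norm_eq_one_of_pow {x : OK K} {n : ℕ} (hn : n ≠ 0) (h : ‖(x : K) ^ n‖ = 1) :
    ‖(x : K)‖ = 1 := by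
  rw [norm_pow] at h
  exact (pow_eq_one_iff_of_nonneg (norm_nonneg _) hn).1 h

/-- Expanding `(1 + (ζ_p - 1)) ^ p = 1` shows that `p` divides `(ζ_p - 1) ^ (p - 1)`. Conversely `p
= ∏ (1 - ζ_p ^ k)` has `p - 1` factors, each divisible by `ζ_p - 1`. -/
lemma RootSystem.norm_root_one_sub_one (ζ : RootSystem p K) :
    ‖((ζ.root 1 : OK K) : K) - 1‖ ^ (p - 1) = ‖(p : K)‖ := by
  have hp : p.Prime := Fact.out
  set z : K := ((ζ.root 1 : OK K) : K) with hz
  have hz1 : z ^ p = 1 := by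
    have := congrArg (Subtype.val) (ζ.root_succ_pow 0)
    rw [ζ.root_zero] at this
    simpa using this
  have hne : z ≠ 1 := fun h ↦ ζ.root_one_ne (Subtype.ext (by simpa [hz] using h))
  have hb : z - 1 ≠ 0 := sub_ne_zero.2 hne
  have hprim : IsPrimitiveRoot z (p - 1 + 1) := by
    rw [Nat.sub_add_cancel hp.one_lt.le, ← orderOf_eq_prime hz1 hne]
    exact IsPrimitiveRoot.orderOf z
  refine le_antisymm ?_ ?_
  · obtain ⟨r, hr⟩ := exists_add_pow_prime_eq hp (ζ.root 1 - 1 : OK K) 1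
    have hr' := congrArg (Subtype.val) hr
    push_cast at hr'
    rw [← hz, sub_add_cancel, hz1, one_pow, mul_one] at hr'
    have h2 : (z - 1) ^ (p - 1) = -(p * (r : K)) := by
      refine mul_right_cancel₀ hb ?_
      rw [← pow_succ, Nat.sub_add_cancel hp.one_lt.le]
      linear_combination -hr'
    rw [← norm_pow, h2, norm_neg, norm_mul]
    exact mul_le_of_le_one_right (norm_nonneg _) (mem_OK.1 r.2)
  · have h := hprim.prod_one_sub_pow_eq_order
    have h2 : ((p - 1 : ℕ) : K) + 1 = p := by
      rw [Nat.cast_sub hp.one_lt.le]; simp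
    rw [h2] at h
    rw [← h, norm_prod]
    refine (Finset.prod_le_prod (g := fun _ ↦ ‖z - 1‖) (fun k _ ↦ norm_nonneg _)
      fun k _ ↦ ?_).trans (by simp)
    rw [norm_sub_rev, ← geom_sum_mul z (k + 1), norm_mul]
    refine mul_le_of_le_one_left (norm_nonneg _) ?_
    have : ∑ i ∈ Finset.range (k + 1), z ^ i =
      ((∑ i ∈ Finset.range (k + 1), ζ.root 1 ^ i : OK K) : K) := by push_cast; rfl
    rw [this]
    exact mem_OK.1 (Subtype.property _)

/-- With `a = ζ_{p²} - 1` and `b = ζ_p - 1`, the geometric sum is `w = b / a`, and `‖b‖ ^ p = ‖p‖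
‖b‖` by the previous lemma. So the claim amounts to `‖a‖ ^ p ≤ ‖b‖`. -/
lemma RootSystem.norm_p_le_norm_geom_sum (ζ : RootSystem p K) :
    ‖(p : K)‖ ≤ ‖((∑ i ∈ Finset.range p, ζ.root 2 ^ i : OK K) : K)‖ ^ p := by
  have hp : p.Prime := Fact.out
  have hp0 := norm_natCast_p_pos (K := K) p
  have hb := ζ.norm_root_one_sub_one
  obtain ⟨r, hr⟩ := exists_add_pow_prime_eq hp (ζ.root 2 - 1 : OK K) 1
  rw [sub_add_cancel, ζ.root_succ_pow 1, one_pow, mul_one] at hr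
  have hr' := congrArg (Subtype.val) hr
  have hgs := congrArg (Subtype.val) (geom_sum_mul (ζ.root 2) p)
  rw [ζ.root_succ_pow 1] at hgs
  push_cast at hr' hgs ⊢
  set b : K := ((ζ.root 1 : OK K) : K) - 1 with hbdef
  set a : K := ((ζ.root 2 : OK K) : K) - 1 with ha
  set w : K := ∑ i ∈ Finset.range p, ((ζ.root 2 : OK K) : K) ^ i
  have hb0 : 0 < ‖b‖ := by
    refine (norm_nonneg b).lt_of_ne fun h ↦ ?_
    rw [← h, zero_pow (Nat.sub_ne_zero_of_lt hp.one_lt)] at hb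
    exact hp0.ne hb
  have ha1 : ‖a‖ ≤ 1 := mem_OK.1 (ζ.root 2 - 1 : OK K).2
  have ha0 : 0 < ‖a‖ := by
    refine norm_pos_iff.2 fun h ↦ ?_
    rw [h, mul_zero] at hgs
    rw [← hgs, norm_zero] at hb0
    exact hb0.false
  -- Otherwise the term `p a r` dominates in `a ^ p = b - p a r`, so `‖a‖ ^ (p - 1) ≤ ‖p‖ = ‖b‖ ^ (p
  -- - 1)`, and then `‖a‖ ^ p ≤ ‖a‖ ≤ ‖b‖` after all.
  have hab : ‖a‖ ^ p ≤ ‖b‖ := by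
    by_contra! hlt
    have h1 : a ^ p = b - p * a * r := by rw [hbdef, hr']; ring
    have h2 : ‖a‖ ^ p ≤ max ‖b‖ ‖(p : K) * a * r‖ := by
      rw [← norm_pow, h1, sub_eq_add_neg, ← norm_neg ((p : K) * a * r)]
      exact IsUltrametricDist.norm_add_le_max _ _
    have h3 : ‖a‖ ^ p ≤ ‖(p : K) * a * r‖ := (le_max_iff.1 h2).resolve_left hlt.not_ge
    have h4 : ‖a‖ ^ (p - 1) * ‖a‖ ≤ ‖(p : K)‖ * ‖a‖ := by
      rw [← pow_succ, Nat.sub_add_cancel hp.one_lt.le]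
      refine h3.trans ?_
      rw [norm_mul, norm_mul]
      exact mul_le_of_le_one_right (by positivity) (mem_OK.1 r.2)
    have h5 := le_of_mul_le_mul_right h4 ha0
    rw [← hb] at h5
    have h6 : ‖a‖ ≤ ‖b‖ :=
      le_of_pow_le_pow_left₀ (Nat.sub_ne_zero_of_lt hp.one_lt) (norm_nonneg b) h5
    exact hlt.not_ge ((pow_le_of_le_one (norm_nonneg a) ha1 hp.ne_zero).trans h6)
  have h1 : ‖w‖ * ‖a‖ = ‖b‖ := by rw [← norm_mul, hgs]
  have h2 : ‖w‖ ^ p * ‖a‖ ^ p = ‖(p : K)‖ * ‖b‖ := by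
    rw [← mul_pow, h1, ← hb, ← pow_succ, Nat.sub_add_cancel hp.one_lt.le]
  refine le_of_mul_le_mul_right ?_ (pow_pos ha0 p)
  rw [h2]
  exact mul_le_mul_of_nonneg_left hab (norm_nonneg _)

/-- The `n`-th component of the sequence of `p`-power roots attached to an element of the tilt. -/
def sharp (n : ℕ) (x : Tilt p K) : OK K := (((frobeniusEquiv (Tilt p K) p).symm)^[n] x).untilt

lemma mk_sharp (n : ℕ) (x : Tilt p K) :
    Ideal.Quotient.mk (Ideal.span {(p : OK K)}) (sharp n x) = PreTilt.coeff n x := by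
  rw [sharp, PreTilt.mk_untilt_eq_coeff_zero, PreTilt.coeff_iterate_frobeniusEquiv_symm]
  simp

lemma sharp_pow (n : ℕ) (x : Tilt p K) : sharp n x ^ p ^ n = x.untilt :=
  PreTilt.untilt_iterate_frobeniusEquiv_symm_pow x n

lemma sharp_succ_pow (n : ℕ) (x : Tilt p K) : sharp (n + 1) x ^ p = sharp n x := by
  have := sharp_pow 1 ((frobeniusEquiv (Tilt p K) p).symm^[n] x)
  rw [pow_one] at this
  rw [sharp, sharp, ← this, sharp, Function.iterate_succ_apply' _ n]
  rfl

/-- The untilt `t` of `0` satisfies `t ^ p = t` and `p ∣ t`, and a nonzero solution of the first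
equation has norm one. -/
lemma untilt_zero : (0 : Tilt p K).untilt = 0 := by
  have hp : p.Prime := Fact.out
  have h1 := sharp_succ_pow 0 (0 : Tilt p K)
  have h0 : sharp 0 (0 : Tilt p K) = (0 : Tilt p K).untilt := rfl
  have h2 : sharp (0 + 1) (0 : Tilt p K) = (0 : Tilt p K).untilt := by
    simp [sharp]
  rw [h0, h2] at h1
  have h3 := mk_sharp 0 (0 : Tilt p K)
  rw [h0, map_zero (PreTilt.coeff 0), Ideal.Quotient.eq_zero_iff_mem, ← pow_one (Ideal.span _), mem_span_pow,
    pow_one] at h3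
  set t : OK K := (0 : Tilt p K).untilt
  by_contra hne
  have h4 : (t : K) ^ (p - 1) = 1 := by
    refine mul_right_cancel₀ (b := (t : K)) (fun h ↦ hne (Subtype.ext h)) ?_
    rw [← pow_succ, Nat.sub_add_cancel hp.one_lt.le, one_mul]
    exact_mod_cast congrArg Subtype.val h1
  have h5 := OK.norm_eq_one_of_pow (Nat.sub_ne_zero_of_lt hp.one_lt) (by rw [h4, norm_one])
  have := norm_natCast_p_lt_one (K := K) p
  linarith

lemma sharp_eq_zero {x : Tilt p K} (hx : x.untilt = 0) (n : ℕ) : sharp n x = 0 :=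
  eq_zero_of_pow_eq_zero ((sharp_pow n x).trans hx)

lemma eq_zero_of_untilt_eq_zero {x : Tilt p K} (hx : x.untilt = 0) : x = 0 := by
  refine Perfection.ext fun n ↦ ?_
  have := mk_sharp n x
  rw [sharp_eq_zero hx, map_zero] at this
  exact this.symm.trans (map_zero _).symm

lemma tilt_regular {x y : Tilt p K} (hy : y.untilt ≠ 0) (h : y * x = 0) : x = 0 := by
  refine eq_zero_of_untilt_eq_zero ?_
  have := congrArg PreTilt.untilt h
  rw [map_mul, untilt_zero] at this
  exact (mul_eq_zero.1 this).resolve_left hy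

/-- Divisibility in the tilt is decided by norms, as in a valuation ring. The quotients of
corresponding `p`-power roots lie in `O_K`, because their `p ^ n`-th powers do, and they form again
a compatible system of `p`-th roots. -/
lemma tilt_dvd {x y : Tilt p K} (hy : y.untilt ≠ 0)
    (h : ‖((x.untilt : OK K) : K)‖ ≤ ‖((y.untilt : OK K) : K)‖) : y ∣ x := by
  have hy' : ∀ n, ((sharp n y : OK K) : K) ≠ 0 := fun n h0 ↦ hy (by
    rw [← sharp_pow n y, show sharp n y = 0 from Subtype.ext h0,
      zero_pow (pow_ne_zero _ (Fact.out : p.Prime).ne_zero)])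
  have hle : ∀ n, ‖((sharp n x : OK K) : K) / (sharp n y : OK K)‖ ≤ 1 := fun n ↦ by
    rw [norm_div]
    refine div_le_one_of_le₀ ?_ (norm_nonneg _)
    refine le_of_pow_le_pow_left₀ (pow_ne_zero n (Fact.out : p.Prime).ne_zero) (norm_nonneg _) ?_
    rw [← norm_pow, ← norm_pow]
    have h1 := congrArg Subtype.val (sharp_pow n x)
    have h2 := congrArg Subtype.val (sharp_pow n y)
    push_cast at h1 h2
    rwa [h1, h2]
  let q : ℕ → OK K := fun n ↦ ⟨_, mem_OK.2 (hle n)⟩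
  have hq : ∀ n, q (n + 1) ^ p = q n := fun n ↦ by
    apply Subtype.ext
    have h1 := congrArg Subtype.val (sharp_succ_pow n x)
    have h2 := congrArg Subtype.val (sharp_succ_pow n y)
    push_cast at h1 h2
    simp only [q, SubmonoidClass.coe_pow, div_pow, h1, h2]
  have hqy : ∀ n, sharp n y * q n = sharp n x := fun n ↦ by
    apply Subtype.ext
    simp only [q, Subring.coe_mul]
    exact mul_div_cancel₀ _ (hy' n)
  let z : Tilt p K := ⟨fun n ↦ Ideal.Quotient.mk _ (q n), fun n ↦ by rw [← map_pow, hq]⟩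
  refine ⟨z, Perfection.ext fun n ↦ ?_⟩
  have h1 : PreTilt.coeff n x = PreTilt.coeff n y * PreTilt.coeff n z := by
    rw [← mk_sharp, ← hqy, map_mul, mk_sharp]
    rfl
  exact h1.trans (map_mul (PreTilt.coeff n) y z).symm

/-- The reduction of `ξ` modulo `p`. -/
def RootSystem.xiTilt (ζ : RootSystem p K) : Tilt p K :=
  ∑ i ∈ Finset.range p, ((frobeniusEquiv (Tilt p K) p).symm ζ.eps) ^ i

lemma RootSystem.coeff_xiTilt (ζ : RootSystem p K) (n : ℕ) :
    PreTilt.coeff n ζ.xiTilt =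
      Ideal.Quotient.mk _ (∑ i ∈ Finset.range p, ζ.root (n + 1) ^ i) := by
  rw [xiTilt, map_sum, map_sum]
  refine Finset.sum_congr rfl fun i _ ↦ ?_
  rw [map_pow, map_pow, PreTilt.coeff_frobeniusEquiv_symm]
  rfl

/-- The element `sharp 1` is congruent modulo `p` to the geometric sum `w` in `ζ_{p²}`. Since `‖w‖ >
‖p‖`, the congruence preserves the norm, and the untilt is the `p`-th power of `sharp 1`. -/
lemma RootSystem.norm_p_le_untilt_xiTilt (ζ : RootSystem p K) :
    ‖(p : K)‖ ≤ ‖((ζ.xiTilt.untilt : OK K) : K)‖ := by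
  have hp : p.Prime := Fact.out
  have hp0 := norm_natCast_p_pos (K := K) p
  have hp1 := norm_natCast_p_lt_one (K := K) p
  -- Component `0` is the class of `∑ ζ_p ^ i = 0` and only bounds the norm from above, so component
  -- `1` is used.
  have h1 := mk_sharp 1 ζ.xiTilt
  rw [ζ.coeff_xiTilt, Ideal.Quotient.eq, ← pow_one (Ideal.span _), mem_span_pow, pow_one] at h1
  have h2 := ζ.norm_p_le_norm_geom_sum
  set w : OK K := ∑ i ∈ Finset.range p, ζ.root (1 + 1) ^ i with hw
  have h3 : ‖(p : K)‖ < ‖(w : K)‖ := by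
    by_contra! hle
    have h5 := pow_le_pow_left₀ (norm_nonneg _) hle p
    have h6 := pow_lt_self_of_lt_one₀ hp0 hp1 hp.one_lt
    have h7 : ‖(p : K)‖ ≤ ‖(w : K)‖ ^ p := h2
    linarith
  have h4 : ‖((sharp 1 ζ.xiTilt : OK K) : K)‖ = ‖(w : K)‖ := by
    by_contra hne
    have h5 := IsUltrametricDist.norm_add_eq_max_of_norm_ne_norm
      (x := ((sharp 1 ζ.xiTilt : OK K) : K)) (y := -(w : K)) (by rwa [norm_neg])
    push_cast at h1
    rw [← sub_eq_add_neg, norm_neg] at h5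
    rw [h5] at h1
    exact (h3.trans_le (le_max_right _ _)).not_ge h1
  have h5 := congrArg Subtype.val (sharp_pow 1 ζ.xiTilt)
  rw [pow_one] at h5
  push_cast at h5
  rw [← h5, norm_pow, h4]
  exact h2

lemma RootSystem.untilt_xiTilt_ne_zero (ζ : RootSystem p K) : ζ.xiTilt.untilt ≠ 0 := fun h ↦ by
  have h1 := ζ.norm_p_le_untilt_xiTilt
  have h2 := norm_natCast_p_pos (K := K) p
  rw [h, ZeroMemClass.coe_zero, norm_zero] at h1
  linarith

/-- This is the reduction modulo `p` of `ker θ = (ξ)`: the vanishing of component `0` bounds the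
norm of the untilt by `‖p‖`. -/
lemma RootSystem.xiTilt_dvd (ζ : RootSystem p K) {x : Tilt p K} (hx : PreTilt.coeff 0 x = 0) :
    ζ.xiTilt ∣ x := by
  refine tilt_dvd ζ.untilt_xiTilt_ne_zero (le_trans ?_ ζ.norm_p_le_untilt_xiTilt)
  have h := mk_sharp 0 x
  rw [hx, Ideal.Quotient.eq_zero_iff_mem, ← pow_one (Ideal.span _), mem_span_pow, pow_one] at h
  exact h

end Tilt

/-! ### Regularity of `p, ξ` in `A_inf`, and the kernel of Fontaine's map -/

section Theta

variable {p : ℕ} [Fact p.Prime] {K : Type u} [NormedField K] [IsUltrametricDist K]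
  [NormedAlgebra ℚ_[p] K] [CompleteSpace K]

lemma Ainf.p_torsionFree (x : Ainf p K) (hx : p • x = 0) : x = 0 :=
  WittVector.eq_zero_of_p_mul_eq_zero x (by rwa [mul_comm, ← nsmul_eq_mul])

lemma Ainf.exists_eq_p_smul {x : Ainf p K} (hx : WittVector.constantCoeff x = 0) :
    ∃ y : Ainf p K, x = p • y := by
  obtain ⟨y, hy⟩ := Ideal.mem_span_singleton.1
    ((WittVector.mem_span_p_iff_coeff_zero_eq_zero x).2 hx)
  exact ⟨y, by rw [nsmul_eq_mul, hy]⟩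

lemma Ainf.constantCoeff_p_smul (x : Ainf p K) :
    WittVector.constantCoeff (p • x : Ainf p K) = 0 := by
  refine (WittVector.mem_span_p_iff_coeff_zero_eq_zero (p • x : Ainf p K)).1 (Ideal.mem_span_singleton.2 ?_)
  exact ⟨x, nsmul_eq_mul _ _⟩

lemma Ainf.pSep : PSep p (Ainf p K) := PSep.of_isAdicComplete _

lemma Ainf.pSum : PSum p (Ainf p K) := PSum.of_isAdicComplete _

lemma RootSystem.constantCoeff_xi (ζ : RootSystem p K) :
    WittVector.constantCoeff ζ.xi = ζ.xiTilt := by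
  rw [xi, xiTilt, map_sum]
  refine Finset.sum_congr rfl fun i _ ↦ ?_
  rw [map_pow]
  congr 1

/-- The sequence `p, ξ` is regular: `ξ` is a nonzerodivisor on the tilt `A_inf / p`, and `p` is one
on `A_inf`. The torsion freeness and separatedness of `A_inf / ξ^e` rest on this. -/
lemma RootSystem.xi_mul_dvd_p (ζ : RootSystem p K) {x y : Ainf p K} (h : ζ.xi * x = p • y) :
    ∃ z, x = p • z ∧ y = ζ.xi * z := by
  have h1 : WittVector.constantCoeff (ζ.xi * x) = WittVector.constantCoeff (p • y) :=
    congrArg _ h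
  rw [map_mul, Ainf.constantCoeff_p_smul, ζ.constantCoeff_xi] at h1
  obtain ⟨z, hz⟩ := Ainf.exists_eq_p_smul (tilt_regular ζ.untilt_xiTilt_ne_zero h1)
  refine ⟨z, hz, sub_eq_zero.1 (Ainf.p_torsionFree _ ?_)⟩
  rw [smul_sub, ← h, hz, mul_smul_comm, sub_self]

lemma RootSystem.xi_pow_mul_dvd_p (ζ : RootSystem p K) (e : ℕ) {x y : Ainf p K}
    (h : ζ.xi ^ e * x = p • y) : ∃ z, x = p • z ∧ y = ζ.xi ^ e * z := by
  induction e generalizing y with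
  | zero => exact ⟨y, by simpa using h, by simp⟩
  | succ e ih =>
    rw [pow_succ', mul_assoc] at h
    obtain ⟨z, hz, rfl⟩ := ζ.xi_mul_dvd_p h
    obtain ⟨w, rfl, rfl⟩ := ih hz
    exact ⟨w, rfl, by ring⟩

lemma RootSystem.xi_pow_mul_dvd_p_pow (ζ : RootSystem p K) (e n : ℕ) {x y : Ainf p K}
    (h : ζ.xi ^ e * x = p ^ n • y) : ∃ z, x = p ^ n • z ∧ y = ζ.xi ^ e * z := by
  induction n generalizing x with
  | zero => exact ⟨x, by simp, by simpa using h.symm⟩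
  | succ n ih =>
    rw [pow_succ', mul_smul] at h
    obtain ⟨z, rfl, hz⟩ := ζ.xi_pow_mul_dvd_p e h
    obtain ⟨w, rfl, rfl⟩ := ih hz.symm
    exact ⟨w, by rw [pow_succ', mul_smul], rfl⟩

lemma RootSystem.xi_pow_regular (ζ : RootSystem p K) (e : ℕ) {x : Ainf p K}
    (h : ζ.xi ^ e * x = 0) : x = 0 :=
  Ainf.pSep x fun n ↦ by
    obtain ⟨z, hz, -⟩ := ζ.xi_pow_mul_dvd_p_pow e n (y := 0) (by rw [h, smul_zero])
    exact ⟨z, hz⟩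

variable (p K) in
/-- Fontaine's map `θ : A_inf → O_K`. -/
abbrev theta : Ainf p K →+* OK K := WittVector.fontaineTheta (OK K) p

lemma theta_surjective (hK : IsPerfectoid p K) : Function.Surjective (theta p K) :=
  surjective_fontaineTheta hK.frobenius_surjective

/-- Modulo `p`, the `n`-th root in the sequence of `φ⁻¹(ε)` is `ζ_{p^(n+1)}`. Raising to the power
`p ^ n` improves the congruence to one modulo `p ^ (n + 1)`, for every `n`. -/
lemma RootSystem.untilt_root (ζ : RootSystem p K) :
    ((frobeniusEquiv (Tilt p K) p).symm ζ.eps).untilt = ζ.root 1 := by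
  set x := (frobeniusEquiv (Tilt p K) p).symm ζ.eps with hx
  have hc : ∀ n, Ideal.Quotient.mk (Ideal.span {(p : OK K)}) (sharp n x) =
      Ideal.Quotient.mk _ (ζ.root (n + 1)) := fun n ↦ by
    rw [mk_sharp, hx, PreTilt.coeff_frobeniusEquiv_symm]; rfl
  have hr : ∀ n, ζ.root (n + 1) ^ p ^ n = ζ.root 1 := fun n ↦ by
    induction n with
    | zero => simp
    | succ n ih => rw [pow_succ', pow_mul, ζ.root_succ_pow, ih]
  refine sub_eq_zero.1 (PSep.of_isAdicComplete (p := p) (OK K) _ fun n ↦ ?_)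
  rw [← mem_span_natCast_pow, ← hr n, ← sharp_pow n x]
  have h := Ideal.Quotient.eq.1 (hc n)
  have := dvd_sub_pow_of_dvd_sub (Ideal.mem_span_singleton.1 h) n
  rw [Ideal.span_singleton_pow, Ideal.mem_span_singleton]
  exact (pow_dvd_pow _ n.le_succ).trans this

lemma RootSystem.theta_xi (ζ : RootSystem p K) : theta p K ζ.xi = 0 := by
  have h : theta p K ζ.xi = ∑ i ∈ Finset.range p, ζ.root 1 ^ i := by
    rw [xi, map_sum]
    refine Finset.sum_congr rfl fun i _ ↦ ?_
    rw [map_pow, teichEpsRoot, theta, WittVector.fontaineTheta_teichmuller, ζ.untilt_root]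
  rw [h]
  have h2 := geom_sum_mul (ζ.root 1) p
  rw [ζ.root_succ_pow 0, ζ.root_zero, sub_self] at h2
  exact (mul_eq_zero.1 h2).resolve_right (sub_ne_zero.2 ζ.root_one_ne)

/-- Modulo `p` this is `xiTilt_dvd`. As `O_K` has no `p`-torsion, the error divided by `p` is again
in the kernel, and successive approximation applies to multiplication by `ξ`. -/
lemma RootSystem.ker_theta (ζ : RootSystem p K) :
    RingHom.ker (theta p K) = Ideal.span {ζ.xi} := by
  refine le_antisymm (fun x hx ↦ ?_) ?_
  · let φ : Ainf p K →+ (RingHom.ker (theta p K)) :=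
      { toFun := fun y ↦ ⟨ζ.xi * y, by rw [RingHom.mem_ker, map_mul, ζ.theta_xi, zero_mul]⟩
        map_zero' := by ext1; simp
        map_add' := fun a b ↦ by ext1; simp [mul_add] }
    have hφ : Function.Surjective φ := by
      refine surjective_of_approx (p := p) φ Ainf.pSum
        (Ainf.pSep.of_injective (RingHom.ker (theta p K)).subtype.toAddMonoidHom
          Subtype.val_injective) ?_
      rintro ⟨y, hy⟩
      have h1 := WittVector.mk_fontaineTheta (R := OK K) (p := p) y
      rw [show WittVector.fontaineTheta (OK K) p y = 0 from hy, map_zero] at h1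
      obtain ⟨t, ht⟩ := ζ.xiTilt_dvd h1.symm
      have h2 : WittVector.constantCoeff (y - ζ.xi * WittVector.teichmuller p t) = 0 := by
        rw [map_sub, map_mul, ζ.constantCoeff_xi]
        refine sub_eq_zero.2 (ht.trans ?_)
        exact congrArg (ζ.xiTilt * ·) (WittVector.teichmuller_coeff_zero p t).symm
      obtain ⟨z, hz⟩ := Ainf.exists_eq_p_smul h2
      have hz0 : theta p K z = 0 := by
        refine OK.p_torsionFree (p := p) _ ?_
        rw [← map_nsmul, ← hz, map_sub, map_mul, ζ.theta_xi, zero_mul, sub_zero]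
        exact hy
      refine ⟨WittVector.teichmuller p t, ⟨z, hz0⟩, Subtype.ext ?_⟩
      simp only [φ, AddMonoidHom.coe_mk, ZeroHom.coe_mk, Submodule.coe_add]
      change y = _ + p • z
      rw [← hz]
      abel
    obtain ⟨y, hy⟩ := hφ ⟨x, hx⟩
    exact Ideal.mem_span_singleton.2 ⟨y, (congrArg Subtype.val hy).symm⟩
  · rw [Ideal.span_singleton_le_iff_mem]
    exact ζ.theta_xi

lemma AinfE.mk_eq_zero {ζ : RootSystem p K} {e : ℕ} {x : Ainf p K} :
    Ideal.Quotient.mk (Ideal.span {ζ.xi ^ e}) x = 0 ↔ ∃ y, x = ζ.xi ^ e * y := by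
  rw [Ideal.Quotient.eq_zero_iff_mem, Ideal.mem_span_singleton]
  rfl

lemma AinfE.p_torsionFree (ζ : RootSystem p K) (e : ℕ) (x : AinfE ζ e) (hx : p • x = 0) :
    x = 0 := by
  obtain ⟨x, rfl⟩ := Ideal.Quotient.mk_surjective x
  rw [← map_nsmul] at hx
  obtain ⟨y, hy⟩ := AinfE.mk_eq_zero.1 hx
  obtain ⟨z, -, hz⟩ := ζ.xi_pow_mul_dvd_p e hy.symm
  exact AinfE.mk_eq_zero.2 ⟨z, hz⟩

lemma AinfE.pSum (ζ : RootSystem p K) (e : ℕ) : PSum p (AinfE ζ e) :=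
  Ainf.pSum.of_surjective (Ideal.Quotient.mk _ : Ainf p K →+* AinfE ζ e).toAddMonoidHom
    Ideal.Quotient.mk_surjective

/-- The ideal `(ξ^e)` is `p`-adically closed: if `x = ξ^e y_n + p^n z_n` for all `n`, regularity
shows that `p^n` divides `y_{n+1} - y_n`, so the `y_n` converge and their limit is the quotient. -/
lemma AinfE.pSep (ζ : RootSystem p K) (e : ℕ) : PSep p (AinfE ζ e) := fun x hx ↦ by
  obtain ⟨x, rfl⟩ := Ideal.Quotient.mk_surjective x
  have h : ∀ n, ∃ y z, x = ζ.xi ^ e * y + p ^ n • z := fun n ↦ by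
    obtain ⟨z, hz⟩ := hx n
    obtain ⟨z, rfl⟩ := Ideal.Quotient.mk_surjective z
    rw [← map_nsmul, ← sub_eq_zero, ← map_sub] at hz
    obtain ⟨y, hy⟩ := AinfE.mk_eq_zero.1 hz
    exact ⟨y, z, by rw [← hy]; abel⟩
  choose y z hyz using h
  have hd : ∀ n, ∃ g, y (n + 1) - y n = p ^ n • g := fun n ↦ by
    obtain ⟨w, hw, -⟩ := ζ.xi_pow_mul_dvd_p_pow e n (x := y (n + 1) - y n)
      (y := z n - p • z (n + 1)) (by
        have h1 := (hyz n).symm.trans (hyz (n + 1))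
        rw [smul_sub, ← mul_smul, ← pow_succ, mul_sub, sub_eq_sub_iff_add_eq_add, ← h1]
        abel)
    exact ⟨w, hw⟩
  choose g hg using hd
  obtain ⟨s, hs⟩ := Ainf.pSum g
  refine AinfE.mk_eq_zero.2 ⟨y 0 + s, sub_eq_zero.1 (Ainf.pSep _ fun n ↦ ?_)⟩
  obtain ⟨t, ht⟩ := hs n
  have hsum : ∑ k ∈ Finset.range n, p ^ k • g k = y n - y 0 := by
    rw [← Finset.sum_range_sub]
    exact Finset.sum_congr rfl fun k _ ↦ (hg k).symm
  refine ⟨z n - ζ.xi ^ e * t, ?_⟩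
  rw [ht, hsum, hyz n, smul_sub, ← mul_smul_comm]
  ring

end Theta

end TateRes
end

noncomputable section

set_option linter.unusedSectionVars false

namespace TateRes

/-! ### `B_dR^+` modulo powers of `ξ` -/

/-- For a finitely generated ideal `I`, the kernel of the projection of the completion to `L / I^e`
is the `e`-th power of `I` times the completion. -/
lemma adicCompletion_eq_pow_mul {L : Type u} [CommRing L] {I : Ideal L} {a : L}
    (hI : I = Ideal.span {a}) {e : ℕ} (x : AdicCompletion I L)
    (hx : AdicCompletion.evalₐ I e x = 0) :
    ∃ y : AdicCompletion I L, x = algebraMap L (AdicCompletion I L) a ^ e * y := by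
  subst hI
  have hfg : (Ideal.span {a}).FG := ⟨{a}, by rw [Finset.coe_singleton]⟩
  have h2 : x ∈ LinearMap.ker (AdicCompletion.eval (Ideal.span {a}) L e) := by
    rw [LinearMap.mem_ker, ← AdicCompletion.factor_evalₐ_eq_eval _ x (by simp), hx, map_zero]
  rw [← AdicCompletion.pow_smul_top_eq_ker_eval hfg, Ideal.span_singleton_pow,
    Submodule.ideal_span_singleton_smul] at h2
  obtain ⟨y, -, hy⟩ := h2
  refine ⟨y, ?_⟩
  rw [← hy, ← map_pow, ← Algebra.smul_def]
  rfl

section BdR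

variable {p : ℕ} [Fact p.Prime] {K : Type u} [NormedField K] [IsUltrametricDist K]
  [NormedAlgebra ℚ_[p] K] [CompleteSpace K]

variable (p K) in
/-- The ring `A_inf[1/p]`. -/
abbrev AinfInv : Type u := Localization.Away (p : Ainf p K)

lemma AinfInv.exists_p_pow_mul (x : AinfInv p K) :
    ∃ (n : ℕ) (a : Ainf p K), (p : AinfInv p K) ^ n * x = algebraMap _ _ a := by
  obtain ⟨n, a, h⟩ := IsLocalization.Away.surj (p : Ainf p K) x
  exact ⟨n, a, by rw [← h, map_natCast, mul_comm]⟩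

lemma AinfInv.isUnit_p : IsUnit (p : AinfInv p K) := by
  have := IsLocalization.Away.algebraMap_isUnit (S := AinfInv p K) (p : Ainf p K)
  rwa [map_natCast] at this

lemma AinfInv.algebraMap_injective : Function.Injective (algebraMap (Ainf p K) (AinfInv p K)) := by
  refine IsLocalization.injective (M := Submonoid.powers (p : Ainf p K)) _ ?_
  rintro _ ⟨n, rfl⟩
  refine pow_mem ?_ n
  rw [mem_nonZeroDivisors_iff]
  exact ⟨fun x hx ↦ Ainf.p_torsionFree x (by rwa [nsmul_eq_mul]),
    fun x hx ↦ Ainf.p_torsionFree x (by rwa [nsmul_eq_mul, mul_comm])⟩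

variable (p K) in
/-- The kernel of Fontaine's map on `A_inf[1/p]`. -/
abbrev kerThetaInv : Ideal (AinfInv p K) := RingHom.ker (fontaineThetaInvertP (OK K) p)

lemma RootSystem.kerThetaInv_eq (ζ : RootSystem p K) :
    kerThetaInv p K = Ideal.span {algebraMap _ (AinfInv p K) ζ.xi} := by
  have hθ : ∀ a, fontaineThetaInvertP (OK K) p (algebraMap _ (AinfInv p K) a) =
      algebraMap _ _ (theta p K a) := fun a ↦ by
    rw [fontaineThetaInvertP, Localization.awayLift, IsLocalization.Away.lift_eq]
    rfl
  have hinj : Function.Injective (algebraMap (OK K) (Localization.Away (p : OK K))) := by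
    refine IsLocalization.injective (M := Submonoid.powers (p : OK K)) _ ?_
    rintro _ ⟨n, rfl⟩
    refine pow_mem ?_ n
    rw [mem_nonZeroDivisors_iff]
    exact ⟨fun x hx ↦ OK.p_torsionFree x (by rwa [nsmul_eq_mul]),
      fun x hx ↦ OK.p_torsionFree x (by rwa [nsmul_eq_mul, mul_comm])⟩
  refine le_antisymm (fun x hx ↦ ?_) ?_
  · obtain ⟨n, a, ha⟩ := AinfInv.exists_p_pow_mul x
    have h1 : theta p K a = 0 := by
      refine hinj ?_
      rw [← hθ, ← ha, map_mul, show fontaineThetaInvertP (OK K) p x = 0 from hx, mul_zero,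
        map_zero]
    have h2 : a ∈ Ideal.span {ζ.xi} := ζ.ker_theta ▸ h1
    obtain ⟨b, rfl⟩ := Ideal.mem_span_singleton.1 h2
    rw [← Ideal.unit_mul_mem_iff_mem _ (AinfInv.isUnit_p.pow n), ha, map_mul]
    exact Ideal.mul_mem_right _ _ (Ideal.mem_span_singleton_self _)
  · rw [Ideal.span_singleton_le_iff_mem, RingHom.mem_ker, hθ, ζ.theta_xi, map_zero]

variable (p K) in
/-- The completion map `A_inf[1/p] → B_dR^+`. -/
def invToBdR : AinfInv p K →+* BdR p K :=
  (algebraMap (AinfInv p K) (AdicCompletion (kerThetaInv p K) (AinfInv p K)) :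
    AinfInv p K →+* BDeRhamPlus (OK K) p)

variable (p K) in
/-- The projection `B_dR^+ → A_inf[1/p] / (ker θ)^e`. -/
def bdREval (e : ℕ) : BdR p K →+* AinfInv p K ⧸ kerThetaInv p K ^ e :=
  (AdicCompletion.evalₐ (kerThetaInv p K) e).toRingHom

lemma bdREval_invToBdR (e : ℕ) (x : AinfInv p K) :
    bdREval p K e (invToBdR p K x) = Ideal.Quotient.mk _ x :=
  AdicCompletion.evalₐ_of (kerThetaInv p K) e x

lemma RootSystem.bdREval_eq_zero (ζ : RootSystem p K) {e : ℕ} {x : BdR p K}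
    (hx : bdREval p K e x = 0) : ∃ y, x = ζ.xiBdR ^ e * y :=
  adicCompletion_eq_pow_mul ζ.kerThetaInv_eq x hx

lemma RootSystem.isUnit_p_BdR : IsUnit (p : BdR p K) := by
  simpa using (AinfInv.isUnit_p (p := p) (K := K)).map (invToBdR p K)

lemma ainfToBdR_eq (a : Ainf p K) : ainfToBdR p K a = invToBdR p K (algebraMap _ _ a) := rfl

lemma RootSystem.exists_approx_BdR (ζ : RootSystem p K) (e : ℕ) (x : BdR p K) :
    ∃ (n : ℕ) (a : Ainf p K) (y : BdR p K), p ^ n • x = ainfToBdR p K a + ζ.xiBdR ^ e * y := by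
  obtain ⟨l, hl⟩ := Ideal.Quotient.mk_surjective (bdREval p K e x)
  obtain ⟨n, a, ha⟩ := AinfInv.exists_p_pow_mul l
  refine ⟨n, a, ?_⟩
  obtain ⟨y, hy⟩ := ζ.bdREval_eq_zero (e := e) (x := p ^ n • x - ainfToBdR p K a) (by
    rw [map_sub, map_nsmul, ← hl, ainfToBdR_eq, bdREval_invToBdR, ← map_nsmul, ← ha, nsmul_eq_mul,
      Nat.cast_pow, sub_self])
  exact ⟨y, by rw [← hy]; abel⟩

/-- Divisibility by `ξ^e` descends from the completion to `A_inf[1/p]`, and regularity of `p, ξ`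
then removes the denominator. Together with `exists_approx_BdR` this gives `B_dR,e^+ =
A_inf,e[1/p]`. -/
lemma RootSystem.ainfToBdR_dvd (ζ : RootSystem p K) {e : ℕ} {a : Ainf p K} {y : BdR p K}
    (h : ainfToBdR p K a = ζ.xiBdR ^ e * y) : ∃ b, a = ζ.xi ^ e * b := by
  have h1 := congrArg (bdREval p K e) h
  have h2 : bdREval p K e (ζ.xiBdR ^ e * y) = 0 := by
    rw [map_mul, xiBdR, ainfToBdR_eq, ← map_pow, bdREval_invToBdR]
    have : Ideal.Quotient.mk (kerThetaInv p K ^ e) (algebraMap _ (AinfInv p K) ζ.xi ^ e) = 0 := by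
      rw [Ideal.Quotient.eq_zero_iff_mem, ζ.kerThetaInv_eq]
      exact Ideal.pow_mem_pow (Ideal.mem_span_singleton_self _) _
    rw [this, zero_mul]
  rw [h2, ainfToBdR_eq, bdREval_invToBdR, Ideal.Quotient.eq_zero_iff_mem, ζ.kerThetaInv_eq,
    Ideal.span_singleton_pow] at h1
  obtain ⟨l, hl⟩ := Ideal.mem_span_singleton.1 h1
  obtain ⟨n, b, hb⟩ := AinfInv.exists_p_pow_mul l
  have h3 : ζ.xi ^ e * b = p ^ n • a := by
    refine AinfInv.algebraMap_injective ?_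
    rw [map_mul, ← hb, nsmul_eq_mul, map_mul, hl, Nat.cast_pow, map_pow, map_pow, map_natCast]
    ring
  obtain ⟨z, -, hz⟩ := ζ.xi_pow_mul_dvd_p_pow e n h3
  exact ⟨z, hz⟩

lemma ainfEToBdRE_mk (ζ : RootSystem p K) (e : ℕ) (a : Ainf p K) :
    ainfEToBdRE ζ e (Ideal.Quotient.mk _ a) = Ideal.Quotient.mk _ (ainfToBdR p K a) := rfl

lemma BdRE.mk_eq_zero {ζ : RootSystem p K} {e : ℕ} {x : BdR p K} :
    Ideal.Quotient.mk (Ideal.span {ζ.xiBdR ^ e}) x = 0 ↔ ∃ y, x = ζ.xiBdR ^ e * y := by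
  rw [Ideal.Quotient.eq_zero_iff_mem, Ideal.mem_span_singleton]
  rfl

lemma ainfEToBdRE_injective (ζ : RootSystem p K) (e : ℕ) :
    Function.Injective (ainfEToBdRE ζ e) := by
  rw [injective_iff_map_eq_zero]
  intro a ha
  obtain ⟨a, rfl⟩ := Ideal.Quotient.mk_surjective a
  rw [ainfEToBdRE_mk] at ha
  obtain ⟨y, hy⟩ := BdRE.mk_eq_zero.1 ha
  exact AinfE.mk_eq_zero.2 (ζ.ainfToBdR_dvd hy)

lemma BdRE.exists_p_pow_smul (ζ : RootSystem p K) (e : ℕ) (x : BdRE ζ e) :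
    ∃ (n : ℕ) (a : AinfE ζ e), p ^ n • x = ainfEToBdRE ζ e a := by
  obtain ⟨x, rfl⟩ := Ideal.Quotient.mk_surjective x
  obtain ⟨n, a, y, h⟩ := ζ.exists_approx_BdR e x
  refine ⟨n, Ideal.Quotient.mk _ a, ?_⟩
  rw [ainfEToBdRE_mk, ← map_nsmul, h, map_add, BdRE.mk_eq_zero.2 ⟨y, rfl⟩, add_zero]

lemma BdRE.isUnit_p (ζ : RootSystem p K) (e : ℕ) : IsUnit (p : BdRE ζ e) := by
  have := (RootSystem.isUnit_p_BdR (p := p) (K := K)).map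
    (Ideal.Quotient.mk (Ideal.span {ζ.xiBdR ^ e}))
  rwa [map_natCast] at this

/-- Cancellation of `ξ` at finite precision: modulo `ξ^e` and up to a power of `p`, the element `y`
comes from `A_inf`, where `ξ` is a nonzerodivisor. -/
lemma RootSystem.xiBdR_mul_eq (ζ : RootSystem p K) {e : ℕ} {y z : BdR p K}
    (h : ζ.xiBdR * y = ζ.xiBdR ^ (e + 1) * z) : ∃ w, y = ζ.xiBdR ^ e * w := by
  obtain ⟨n, a, w, hw⟩ := ζ.exists_approx_BdR e y
  have h1 : ainfToBdR p K (ζ.xi * a) = ζ.xiBdR ^ (e + 1) * (p ^ n • z - w) := by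
    have h2 : ainfToBdR p K a = p ^ n • y - ζ.xiBdR ^ e * w := by rw [hw]; ring
    rw [map_mul, h2, show ainfToBdR p K ζ.xi = ζ.xiBdR from rfl, mul_sub, mul_smul_comm, h,
      mul_sub, mul_smul_comm]
    ring
  obtain ⟨b, hb⟩ := ζ.ainfToBdR_dvd h1
  have h3 : a = ζ.xi ^ e * b := by
    refine sub_eq_zero.1 (ζ.xi_pow_regular 1 ?_)
    rw [mul_sub, pow_one, hb, pow_succ']
    ring
  have h4 : p ^ n • y = ζ.xiBdR ^ e * (ainfToBdR p K b + w) := by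
    rw [hw, h3, map_mul, map_pow, mul_add]; rfl
  obtain ⟨v, hv⟩ := (RootSystem.isUnit_p_BdR (p := p) (K := K)).pow n
  refine ⟨(v⁻¹ : (BdR p K)ˣ) * (ainfToBdR p K b + w), ?_⟩
  rw [nsmul_eq_mul, Nat.cast_pow, ← hv] at h4
  rw [mul_left_comm, ← h4, Units.inv_mul_cancel_left]

end BdR

end TateRes
end

noncomputable section

set_option linter.unusedSectionVars false

namespace TateRes

/-! ### Restricted power series -/

section Restricted

variable {A : Type u} [CommRing A] {p : ℕ} {σ : Type}

/-- The `m`-th coefficient of a restricted power series. -/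
def rcoeff (m : σ →₀ ℕ) : restricted A p σ →ₗ[A] A :=
  (MvPowerSeries.coeff m).comp (restricted A p σ).val.toLinearMap

lemma rcoeff_apply (m : σ →₀ ℕ) (f : restricted A p σ) :
    rcoeff m f = MvPowerSeries.coeff m (f : MvPowerSeries σ A) := rfl

lemma restricted_ext {f g : restricted A p σ} (h : ∀ m, rcoeff m f = rcoeff m g) : f = g :=
  Subtype.ext (MvPowerSeries.ext h)

lemma mem_restricted {f : MvPowerSeries σ A} :
    f ∈ restricted A p σ ↔
      ∀ n : ℕ, {m | ¬ ∃ y, MvPowerSeries.coeff m f = p ^ n • y}.Finite := by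
  simp only [← mem_span_natCast_pow]; rfl

lemma finite_rcoeff (f : restricted A p σ) (n : ℕ) :
    {m | ¬ ∃ y, rcoeff m f = p ^ n • y}.Finite := mem_restricted.1 f.2 n

/-- The restricted power series with given coefficients. -/
def restrictedMk (c : (σ →₀ ℕ) → A) (hc : ∀ n : ℕ, {m | ¬ ∃ y, c m = p ^ n • y}.Finite) :
    restricted A p σ := ⟨c, mem_restricted.2 hc⟩

@[simp] lemma rcoeff_restrictedMk (c : (σ →₀ ℕ) → A)
    (hc : ∀ n : ℕ, {m | ¬ ∃ y, c m = p ^ n • y}.Finite) (m : σ →₀ ℕ) :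
    rcoeff m (restrictedMk c hc) = c m := rfl

variable (A p σ) in
/-- Polynomials as restricted power series. -/
def ofPoly : MvPolynomial σ A →ₐ[A] restricted A p σ :=
  MvPolynomial.aeval fun s ↦ ⟨MvPowerSeries.X s, X_mem_restricted A p σ s⟩

lemma coe_ofPoly (P : MvPolynomial σ A) : (ofPoly A p σ P : MvPowerSeries σ A) = P := by
  have : (restricted A p σ).val.comp (ofPoly A p σ) = MvPolynomial.coeToMvPowerSeries.algHom A := by
    apply MvPolynomial.algHom_ext
    intro s
    simp [ofPoly]
  have h := DFunLike.congr_fun this P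
  simpa using h

@[simp] lemma rcoeff_ofPoly (P : MvPolynomial σ A) (m : σ →₀ ℕ) :
    rcoeff m (ofPoly A p σ P) = P.coeff m := by
  rw [rcoeff_apply, coe_ofPoly, MvPolynomial.coeff_coe]

/-- The variables of the ring of restricted power series. -/
def rvar (s : σ) : restricted A p σ := ⟨MvPowerSeries.X s, X_mem_restricted A p σ s⟩

@[simp] lemma ofPoly_X (s : σ) : ofPoly A p σ (MvPolynomial.X s) = rvar s := by
  simp [ofPoly, rvar]

lemma torsionFree_pow {M : Type*} [AddCommGroup M] (hM : ∀ x : M, p • x = 0 → x = 0) (n : ℕ)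
    {x : M} (h : p ^ n • x = 0) : x = 0 := by
  induction n with
  | zero => simpa using h
  | succ n ih => exact ih (hM _ (by rwa [← mul_smul, ← pow_succ']))

lemma restricted_torsionFree (hA : ∀ x : A, p • x = 0 → x = 0) (f : restricted A p σ)
    (h : p • f = 0) : f = 0 := restricted_ext fun m ↦ by
  rw [map_zero]
  exact hA _ (by rw [← map_nsmul, h, map_zero])

/-- The quotient is again restricted because `p`-torsion freeness turns divisibility of `p ^ n c` by
`p ^ (n + k)` into divisibility of `c` by `p ^ k`. -/
lemma exists_eq_pow_smul (hA : ∀ x : A, p • x = 0 → x = 0) {n : ℕ} {f : restricted A p σ}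
    (h : ∀ m, ∃ y, rcoeff m f = p ^ n • y) : ∃ g, f = p ^ n • g := by
  choose c hc using h
  refine ⟨restrictedMk c fun k ↦ (finite_rcoeff f (n + k)).subset fun m hm ↦ ?_,
    restricted_ext fun m ↦ by rw [map_nsmul, hc, rcoeff_restrictedMk]⟩
  rintro ⟨y, hy⟩
  refine hm ⟨y, sub_eq_zero.1 (torsionFree_pow hA n ?_)⟩
  rw [smul_sub, ← hc, hy, pow_add, mul_smul, sub_self]

/-- The truncation of a restricted power series to finitely many coefficients. -/
def truncate (s : Finset (σ →₀ ℕ)) (f : restricted A p σ) : MvPolynomial σ A :=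
  ∑ m ∈ s, MvPolynomial.monomial m (rcoeff m f)

lemma coeff_truncate (s : Finset (σ →₀ ℕ)) (f : restricted A p σ) (m : σ →₀ ℕ) [Decidable (m ∈ s)] :
    (truncate s f).coeff m = if m ∈ s then rcoeff m f else 0 := by
  classical
  simp [truncate, MvPolynomial.coeff_sum, MvPolynomial.coeff_monomial]

lemma exists_poly_approx (hA : ∀ x : A, p • x = 0 → x = 0) (n : ℕ) (f : restricted A p σ) :
    ∃ (P : MvPolynomial σ A) (g : restricted A p σ), f = ofPoly A p σ P + p ^ n • g := by
  classical
  obtain ⟨g, hg⟩ := exists_eq_pow_smul hA (n := n)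
    (f := f - ofPoly A p σ (truncate (finite_rcoeff f n).toFinset f)) (fun m ↦ by
      rw [map_sub, rcoeff_ofPoly, coeff_truncate]
      split_ifs with h
      · exact ⟨0, by simp⟩
      · simpa using h)
  exact ⟨_, g, by rw [← hg]; abel⟩

lemma restricted_pSep (hA : PSep p A) : PSep p (restricted A p σ) := fun f hf ↦
  restricted_ext fun m ↦ by
    rw [map_zero]
    refine hA _ fun n ↦ ?_
    obtain ⟨g, hg⟩ := hf n
    exact ⟨rcoeff m g, by rw [← map_nsmul, ← hg]⟩

lemma restricted_pSum (hA : ∀ x : A, p • x = 0 → x = 0) (hs : PSum p A) :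
    PSum p (restricted A p σ) := fun g ↦ by
  choose c y hy using fun m ↦ hs fun k ↦ rcoeff m (g k)
  have h1 : ∀ n m, c m = rcoeff m (∑ k ∈ Finset.range n, p ^ k • g k) + p ^ n • y m n :=
    fun n m ↦ by rw [hy m n, map_sum]; simp only [map_nsmul]
  let s : restricted A p σ := restrictedMk c fun n ↦
    (finite_rcoeff (∑ k ∈ Finset.range n, p ^ k • g k) n).subset fun m hm ⟨z, hz⟩ ↦
      hm ⟨z + y m n, by rw [h1 n m, hz, smul_add]⟩
  refine ⟨s, fun n ↦ ?_⟩
  obtain ⟨t, ht⟩ := exists_eq_pow_smul hA (n := n)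
    (f := s - ∑ k ∈ Finset.range n, p ^ k • g k) fun m ↦
      ⟨y m n, by rw [map_sub, rcoeff_restrictedMk, h1 n m]; abel⟩
  exact ⟨t, by rw [← ht]; abel⟩

lemma exists_sub_eq_pow_smul (hA : ∀ x : A, p • x = 0 → x = 0) {C : Type*} [CommRing C]
    (φ ψ : restricted A p σ →+* C) (hC : ∀ a, φ (algebraMap A _ a) = ψ (algebraMap A _ a))
    (hX : ∀ s, φ (rvar s) = ψ (rvar s)) (f : restricted A p σ) (n : ℕ) :
    ∃ g, φ f - ψ f = p ^ n • (φ g - ψ g) := by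
  obtain ⟨P, g, hg⟩ := exists_poly_approx hA n f
  have h : (φ.comp (ofPoly A p σ).toRingHom) = ψ.comp (ofPoly A p σ).toRingHom := by
    apply MvPolynomial.ringHom_ext
    · intro a
      have : ofPoly A p σ (MvPolynomial.C a) = algebraMap _ _ a := (ofPoly A p σ).commutes a
      simpa [this] using hC a
    · intro s
      simpa using hX s
  have h2 : φ (ofPoly A p σ P) = ψ (ofPoly A p σ P) := DFunLike.congr_fun h P
  exact ⟨g, by rw [hg, map_add, map_add, h2, map_nsmul, map_nsmul, smul_sub]; abel⟩

lemma restricted_ringHom_ext (hA : ∀ x : A, p • x = 0 → x = 0) {C : Type*} [CommRing C]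
    (hsep : PSep p C) {φ ψ : restricted A p σ →+* C}
    (hC : ∀ a, φ (algebraMap A _ a) = ψ (algebraMap A _ a))
    (hX : ∀ s, φ (rvar s) = ψ (rvar s)) : φ = ψ :=
  RingHom.ext fun f ↦ sub_eq_zero.1 (hsep _ fun n ↦ by
    obtain ⟨g, hg⟩ := exists_sub_eq_pow_smul hA φ ψ hC hX f n
    exact ⟨_, hg⟩)

/-! ### Evaluation of restricted power series -/

section Eval

variable {C : Type*} [CommRing C] [Algebra A C]

/-- `s` is the value of `f` at the point `c`. -/
def IsValue (c : σ → C) (f : restricted A p σ) (s : C) : Prop :=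
  ∀ n : ℕ, ∃ (P : MvPolynomial σ A) (g : restricted A p σ) (t : C),
    f = ofPoly A p σ P + p ^ n • g ∧ s = MvPolynomial.aeval c P + p ^ n • t

lemma IsValue.add {c : σ → C} {f f' : restricted A p σ} {s s' : C} (h : IsValue c f s)
    (h' : IsValue c f' s') : IsValue c (f + f') (s + s') := fun n ↦ by
  obtain ⟨P, g, t, rfl, rfl⟩ := h n
  obtain ⟨P', g', t', rfl, rfl⟩ := h' n
  exact ⟨P + P', g + g', t + t', by rw [map_add, smul_add]; abel,
    by rw [map_add, smul_add]; abel⟩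

lemma IsValue.mul {c : σ → C} {f f' : restricted A p σ} {s s' : C} (h : IsValue c f s)
    (h' : IsValue c f' s') : IsValue c (f * f') (s * s') := fun n ↦ by
  obtain ⟨P, g, t, rfl, rfl⟩ := h n
  obtain ⟨P', g', t', rfl, rfl⟩ := h' n
  refine ⟨P * P', g * ofPoly A p σ P' + ofPoly A p σ P * g' + p ^ n • (g * g'),
    t * MvPolynomial.aeval c P' + MvPolynomial.aeval c P * t' + p ^ n • (t * t'), ?_, ?_⟩
  · simp only [map_mul, nsmul_eq_mul]; ring
  · simp only [map_mul, nsmul_eq_mul]; ring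

lemma isValue_ofPoly (c : σ → C) (P : MvPolynomial σ A) :
    IsValue c (ofPoly A p σ P) (MvPolynomial.aeval c P) :=
  fun _ ↦ ⟨P, 0, 0, by simp, by simp⟩

/-- Two polynomials congruent to `f` modulo `p ^ n` differ by `p ^ n Q`, so their values agree
modulo `p ^ n`. Uniqueness makes the values, chosen separately for each series, into a ring
homomorphism. -/
lemma IsValue.unique (hsep : PSep p C) {c : σ → C} {f : restricted A p σ} {s s' : C}
    (h : IsValue c f s) (h' : IsValue c f s') : s = s' := by
  refine sub_eq_zero.1 (hsep _ fun n ↦ ?_)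
  obtain ⟨P, g, t, rfl, rfl⟩ := h n
  obtain ⟨P', g', t', h1, rfl⟩ := h' n
  have h2 : ofPoly A p σ (P - P') = p ^ n • (g' - g) := by
    rw [map_sub, smul_sub, sub_eq_sub_iff_add_eq_add, h1]; abel
  have h3 : MvPolynomial.C ((p ^ n : ℕ) : A) ∣ P - P' := by
    rw [MvPolynomial.C_dvd_iff_dvd_coeff]
    intro m
    rw [← rcoeff_ofPoly (p := p), h2, map_nsmul, nsmul_eq_mul]
    exact dvd_mul_right _ _
  obtain ⟨Q, hQ⟩ := h3
  refine ⟨MvPolynomial.aeval c Q + t - t', ?_⟩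
  have h4 : MvPolynomial.aeval c P = MvPolynomial.aeval c P' + p ^ n • MvPolynomial.aeval c Q := by
    rw [← sub_eq_iff_eq_add', ← map_sub, hQ, map_mul, MvPolynomial.aeval_C, map_natCast,
      nsmul_eq_mul]
  rw [h4, smul_sub, smul_add]
  abel

/-- An expansion `f = ∑ p ^ k P_k` into polynomials reduces evaluation to a convergent series in
`C`. -/
lemma exists_isValue (hA : ∀ x : A, p • x = 0 → x = 0) (hsum : PSum p C) (c : σ → C)
    (f : restricted A p σ) : ∃ s, IsValue c f s := by
  have h := fun f : restricted A p σ ↦ exists_poly_approx hA 1 f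
  simp only [pow_one] at h
  choose P b hPb using h
  obtain ⟨s, hs⟩ := hsum fun k ↦ MvPolynomial.aeval c (P (b^[k] f))
  refine ⟨s, fun n ↦ ?_⟩
  obtain ⟨t, ht⟩ := hs n
  refine ⟨∑ k ∈ Finset.range n, p ^ k • P (b^[k] f), b^[n] f, t, ?_, by rw [ht, map_sum]; simp⟩
  clear ht t hs s
  induction n with
  | zero => simp
  | succ n ih =>
    rw [Finset.sum_range_succ, map_add, map_nsmul, add_assoc, pow_succ, mul_smul,
        Function.iterate_succ_apply', ← smul_add, ← hPb]
    exact ih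

/-- Evaluation of restricted power series in a `p`-adically complete algebra. -/
lemma exists_eval (hA : ∀ x : A, p • x = 0 → x = 0) (hsep : PSep p C) (hsum : PSum p C)
    (c : σ → C) : ∃ φ : restricted A p σ →ₐ[A] C, ∀ s, φ (rvar s) = c s := by
  choose ev hev using exists_isValue (A := A) hA hsum c
  have h1 : ∀ P, ev (ofPoly A p σ P) = MvPolynomial.aeval c P := fun P ↦
    (hev _).unique hsep (isValue_ofPoly c P)
  refine ⟨{ toFun := ev
            map_one' := ?_
            map_mul' := fun f g ↦ (hev _).unique hsep ((hev f).mul (hev g))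
            map_zero' := ?_
            map_add' := fun f g ↦ (hev _).unique hsep ((hev f).add (hev g))
            commutes' := fun a ↦ ?_ }, fun s ↦ ?_⟩
  · rw [← map_one (ofPoly A p σ), h1, map_one]
  · rw [← map_zero (ofPoly A p σ), h1, map_zero]
  · rw [← (ofPoly A p σ).commutes, h1, AlgHom.commutes]
  · change ev _ = _
    rw [← ofPoly_X, h1, MvPolynomial.aeval_X]

end Eval

/-! ### Change of coefficients -/

section Map

variable {A' : Type u} [CommRing A']

/-- Applying a ring homomorphism to the coefficients of a restricted power series. -/
def restrictedMap (h : A →+* A') : restricted A p σ →+* restricted A' p σ :=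
  ((MvPowerSeries.map h).comp (restricted A p σ).val.toRingHom).codRestrict
    (restricted A' p σ) fun f ↦ mem_restricted.2 fun n ↦ (finite_rcoeff f n).subset
      fun m hm ⟨y, hy⟩ ↦ hm ⟨h y, by
        rw [← map_nsmul, ← hy]
        exact MvPowerSeries.coeff_map h m _⟩

@[simp] lemma rcoeff_restrictedMap (h : A →+* A') (f : restricted A p σ) (m : σ →₀ ℕ) :
    rcoeff m (restrictedMap h f) = h (rcoeff m f) := MvPowerSeries.coeff_map h m _

@[simp] lemma restrictedMap_algebraMap (h : A →+* A') (a : A) :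
    restrictedMap h (algebraMap _ (restricted A p σ) a) = algebraMap _ _ (h a) :=
  Subtype.ext (by
    change MvPowerSeries.map h (algebraMap A (MvPowerSeries σ A) a) = algebraMap _ _ _
    rw [MvPowerSeries.algebraMap_apply, MvPowerSeries.map_C, MvPowerSeries.algebraMap_apply]; rfl)

/-- Modulo `p` a restricted series is a polynomial, which lifts coefficientwise; successive
approximation does the rest. -/
lemma restrictedMap_surjective (h : A →+* A') (hh : Function.Surjective h)
    (hA : ∀ x : A, p • x = 0 → x = 0) (hA' : ∀ x : A', p • x = 0 → x = 0)
    (hsum : PSum p A) (hsep : PSep p A') :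
    Function.Surjective (restrictedMap h : restricted A p σ →+* restricted A' p σ) := by
  refine surjective_of_approx (p := p) (restrictedMap h).toAddMonoidHom
    (restricted_pSum hA hsum) (restricted_pSep hsep) fun f ↦ ?_
  obtain ⟨P, g, hg⟩ := exists_poly_approx hA' 1 f
  obtain ⟨Q, rfl⟩ := MvPolynomial.map_surjective h hh P
  refine ⟨ofPoly A p σ Q, g, ?_⟩
  rw [hg, pow_one]
  congr 1
  exact restricted_ext fun m ↦ by
    change _ = rcoeff m (restrictedMap h _)
    rw [rcoeff_restrictedMap, rcoeff_ofPoly, rcoeff_ofPoly, MvPolynomial.coeff_map]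

end Map

end Restricted

end TateRes
end

noncomputable section

set_option linter.unusedSectionVars false

namespace TateRes

/-! ### Saturated ideals of Tate algebras over `O_K` -/

/-- The form of Dickson's lemma used for leading exponents: the minimal elements form an antichain,
hence a finite set, and every element lies above one of them. -/
lemma exists_finset_le_of_mem {α : Type*} [PartialOrder α] [WellQuasiOrderedLE α] (s : Set α) :
    ∃ t : Finset α, ↑t ⊆ s ∧ ∀ x ∈ s, ∃ y ∈ t, y ≤ x := by
  have hf : {x | Minimal (· ∈ s) x}.Finite :=
    WellQuasiOrderedLE.finite_of_isAntichain (setOfPred_minimal_antichain (· ∈ s))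
  refine ⟨hf.toFinset, fun x hx ↦ ?_, fun x hx ↦ ?_⟩
  · rw [Set.Finite.coe_toFinset] at hx
    exact hx.prop
  · obtain ⟨y, hyx, hy⟩ := exists_minimal_le_of_wellFoundedLT (· ∈ s) x hx
    exact ⟨y, by simpa using hy, hyx⟩

lemma PSum.pi {p : ℕ} {ι : Type*} {M : ι → Type*} [∀ i, AddCommGroup (M i)]
    (h : ∀ i, PSum p (M i)) : PSum p (∀ i, M i) := fun g ↦ by
  choose s y hy using fun i ↦ h i fun k ↦ g k i
  exact ⟨s, fun n ↦ ⟨fun i ↦ y i n, funext fun i ↦ by simp [hy i n]⟩⟩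

lemma PSep.pi {p : ℕ} {ι : Type*} {M : ι → Type*} [∀ i, AddCommGroup (M i)]
    (h : ∀ i, PSep p (M i)) : PSep p (∀ i, M i) := fun x hx ↦ funext fun i ↦
  h i _ fun n ↦ by
    obtain ⟨y, hy⟩ := hx n
    exact ⟨y i, by rw [hy]; rfl⟩

lemma PSum.prod {p : ℕ} {M N : Type*} [AddCommGroup M] [AddCommGroup N]
    (hM : PSum p M) (hN : PSum p N) : PSum p (M × N) := fun g ↦ by
  obtain ⟨s, hs⟩ := hM fun k ↦ (g k).1
  obtain ⟨t, ht⟩ := hN fun k ↦ (g k).2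
  refine ⟨(s, t), fun n ↦ ?_⟩
  obtain ⟨y, hy⟩ := hs n
  obtain ⟨z, hz⟩ := ht n
  refine ⟨(y, z), Prod.ext ?_ ?_⟩
  · simp [hy, Prod.fst_sum]
  · simp [hz, Prod.snd_sum]

lemma PSep.prod {p : ℕ} {M N : Type*} [AddCommGroup M] [AddCommGroup N]
    (hM : PSep p M) (hN : PSep p N) : PSep p (M × N) := fun x hx ↦ Prod.ext
  (hM _ fun n ↦ by obtain ⟨y, hy⟩ := hx n; exact ⟨y.1, by rw [hy]; rfl⟩)
  (hN _ fun n ↦ by obtain ⟨y, hy⟩ := hx n; exact ⟨y.2, by rw [hy]; rfl⟩)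

section OKTate

variable {p : ℕ} [Fact p.Prime] {K : Type u} [NormedField K] [IsUltrametricDist K]
  [NormedAlgebra ℚ_[p] K] [CompleteSpace K] {σ : Type}

lemma OK.pSep : PSep p (OK K) := PSep.of_isAdicComplete _

lemma OK.pSum : PSum p (OK K) := PSum.of_isAdicComplete _

lemma OK.exists_eq_p_pow_smul {x : OK K} {n : ℕ} :
    (∃ y, x = p ^ n • y) ↔ ‖(x : K)‖ ≤ ‖(p : K)‖ ^ n := by
  rw [← mem_span_natCast_pow, mem_span_pow]

lemma OK.dvd_of_norm_le {x y : OK K} (h : ‖(y : K)‖ ≤ ‖(x : K)‖) : x ∣ y := by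
  by_cases hx : x = 0
  · have : y = 0 := by
      rw [hx, ZeroMemClass.coe_zero, norm_zero] at h
      exact Subtype.ext (norm_le_zero_iff.1 h)
    rw [this]; exact dvd_zero _
  have hx' : (x : K) ≠ 0 := fun h ↦ hx (Subtype.ext h)
  refine ⟨⟨(y : K) / x, mem_OK.2 ?_⟩, Subtype.ext ?_⟩
  · rw [norm_div]; exact div_le_one_of_le₀ h (norm_nonneg _)
  · rw [Subring.coe_mul]; exact (mul_div_cancel₀ _ hx').symm

lemma OK.norm_le_of_dvd {x y : OK K} (h : x ∣ y) : ‖(y : K)‖ ≤ ‖(x : K)‖ := by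
  obtain ⟨z, rfl⟩ := h
  rw [Subring.coe_mul, norm_mul]
  exact mul_le_of_le_one_right (norm_nonneg _) (mem_OK.1 z.2)

lemma OK.exists_norm_p_pow_le {r : ℝ} (hr : 0 < r) : ∃ N : ℕ, ‖(p : K)‖ ^ N ≤ r :=
  (exists_pow_lt_of_lt_one hr (norm_natCast_p_lt_one (K := K) p)).imp fun _ h ↦ h.le

lemma exists_eq_smul_of_norm_le {x : OK K} (hx : x ≠ 0) {f : restricted (OK K) p σ}
    (h : ∀ m, ‖((rcoeff m f : OK K) : K)‖ ≤ ‖(x : K)‖) : ∃ g, f = x • g := by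
  choose c hc using fun m ↦ OK.dvd_of_norm_le (h m)
  have hx' : 0 < ‖(x : K)‖ := norm_pos_iff.2 fun h ↦ hx (Subtype.ext h)
  -- Division by `x` costs at most `N` powers of `p`, so the quotients still tend to zero.
  obtain ⟨N, hN⟩ := OK.exists_norm_p_pow_le (p := p) (K := K) hx'
  refine ⟨restrictedMk c fun n ↦ (finite_rcoeff f (n + N)).subset fun m hm hf ↦ hm ?_,
    restricted_ext fun m ↦ by rw [map_smul, rcoeff_restrictedMk, hc, smul_eq_mul]⟩
  rw [OK.exists_eq_p_pow_smul] at hf ⊢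
  rw [hc m, Subring.coe_mul, norm_mul, pow_add] at hf
  refine le_of_mul_le_mul_left (hf.trans ?_) hx'
  rw [mul_comm]
  exact mul_le_mul_of_nonneg_right hN (by positivity)

/-- The exponents at which `f` has a coefficient of norm one. -/
def unitExps (f : restricted (OK K) p σ) : Set (σ →₀ ℕ) := {m | ‖((rcoeff m f : OK K) : K)‖ = 1}

lemma finite_unitExps (f : restricted (OK K) p σ) : (unitExps f).Finite :=
  (finite_rcoeff f 1).subset fun m hm hf ↦ by
    rw [OK.exists_eq_p_pow_smul, pow_one] at hf
    have := norm_natCast_p_lt_one (K := K) p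
    rw [show ‖((rcoeff m f : OK K) : K)‖ = 1 from hm] at hf
    linarith

/-- The Gauss norm is attained, as only finitely many coefficients exceed a given `‖p‖ ^ n`; the
scalar is a coefficient of largest norm. -/
lemma exists_eq_smul_unitExps_nonempty {f : restricted (OK K) p σ} (hf : f ≠ 0) :
    ∃ x : OK K, x ≠ 0 ∧ ∃ g, f = x • g ∧ (unitExps g).Nonempty := by
  have h1 : ∃ n, {m | ¬ ∃ y, rcoeff m f = p ^ n • y}.Nonempty := by
    by_contra! h
    refine hf (restricted_ext fun m ↦ OK.pSep (p := p) _ fun n ↦ ?_)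
    by_contra hm
    have hm' : m ∈ {m | ¬ ∃ y, rcoeff m f = p ^ n • y} := hm
    simp only [not_exists] at hm'
    rw [h n] at hm'
    exact hm'
  obtain ⟨n, hn⟩ := h1
  obtain ⟨m₀, hm₀, hmax⟩ := (finite_rcoeff f n).exists_maximalFor
    (fun m ↦ ‖((rcoeff m f : OK K) : K)‖) _ hn
  have hpn : ‖(p : K)‖ ^ n < ‖((rcoeff m₀ f : OK K) : K)‖ := by
    by_contra! h
    exact hm₀ (OK.exists_eq_p_pow_smul.2 h)
  have hx : rcoeff m₀ f ≠ 0 := fun h ↦ by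
    rw [h, ZeroMemClass.coe_zero, norm_zero] at hpn
    exact hpn.not_ge (by positivity)
  obtain ⟨g, hg⟩ := exists_eq_smul_of_norm_le (f := f) hx fun m ↦ by
    by_cases hm : ∃ y, rcoeff m f = p ^ n • y
    · exact (OK.exists_eq_p_pow_smul.1 hm).trans hpn.le
    · by_contra! hlt
      exact hlt.not_ge (hmax hm hlt.le)
  refine ⟨_, hx, g, hg, m₀, ?_⟩
  have h2 : rcoeff m₀ f = rcoeff m₀ f * rcoeff m₀ g := by
    conv_lhs => rw [hg, map_smul, smul_eq_mul]
  have h3 : rcoeff m₀ g = 1 := (mul_eq_left₀ hx).1 h2.symm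
  change ‖((rcoeff m₀ g : OK K) : K)‖ = 1
  rw [h3, OneMemClass.coe_one, norm_one]

/-- `l` is the largest exponent at which `f` has a coefficient of norm one. -/
def IsLead (m : MonomialOrder σ) (f : restricted (OK K) p σ) (l : σ →₀ ℕ) : Prop :=
  l ∈ unitExps f ∧ ∀ k ∈ unitExps f, m.toSyn k ≤ m.toSyn l

lemma exists_isLead (m : MonomialOrder σ) {f : restricted (OK K) p σ}
    (hf : (unitExps f).Nonempty) : ∃ l, IsLead m f l := by
  obtain ⟨l, hl, hmax⟩ := (finite_unitExps f).exists_maximalFor m.toSyn _ hf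
  exact ⟨l, hl, fun k hk ↦ (le_total _ _).elim id (hmax hk)⟩

/-- The element `b` plays the role of a uniformizer, which `O_K` need not have. Among the
coefficients of finitely many restricted series, only finitely many are not divisible by `p`, so
those of norm less than one stay away from norm one. -/
lemma exists_gap (s : Finset (restricted (OK K) p σ)) :
    ∃ b : OK K, b ≠ 0 ∧ ‖(p : K)‖ ≤ ‖(b : K)‖ ∧ ‖(b : K)‖ < 1 ∧
      ∀ f ∈ s, ∀ m, ‖((rcoeff m f : OK K) : K)‖ < 1 → ‖((rcoeff m f : OK K) : K)‖ ≤ ‖(b : K)‖ := by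
  classical
  let E : Set (OK K) := {(p : OK K)} ∪
    ({x | ‖(x : K)‖ < 1} ∩
      ⋃ f ∈ s, (fun m ↦ rcoeff m f) '' {m | ¬ ∃ y, rcoeff m f = p ^ 1 • y})
  have hE : E.Finite := (Set.finite_singleton _).union
    ((s.finite_toSet.biUnion fun f _ ↦ (finite_rcoeff f 1).image _).inter_of_right _)
  have hne : E.Nonempty := ⟨(p : OK K), Or.inl rfl⟩
  obtain ⟨b, hb, hmax⟩ := hE.exists_maximalFor (fun x : OK K ↦ ‖(x : K)‖) E hne
  have hmax' : ∀ x ∈ E, ‖(x : K)‖ ≤ ‖(b : K)‖ := fun x hx ↦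
    (le_total _ _).elim id (hmax hx)
  have hpb : ‖(p : K)‖ ≤ ‖(b : K)‖ := hmax' (p : OK K) (Or.inl rfl)
  refine ⟨b, fun h ↦ ?_, hpb, ?_, fun f hf m hm ↦ ?_⟩
  · rw [h, ZeroMemClass.coe_zero, norm_zero] at hpb
    exact hpb.not_gt (norm_natCast_p_pos p)
  · rcases hb with rfl | hb
    · exact norm_natCast_p_lt_one p
    · exact hb.1
  · by_cases h : ∃ y, rcoeff m f = p ^ 1 • y
    · rw [OK.exists_eq_p_pow_smul, pow_one] at h
      exact h.trans hpb
    · exact hmax' _ (Or.inr ⟨hm, Set.mem_biUnion hf ⟨m, h, rfl⟩⟩)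

/-- The restricted power series without monomials divisible by one of the monomials in `t`. -/
def avoiding (p : ℕ) [Fact p.Prime] [NormedAlgebra ℚ_[p] K] (t : Set (σ →₀ ℕ)) :
    Submodule (OK K) (restricted (OK K) p σ) where
  carrier := {f | ∀ l ∈ t, ∀ m, l ≤ m → rcoeff m f = 0}
  add_mem' hf hg l hl m hm := by rw [map_add, hf l hl m hm, hg l hl m hm, add_zero]
  zero_mem' l _ m _ := map_zero _
  smul_mem' c f hf l hl m hm := by rw [map_smul, hf l hl m hm, smul_zero]

lemma avoiding_pSum (t : Set (σ →₀ ℕ)) : PSum p (avoiding (K := K) p t) := fun g ↦ by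
  have htf : ∀ x : OK K, p • x = 0 → x = 0 := OK.p_torsionFree
  obtain ⟨s, hs⟩ := restricted_pSum (σ := σ) htf OK.pSum fun k ↦ (g k : restricted (OK K) p σ)
  have hsum : ∀ n, (∑ k ∈ Finset.range n, p ^ k • (g k : restricted (OK K) p σ)) =
      (∑ k ∈ Finset.range n, p ^ k • g k : avoiding (K := K) p t) := fun n ↦ by
    push_cast; rfl
  have hs' : s ∈ avoiding (K := K) p t := fun l hl m hm ↦ OK.pSep (p := p) _ fun n ↦ by
    obtain ⟨y, hy⟩ := hs n
    refine ⟨rcoeff m y, ?_⟩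
    rw [hy, hsum, map_add, Subtype.property (∑ k ∈ Finset.range n, p ^ k • g k) l hl m hm,
      zero_add, map_nsmul]
  refine ⟨⟨s, hs'⟩, fun n ↦ ?_⟩
  obtain ⟨y, hy⟩ := hs n
  have hy' : y ∈ avoiding (K := K) p t := fun l hl m hm ↦ by
    refine torsionFree_pow htf n ?_
    rw [← map_nsmul, ← sub_eq_iff_eq_add'.2 hy, hsum]
    exact (sub_mem hs' (Subtype.property _)) l hl m hm
  exact ⟨⟨y, hy'⟩, Subtype.ext (hy.trans (by rw [hsum]; rfl))⟩

/-- One step of the division algorithm. -/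
lemma exists_division_step (m : MonomialOrder σ) {ι : Type} [Fintype ι]
    (a : ι → restricted (OK K) p σ) (l : ι → σ →₀ ℕ) (ha : ∀ i, IsLead m (a i) (l i))
    {b : OK K} (hb0 : b ≠ 0) (hpb : ‖(p : K)‖ ≤ ‖(b : K)‖) (hb1 : ‖(b : K)‖ < 1)
    (hb : ∀ i k, ‖((rcoeff k (a i) : OK K) : K)‖ < 1 → ‖((rcoeff k (a i) : OK K) : K)‖ ≤ ‖(b : K)‖)
    (f : restricted (OK K) p σ) :
    ∃ (q : ι → restricted (OK K) p σ) (r : restricted (OK K) p σ)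
      (g : restricted (OK K) p σ), r ∈ avoiding (K := K) p (Set.range l) ∧
      f = ∑ i, q i * a i + r + b • g := by
  classical
  -- Modulo `b` the series become polynomials, and every coefficient of `a i` of norm less than one
  -- vanishes. So `l i` is the degree of the reduction, with a unit as leading coefficient, and
  -- polynomial division applies.
  let Q := OK K ⧸ Ideal.span {b}
  let π : OK K →+* Q := Ideal.Quotient.mk _
  have hπ : ∀ x, π x = 0 ↔ ‖(x : K)‖ ≤ ‖(b : K)‖ := fun x ↦ by
    rw [Ideal.Quotient.eq_zero_iff_mem, Ideal.mem_span_singleton]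
    exact ⟨OK.norm_le_of_dvd, OK.dvd_of_norm_le⟩
  have hpoly : ∀ f : restricted (OK K) p σ, ∃ P : MvPolynomial σ Q,
      ∀ k, P.coeff k = π (rcoeff k f) := fun f ↦ by
    obtain ⟨P, g, hg⟩ := exists_poly_approx (p := p) OK.p_torsionFree 1 f
    refine ⟨MvPolynomial.map π P, fun k ↦ ?_⟩
    rw [MvPolynomial.coeff_map, hg, map_add, map_add, rcoeff_ofPoly, left_eq_add, hπ, pow_one]
    rw [map_nsmul, nsmul_eq_mul, Subring.coe_mul, norm_mul]
    refine le_trans ?_ hpb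
    exact mul_le_of_le_one_right (norm_nonneg _) (mem_OK.1 (Subtype.property _))
  choose red hred using hpoly
  have hlead : ∀ i, m.degree (red (a i)) = l i := fun i ↦ by
    refine m.toSyn.injective (le_antisymm ?_ ?_)
    · rw [MonomialOrder.degree_le_iff]
      intro k hk
      rw [MvPolynomial.mem_support_iff, hred, Ne, hπ] at hk
      refine (ha i).2 k ?_
      refine le_antisymm (mem_OK.1 (Subtype.property _)) ?_
      by_contra! hlt
      exact hk (hb i k hlt)
    · refine MonomialOrder.le_degree ?_
      rw [MvPolynomial.mem_support_iff, hred, Ne, hπ,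
        show ‖((rcoeff (l i) (a i) : OK K) : K)‖ = 1 from (ha i).1]
      exact hb1.not_ge
  have hunit : ∀ i, IsUnit (m.leadingCoeff (red (a i))) := fun i ↦ by
    rw [MonomialOrder.leadingCoeff, hlead, hred]
    refine IsUnit.map π ?_
    rw [isUnit_iff_dvd_one]
    refine OK.dvd_of_norm_le ?_
    rw [show ‖((rcoeff (l i) (a i) : OK K) : K)‖ = 1 from (ha i).1]
    simp
  obtain ⟨q, r, hqr, -, hr⟩ := m.div hunit (red f)
  choose q' hq' using fun i ↦ MvPolynomial.map_surjective π Ideal.Quotient.mk_surjective (q i)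
  obtain ⟨lift, hlift⟩ : ∃ c : Q → OK K, ∀ x, π (c x) = x :=
    ⟨_, Function.surjInv_eq Ideal.Quotient.mk_surjective⟩
  -- The remainder is lifted monomial by monomial, since an arbitrary lift could contain monomials
  -- that have to be avoided.
  let r' : MvPolynomial σ (OK K) := ∑ k ∈ r.support, MvPolynomial.monomial k (lift (r.coeff k))
  have hr' : ∀ k, r'.coeff k = if k ∈ r.support then lift (r.coeff k) else 0 := fun k ↦ by
    simp [r', MvPolynomial.coeff_sum, MvPolynomial.coeff_monomial]
  have hr'' : MvPolynomial.map π r' = r := by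
    ext k
    rw [MvPolynomial.coeff_map, hr']
    split_ifs with h
    · exact hlift _
    · rw [map_zero]; exact (MvPolynomial.notMem_support_iff.1 h).symm
  have hredmul : ∀ (P : MvPolynomial σ (OK K)) (f : restricted (OK K) p σ),
      ∀ k, (MvPolynomial.map π P * red f).coeff k = π (rcoeff k (ofPoly _ p σ P * f)) :=
    fun P f k ↦ by
      rw [MvPolynomial.coeff_mul, rcoeff_apply, Subalgebra.coe_mul, MvPowerSeries.coeff_mul,
        map_sum]
      refine Finset.sum_congr rfl fun x _ ↦ ?_
      rw [MvPolynomial.coeff_map, hred, map_mul, ← rcoeff_apply, ← rcoeff_apply, rcoeff_ofPoly]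
  obtain ⟨g, hg⟩ := exists_eq_smul_of_norm_le (x := b) hb0
    (f := f - ∑ i, ofPoly _ p σ (q' i) * a i - ofPoly _ p σ r') fun k ↦ by
      rw [← hπ, map_sub, map_sub, map_sub, map_sub, ← hred, hqr, rcoeff_ofPoly,
        ← MvPolynomial.coeff_map, hr'', MvPolynomial.coeff_add, map_sum, map_sum,
        Finsupp.linearCombination_apply, Finsupp.sum_fintype _ _ (by simp),
        MvPolynomial.coeff_sum, sub_sub, sub_eq_zero]
      congr 1
      refine Finset.sum_congr rfl fun i _ ↦ ?_
      rw [← hredmul, hq', smul_eq_mul]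
  refine ⟨fun i ↦ ofPoly _ p σ (q' i), ofPoly _ p σ r', g, ?_, by rw [← hg]; abel⟩
  rintro _ ⟨i, rfl⟩ k hk
  rw [rcoeff_ofPoly, hr', if_neg]
  intro h
  refine hr k h i ?_
  rwa [hlead]

/-- One division step leaves an error divisible by `b`. After `N` steps with `p ∣ b ^ N` the error
is divisible by `p`, and successive approximation applies to `(q, r) ↦ ∑ q_i a_i + r`. -/
lemma exists_division (m : MonomialOrder σ) {ι : Type} [Fintype ι]
    (a : ι → restricted (OK K) p σ) (l : ι → σ →₀ ℕ) (ha : ∀ i, IsLead m (a i) (l i))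
    (f : restricted (OK K) p σ) :
    ∃ (q : ι → restricted (OK K) p σ), f - ∑ i, q i * a i ∈ avoiding (K := K) p (Set.range l) := by
  classical
  have htf : ∀ x : OK K, p • x = 0 → x = 0 := OK.p_torsionFree
  obtain ⟨b, hb0, hpb, hb1, hb⟩ := exists_gap (Finset.univ.image a)
  have hstep := exists_division_step m a l ha hb0 hpb hb1 fun i ↦ hb _ (by simp)
  let φ : (ι → restricted (OK K) p σ) × avoiding (K := K) p (Set.range l) →ₗ[OK K]
      restricted (OK K) p σ :=
    (∑ i, (LinearMap.mulRight (OK K) (a i)).comp (LinearMap.proj i)).coprod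
      (avoiding (K := K) p (Set.range l)).subtype
  have hφ : ∀ q r, φ (q, r) = ∑ i, q i * a i + r := fun q r ↦ by simp [φ]
  have hpow : ∀ (N : ℕ) (f : restricted (OK K) p σ), ∃ x g, f = φ x + b ^ N • g := fun N ↦ by
    induction N with
    | zero => exact fun f ↦ ⟨0, f, by simp⟩
    | succ N ih =>
      intro f
      obtain ⟨x, g, rfl⟩ := ih f
      obtain ⟨q, r, g', hr, rfl⟩ := hstep g
      refine ⟨x + b ^ N • (q, ⟨r, hr⟩), g', ?_⟩
      rw [map_add, map_smul, hφ q, pow_succ, mul_smul, smul_add, add_assoc]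
  obtain ⟨N, hN⟩ := exists_pow_lt_of_lt_one (norm_natCast_p_pos (K := K) p) hb1
  obtain ⟨c, hc⟩ : (p : OK K) ∣ b ^ N := OK.dvd_of_norm_le (by
    push_cast; rw [norm_pow]; exact hN.le)
  have hsurj : Function.Surjective φ.toAddMonoidHom := by
    refine surjective_of_approx (p := p) _ ((PSum.pi fun _ ↦ restricted_pSum htf OK.pSum).prod
      (avoiding_pSum _)) (restricted_pSep OK.pSep) fun f ↦ ?_
    obtain ⟨x, g, hx⟩ := hpow N f
    refine ⟨x, c • g, ?_⟩
    rw [hx, hc, mul_smul, Nat.cast_smul_eq_nsmul]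
    rfl
  obtain ⟨⟨q, r⟩, hqr⟩ := hsurj f
  refine ⟨q, ?_⟩
  rw [← hqr]
  change φ (q, r) - _ ∈ _
  rw [hφ, add_sub_cancel_left]
  exact r.2

/-- Saturated ideals of `O_K⟨σ⟩` are finitely generated. -/
theorem OK.fg_of_saturated [Finite σ] (I : Ideal (restricted (OK K) p σ))
    (hI : ∀ x, p • x ∈ I → x ∈ I) : I.FG := by
  classical
  let _ : LinearOrder σ := linearOrderOfSTO WellOrderingRel
  let m : MonomialOrder σ := MonomialOrder.lex
  obtain ⟨t, ht, hmin⟩ := exists_finset_le_of_mem {l | ∃ f ∈ I, IsLead m f l}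
  choose a haI ha using fun l : t ↦ ht l.2
  have hpow : ∀ n x, p ^ n • x ∈ I → x ∈ I := fun n ↦ by
    induction n with
    | zero => simp
    | succ n ih => exact fun x hx ↦ ih x (hI _ (by rwa [← mul_smul, ← pow_succ']))
  refine ⟨Finset.univ.image a, le_antisymm (Ideal.span_le.2 ?_) fun f hf ↦ ?_⟩
  · intro x hx
    obtain ⟨i, -, rfl⟩ := Finset.mem_image.1 hx
    exact haI i
  · obtain ⟨q, hq⟩ := exists_division m a _ ha f
    have hmem : ∑ i, q i * a i ∈ Ideal.span ((Finset.univ.image a : Finset _) : Set _) :=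
      Ideal.sum_mem _ fun i _ ↦ Ideal.mul_mem_left _ _ (Ideal.subset_span (by simp))
    have hr : f - ∑ i, q i * a i ∈ I :=
      sub_mem hf (Ideal.sum_mem _ fun i _ ↦ Ideal.mul_mem_left _ _ (haI i))
    -- A nonzero remainder equals `x • g` with `g` of Gauss norm one, and saturation puts `g` in
    -- `I`. The leading exponent of `g` then lies above some chosen leading exponent, although the
    -- remainder has no such monomial.
    suffices f - ∑ i, q i * a i = 0 by rwa [sub_eq_zero.1 this]
    by_contra hne
    obtain ⟨x, hx, g, hg, hne'⟩ := exists_eq_smul_unitExps_nonempty hne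
    obtain ⟨N, hN⟩ := OK.exists_norm_p_pow_le (p := p) (K := K)
      (norm_pos_iff.2 fun h ↦ hx (Subtype.ext h) : 0 < ‖(x : K)‖)
    obtain ⟨y, hy⟩ : x ∣ ((p ^ N : ℕ) : OK K) := OK.dvd_of_norm_le (by
      push_cast; rw [norm_pow]; exact hN)
    have hgI : g ∈ I := hpow N g (by
      rw [← Nat.cast_smul_eq_nsmul (OK K), hy, mul_comm, mul_smul, ← hg, Algebra.smul_def]
      exact Ideal.mul_mem_left _ _ hr)
    obtain ⟨l, hl⟩ := exists_isLead m hne'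
    obtain ⟨k, hk, hkl⟩ := hmin l ⟨g, hgI, hl⟩
    have h0 := hq k ⟨⟨k, hk⟩, rfl⟩ l hkl
    rw [hg, map_smul, smul_eq_mul] at h0
    have h1 := (mul_eq_zero.1 h0).resolve_left hx
    have h2 : ‖((rcoeff l g : OK K) : K)‖ = 1 := hl.1
    rw [h1, ZeroMemClass.coe_zero, norm_zero] at h2
    exact zero_ne_one h2

end OKTate

end TateRes
end

noncomputable section

set_option linter.unusedSectionVars false

namespace TateRes

/-! ### Saturated submodules -/

/-- Every `p`-saturated submodule of a finite free `S`-module is finitely generated. -/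
def SatFG (p : ℕ) (S : Type*) [CommRing S] : Prop :=
  ∀ (r : ℕ) (N : Submodule S (Fin r → S)), (∀ x, p • x ∈ N → x ∈ N) → N.FG

section SatFG

variable {p : ℕ} {R S : Type*} [CommRing R] [CommRing S]

lemma SatFG.ideal_fg (h : SatFG p R) (I : Ideal R) (hI : ∀ x, p • x ∈ I → x ∈ I) : I.FG := by
  have h1 := h 1 (Submodule.comap (LinearMap.proj 0 : (Fin 1 → R) →ₗ[R] R) I) fun x hx ↦ hI _ hx
  have h2 := h1.map (LinearMap.proj 0 : (Fin 1 → R) →ₗ[R] R)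
  rwa [Submodule.map_comap_eq_of_surjective fun x ↦ ⟨fun _ ↦ x, rfl⟩] at h2

/-- The relations `∑ x_i a_i = ∑ y_j b_j` form a saturated submodule, being the kernel of a map to a
`p`-torsion free ring. Its image under `α` is the intersection. -/
lemma SatFG.inf_fg (h : SatFG p R) (hR : ∀ x : R, p • x = 0 → x = 0) {I J : Ideal R} (hI : I.FG)
    (hJ : J.FG) : (I ⊓ J).FG := by
  obtain ⟨k, a, ha⟩ := Submodule.fg_iff_exists_fin_generating_family.1 hI
  obtain ⟨l, b, hb⟩ := Submodule.fg_iff_exists_fin_generating_family.1 hJ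
  let α : (Fin (k + l) → R) →ₗ[R] R :=
    (Fintype.linearCombination R a).comp (LinearMap.funLeft R R (Fin.castAdd l))
  let β : (Fin (k + l) → R) →ₗ[R] R :=
    (Fintype.linearCombination R b).comp (LinearMap.funLeft R R (Fin.natAdd k))
  have h1 := (h _ (LinearMap.ker (α - β)) fun x hx ↦ hR _ (by
    rw [← map_nsmul]; exact hx)).map α
  suffices H : I ⊓ J = Submodule.map α (LinearMap.ker (α - β)) by rwa [H]
  ext x
  rw [Submodule.mem_map]
  constructor
  · rintro ⟨hxI, hxJ⟩
    have hxI' : x ∈ I := hxI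
    have hxJ' : x ∈ J := hxJ
    rw [← ha, ← Fintype.range_linearCombination] at hxI'
    rw [← hb, ← Fintype.range_linearCombination] at hxJ'
    obtain ⟨y, hy⟩ := hxI'
    obtain ⟨z, hz⟩ := hxJ'
    have h2 : α (Fin.append y z) = x := by
      rw [← hy]
      simp only [α, LinearMap.comp_apply]
      congr 1
      ext i
      simp [LinearMap.funLeft_apply]
    have h3 : β (Fin.append y z) = x := by
      rw [← hz]
      simp only [β, LinearMap.comp_apply]
      congr 1
      ext i
      simp [LinearMap.funLeft_apply]
    exact ⟨Fin.append y z, by rw [LinearMap.mem_ker, LinearMap.sub_apply, h2, h3, sub_self], h2⟩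
  · rintro ⟨y, hy, rfl⟩
    rw [LinearMap.mem_ker, LinearMap.sub_apply, sub_eq_zero] at hy
    refine ⟨?_, ?_⟩
    · change α y ∈ I
      rw [← ha, ← Fintype.range_linearCombination]
      exact ⟨_, rfl⟩
    · change α y ∈ J
      rw [hy, ← hb, ← Fintype.range_linearCombination]
      exact ⟨_, rfl⟩

/-- A submodule that contains `ξ R^r` is the preimage of its image in `S^r`. The image is therefore
saturated, and lifts of its generators together with the `ξ e_i` generate `N`. -/
lemma SatFG.fg_of_smul_mem (h : SatFG p S) (π : R →+* S) (hπ : Function.Surjective π) {ξ : R}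
    (hker : ∀ x, π x = 0 ↔ ∃ y, x = ξ * y) {r : ℕ} (N : Submodule R (Fin r → R))
    (hN : ∀ x, p • x ∈ N → x ∈ N) (hξ : ∀ x, ξ • x ∈ N) : N.FG := by
  have hmem : ∀ x y : Fin r → R, (∀ i, π (x i) = π (y i)) → x ∈ N → y ∈ N := fun x y hxy hx ↦ by
    choose z hz using fun i ↦ (hker (y i - x i)).1 (by rw [map_sub, hxy, sub_self])
    have : y = x + ξ • z := funext fun i ↦ by
      rw [Pi.add_apply, Pi.smul_apply, smul_eq_mul, ← hz]; ring
    rw [this]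
    exact add_mem hx (hξ z)
  let N' : Submodule S (Fin r → S) :=
    { carrier := {y | ∃ x ∈ N, y = π ∘ x}
      add_mem' := by
        rintro _ _ ⟨x, hx, rfl⟩ ⟨y, hy, rfl⟩
        exact ⟨x + y, add_mem hx hy, funext fun i ↦ by simp⟩
      zero_mem' := ⟨0, zero_mem _, funext fun i ↦ by simp⟩
      smul_mem' := by
        rintro c _ ⟨x, hx, rfl⟩
        obtain ⟨c, rfl⟩ := hπ c
        exact ⟨c • x, N.smul_mem _ hx, funext fun i ↦ by simp⟩ }
  have hN' : ∀ y, p • y ∈ N' → y ∈ N' := by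
    rintro y ⟨x, hx, hxy⟩
    choose z hz using fun i ↦ hπ (y i)
    refine ⟨z, hN _ (hmem x _ (fun i ↦ ?_) hx), funext fun i ↦ (hz i).symm⟩
    have := congrFun hxy i
    rw [Pi.smul_apply, map_nsmul π, hz]
    exact this.symm
  obtain ⟨k, y, hy⟩ := Submodule.fg_iff_exists_fin_generating_family.1 (h r N' hN')
  have hyN : ∀ j, y j ∈ N' := fun j ↦ hy ▸ Submodule.subset_span ⟨j, rfl⟩
  choose x hxN hx using hyN
  refine Submodule.fg_def.2 ⟨Set.range x ∪ Set.range fun i ↦ ξ • (Pi.single i 1 : Fin r → R),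
    (Set.finite_range _).union (Set.finite_range _), le_antisymm ?_ fun n hn ↦ ?_⟩
  · rw [Submodule.span_le]
    rintro _ (⟨j, rfl⟩ | ⟨i, rfl⟩)
    · exact hxN j
    · exact hξ _
  · have h1 : π ∘ n ∈ N' := ⟨n, hn, rfl⟩
    rw [← hy, ← Fintype.range_linearCombination] at h1
    obtain ⟨c, hc⟩ := h1
    choose d hd using fun j ↦ hπ (c j)
    choose z hz using fun i ↦ (hker (n i - ∑ j, d j * x j i)).1 (by
      have h2 := congrFun hc i
      rw [Fintype.linearCombination_apply, Finset.sum_apply] at h2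
      rw [map_sub, map_sum, show π (n i) = (π ∘ n) i from rfl, ← h2, sub_eq_zero]
      refine Finset.sum_congr rfl fun j _ ↦ ?_
      rw [hx, map_mul, hd]; rfl)
    have h3 : n = ∑ j, d j • x j + ∑ i, z i • ξ • (Pi.single i 1 : Fin r → R) := by
      funext i
      have := hz i
      simp only [Pi.add_apply, Finset.sum_apply, Pi.smul_apply, smul_eq_mul, Pi.single_apply,
        mul_ite, mul_one, mul_zero, Finset.sum_ite_eq, Finset.mem_univ, if_true]
      linear_combination this
    rw [h3]
    exact add_mem
      (sum_mem fun j _ ↦ Submodule.smul_mem _ _ (Submodule.subset_span (Or.inl ⟨j, rfl⟩)))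
      (sum_mem fun i _ ↦ Submodule.smul_mem _ _ (Submodule.subset_span (Or.inr ⟨i, rfl⟩)))

/-- Induction on `j` with `ξ^j R^r ⊆ N`. The sum `N + ξ R^r` need not be saturated, so it is
replaced by its saturation `N'`, which is finitely generated by reduction to `S`. In a finite free
cover of `N'`, the preimage of `N` is saturated and contains `ξ^j` times the cover, so the induction
hypothesis applies to it. -/
lemma SatFG.of_nilpotent_thickening (h : SatFG p S) (π : R →+* S) (hπ : Function.Surjective π)
    {ξ : R} (hker : ∀ x, π x = 0 ↔ ∃ y, x = ξ * y) {e : ℕ} (he : ξ ^ e = 0) : SatFG p R := by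
  suffices H : ∀ (j r : ℕ) (N : Submodule R (Fin r → R)), (∀ x, p • x ∈ N → x ∈ N) →
      (∀ x : Fin r → R, ξ ^ j • x ∈ N) → N.FG from
    fun r N hN ↦ H e r N hN fun x ↦ by rw [he, zero_smul]; exact zero_mem _
  intro j
  induction j with
  | zero =>
    intro r N _ hN
    have : N = ⊤ := eq_top_iff.2 fun x _ ↦ by simpa using hN x
    rw [this]
    exact Module.Finite.fg_top
  | succ j ih =>
    intro r N hN hξ
    have hpow : ∀ n x, p ^ n • x ∈ N → x ∈ N := fun n ↦ by
      induction n with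
      | zero => simp
      | succ n ih => exact fun x hx ↦ ih x (hN _ (by rwa [← mul_smul, ← pow_succ']))
    let N' : Submodule R (Fin r → R) :=
      { carrier := {x | ∃ n y, p ^ n • x + ξ • y ∈ N}
        add_mem' := by
          rintro x x' ⟨n, y, hx⟩ ⟨n', y', hx'⟩
          refine ⟨n + n', p ^ n' • y + p ^ n • y', ?_⟩
          convert add_mem (N.smul_of_tower_mem (p ^ n') hx) (N.smul_of_tower_mem (p ^ n) hx')
            using 1
          simp only [pow_add, smul_add, mul_smul, smul_comm ξ]
          rw [smul_comm (p ^ n) (p ^ n') x]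
          abel
        zero_mem' := ⟨0, 0, by simp⟩
        smul_mem' := by
          rintro c x ⟨n, y, hx⟩
          refine ⟨n, c • y, ?_⟩
          convert N.smul_mem c hx using 1
          rw [smul_add, smul_comm c, smul_comm c] }
    have hNN' : N ≤ N' := fun x hx ↦ ⟨0, 0, by simpa using hx⟩
    have hN' : N'.FG := by
      refine h.fg_of_smul_mem π hπ hker N' ?_ fun x ↦ ⟨0, -x, by simp⟩
      rintro x ⟨n, y, hx⟩
      exact ⟨n + 1, y, by rwa [pow_succ, mul_smul]⟩
    obtain ⟨s, b, hb⟩ := Submodule.fg_iff_exists_fin_generating_family.1 hN'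
    have hrange : LinearMap.range (Fintype.linearCombination R b) = N' := by
      rw [Fintype.range_linearCombination, hb]
    have h1 := (ih s (N.comap (Fintype.linearCombination R b))
      (fun x hx ↦ hN _ (by rw [← map_nsmul]; exact hx)) fun x ↦ by
        rw [Submodule.mem_comap, map_smul]
        obtain ⟨n, y, hx⟩ : Fintype.linearCombination R b x ∈ N' := hrange ▸ ⟨x, rfl⟩
        refine hpow n _ ?_
        -- Multiplying `p^n x + ξ y ∈ N` by `ξ^j` and removing `ξ^(j+1) y ∈ N` leaves `p^n ξ^j x ∈
        -- N`; saturation then removes `p^n`.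
        have h2 := sub_mem (N.smul_mem (ξ ^ j) hx) (hξ y)
        rwa [smul_add, ← mul_smul, ← pow_succ, add_sub_cancel_right, smul_comm] at h2).map
          (Fintype.linearCombination R b)
    rwa [Submodule.map_comap_eq_of_le (hNN'.trans hrange.ge)] at h1

lemma pSep_trivSqZeroExt (h : PSep p S) (r : ℕ) : PSep p (TrivSqZeroExt S (Fin r → S)) := by
  refine PSep.of_injective (N := S × (Fin r → S))
    { toFun := fun d ↦ (d.fst, d.snd)
      map_zero' := rfl
      map_add' := fun _ _ ↦ rfl } (fun a b h ↦ TrivSqZeroExt.ext ?_ ?_)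
    (h.prod (PSep.pi fun _ ↦ h))
  · exact congrArg Prod.fst h
  · exact congrArg Prod.snd h

lemma pSum_trivSqZeroExt (h : PSum p S) (r : ℕ) : PSum p (TrivSqZeroExt S (Fin r → S)) := by
  refine PSum.of_surjective (M := S × (Fin r → S))
    { toFun := fun d ↦ (TrivSqZeroExt.inl d.1 + TrivSqZeroExt.inr d.2)
      map_zero' := by simp
      map_add' := fun a b ↦ by
        rw [Prod.fst_add, Prod.snd_add, TrivSqZeroExt.inl_add, TrivSqZeroExt.inr_add]
        abel } (fun d ↦ ⟨(d.fst, d.snd), TrivSqZeroExt.inl_fst_add_inr_snd_eq d⟩)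
    (h.prod (PSum.pi fun _ ↦ h))

/-- Finite generation of saturated submodules of `S ^ r` follows from that of saturated ideals in
a ring that surjects onto the square-zero extension of `S` by `S ^ r`. -/
lemma fg_of_trivSqZeroExt (htf : ∀ x : S, p • x = 0 → x = 0) {r : ℕ}
    (φ : R →+* TrivSqZeroExt S (Fin r → S)) (ι : S →+* R)
    (hι : ∀ s, φ (ι s) = TrivSqZeroExt.inl s) (t : Fin r → R)
    (ht : ∀ i, φ (t i) = TrivSqZeroExt.inr (Pi.single i 1))
    (hR : ∀ I : Ideal R, (∀ x, p • x ∈ I → x ∈ I) → I.FG)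
    (N : Submodule S (Fin r → S)) (hN : ∀ x, p • x ∈ N → x ∈ N) : N.FG := by
  have hinr : ∀ m : Fin r → S, ∃ f, φ f = TrivSqZeroExt.inr m := fun m ↦ by
    refine ⟨∑ i, ι (m i) * t i, ?_⟩
    rw [map_sum]
    simp only [map_mul, hι, ht, TrivSqZeroExt.inl_mul_inr]
    rw [← TrivSqZeroExt.inr_sum]
    congr 1
    funext j
    simp [Finset.sum_apply, Pi.single_apply]
  -- The preimage of the ideal `0 ⊕ N`. It is saturated since `S` is torsion free and `N` is
  -- saturated. Its generators have second components that generate `N`, because `R` acts on the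
  -- square-zero part through `S`.
  let I : Ideal R :=
    { carrier := {f | (φ f).fst = 0 ∧ (φ f).snd ∈ N}
      add_mem' := fun {f g} hf hg ↦ ⟨by rw [map_add, TrivSqZeroExt.fst_add, hf.1, hg.1, add_zero],
        by rw [map_add, TrivSqZeroExt.snd_add]; exact add_mem hf.2 hg.2⟩
      zero_mem' := ⟨by rw [map_zero, TrivSqZeroExt.fst_zero],
        by rw [map_zero, TrivSqZeroExt.snd_zero]; exact zero_mem _⟩
      smul_mem' := fun c f hf ↦ ⟨by
          rw [smul_eq_mul, map_mul, TrivSqZeroExt.fst_mul, hf.1, mul_zero], by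
          rw [smul_eq_mul, map_mul, TrivSqZeroExt.snd_mul, hf.1, MulOpposite.op_zero, zero_smul,
            add_zero]
          exact N.smul_mem _ hf.2⟩ }
  obtain ⟨F, hF⟩ := hR I fun f hf ↦ by
    refine ⟨htf _ ?_, hN _ ?_⟩
    · rw [← TrivSqZeroExt.fst_smul, ← map_nsmul]; exact hf.1
    · rw [← TrivSqZeroExt.snd_smul, ← map_nsmul]; exact hf.2
  classical
  refine ⟨F.image fun f ↦ (φ f).snd, le_antisymm ?_ fun m hm ↦ ?_⟩
  · rw [Submodule.span_le]
    intro x hx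
    obtain ⟨f, hf, rfl⟩ := Finset.mem_image.1 hx
    have : f ∈ I := hF ▸ Ideal.subset_span hf
    exact this.2
  · have H : ∀ f ∈ Ideal.span (F : Set R), (φ f).snd ∈
        Submodule.span S ((F.image fun f ↦ (φ f).snd : Finset (Fin r → S)) : Set (Fin r → S)) := by
      have hle : Ideal.span (F : Set R) ≤ I := hF.le
      intro f hf
      induction hf using Submodule.span_induction with
      | mem x hx =>
        exact Submodule.subset_span (Finset.mem_coe.2 (Finset.mem_image_of_mem _ hx))
      | zero => rw [map_zero, TrivSqZeroExt.snd_zero]; exact zero_mem _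
      | add x y _ _ hx hy => rw [map_add, TrivSqZeroExt.snd_add]; exact add_mem hx hy
      | smul c x hx' hx =>
        rw [smul_eq_mul, map_mul, TrivSqZeroExt.snd_mul, (hle hx').1, MulOpposite.op_zero,
          zero_smul, add_zero]
        exact Submodule.smul_mem _ _ hx
    obtain ⟨f, hf⟩ := hinr m
    have := H f (by
      rw [hF]
      exact ⟨by rw [hf, TrivSqZeroExt.fst_inr], by rw [hf, TrivSqZeroExt.snd_inr]; exact hm⟩)
    rwa [hf, TrivSqZeroExt.snd_inr] at this

/-- `fg_of_trivSqZeroExt` for algebras `S` and `T` with the universal property of restricted power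
series rings in the variables `σ` and `σ ⊕ Fin r`. -/
lemma fg_of_evaluation {A S T : Type u} [CommRing A] [CommRing S] [CommRing T] [Algebra A S]
    [Algebra A T] {σ : Type} {r : ℕ} (v : σ → S) (w : σ ⊕ Fin r → T)
    (htf : ∀ x : S, p • x = 0 → x = 0) (hS : PSep p S) (hS' : PSum p S)
    (hext : ∀ (D : Type u) [CommRing D] [Algebra A D], PSep p D → ∀ φ ψ : S →ₐ[A] D,
      (∀ s, φ (v s) = ψ (v s)) → φ = ψ)
    (ι : S →ₐ[A] T) (hι : ∀ s, ι (v s) = w (Sum.inl s))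
    (heval : ∀ (D : Type u) [CommRing D] [Algebra A D], PSep p D → PSum p D →
      ∀ c : σ ⊕ Fin r → D, ∃ φ : T →ₐ[A] D, ∀ s, φ (w s) = c s)
    (hT : ∀ I : Ideal T, (∀ x, p • x ∈ I → x ∈ I) → I.FG)
    (N : Submodule S (Fin r → S)) (hN : ∀ x, p • x ∈ N → x ∈ N) : N.FG := by
  have hsep := pSep_trivSqZeroExt hS r
  obtain ⟨φ, hφ⟩ := heval (TrivSqZeroExt S (Fin r → S)) hsep (pSum_trivSqZeroExt hS' r)
    (Sum.elim (fun s ↦ TrivSqZeroExt.inl (v s)) fun i ↦ TrivSqZeroExt.inr (Pi.single i 1))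
  have hφι : φ.comp ι = TrivSqZeroExt.inlAlgHom A S (Fin r → S) :=
    hext _ hsep _ _ fun s ↦ by
      rw [AlgHom.comp_apply, hι, hφ]
      rfl
  exact fg_of_trivSqZeroExt htf φ.toRingHom ι.toRingHom
    (DFunLike.congr_fun hφι) (fun i ↦ w (Sum.inr i)) (fun i ↦ hφ _) hT N hN

/-- A submodule of `A⟨σ⟩^r` becomes an ideal in `r` more variables, by evaluating these at the basis
of the square-zero ideal of the trivial extension, which is again `p`-adically complete. -/
lemma satFG_restricted {A : Type u} [CommRing A] (htf : ∀ x : A, p • x = 0 → x = 0)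
    (hA : PSep p A) (hA' : PSum p A) {σ : Type} [Finite σ]
    (hfg : ∀ (τ : Type) [Finite τ] (I : Ideal (restricted A p τ)),
      (∀ x, p • x ∈ I → x ∈ I) → I.FG) : SatFG p (restricted A p σ) := fun r N hN ↦ by
  have hsep : ∀ τ : Type, PSep p (restricted A p τ) := fun τ ↦ restricted_pSep hA
  have hsum : ∀ τ : Type, PSum p (restricted A p τ) := fun τ ↦ restricted_pSum htf hA'
  obtain ⟨ι, hι⟩ := exists_eval (A := A) (σ := σ) (C := restricted A p (σ ⊕ Fin r)) htf
    (hsep _) (hsum _) fun s ↦ rvar (Sum.inl s)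
  refine fg_of_evaluation (A := A) (T := restricted A p (σ ⊕ Fin r)) rvar rvar
    (restricted_torsionFree htf) (hsep _) (hsum _) ?_ ι hι ?_
    (hfg _) N hN
  · intro D _ _ hD φ ψ h
    have := restricted_ringHom_ext htf hD (φ := φ.toRingHom) (ψ := ψ.toRingHom)
      (fun a ↦ (φ.commutes a).trans (ψ.commutes a).symm) h
    exact AlgHom.ext fun x ↦ DFunLike.congr_fun this x
  · intro D _ _ hD hD' c
    exact exists_eval htf hD hD' c

end SatFG

/-! ### Saturated submodules over `O_K⟨σ⟩` and `A_inf,e⟨σ⟩` -/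

section TateSatFG

variable {p : ℕ} [Fact p.Prime] {K : Type u} [NormedField K] [IsUltrametricDist K]
  [NormedAlgebra ℚ_[p] K] [CompleteSpace K] {σ : Type}

/-- Saturated submodules of finite free `O_K⟨σ⟩`-modules are finitely generated. -/
lemma OK.satFG [Finite σ] : SatFG p (restricted (OK K) p σ) :=
  satFG_restricted OK.p_torsionFree OK.pSep OK.pSum fun _ ↦ OK.fg_of_saturated

lemma AinfE.xi_pow_eq_zero (ζ : RootSystem p K) (e : ℕ) :
    (Ideal.Quotient.mk (Ideal.span {ζ.xi ^ e}) ζ.xi) ^ e = 0 := by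
  rw [← map_pow]
  exact AinfE.mk_eq_zero.2 ⟨1, by rw [mul_one]⟩

/-- Saturated submodules of finite free `A_inf,e⟨σ⟩`-modules are finitely generated. -/
lemma AinfE.satFG (hK : IsPerfectoid p K) (ζ : RootSystem p K) (e : ℕ) [Finite σ] :
    SatFG p (restricted (AinfE ζ e) p σ) := by
  -- The case `e = 0` is separate: the ring is zero, and `θ` does not factor through it.
  rcases e with _ | e
  · have h0 : Subsingleton (AinfE ζ 0) := by
      rw [Ideal.Quotient.subsingleton_iff, pow_zero, Ideal.span_singleton_one]
    have : Subsingleton (restricted (AinfE ζ 0) p σ) :=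
      ⟨fun f g ↦ restricted_ext fun m ↦ Subsingleton.elim _ _⟩
    intro r N _
    have : N = ⊥ := Subsingleton.elim _ _
    rw [this]
    exact Submodule.fg_bot
  have htf : ∀ x : OK K, p • x = 0 → x = 0 := OK.p_torsionFree
  let q : Ainf p K →+* AinfE ζ (e + 1) := Ideal.Quotient.mk _
  let π : AinfE ζ (e + 1) →+* OK K := Ideal.Quotient.lift _ (theta p K) fun a ha ↦ by
    obtain ⟨b, rfl⟩ := Ideal.mem_span_singleton.1 ha
    rw [map_mul, map_pow, ζ.theta_xi, pow_succ, mul_zero, zero_mul]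
  have hπq : ∀ a, π (q a) = theta p K a := fun a ↦ rfl
  have hπ : Function.Surjective π := fun y ↦ by
    obtain ⟨a, ha⟩ := theta_surjective hK y
    exact ⟨q a, ha⟩
  have hlift : Function.Surjective (restrictedMap q : restricted _ p σ →+* restricted _ p σ) :=
    restrictedMap_surjective q Ideal.Quotient.mk_surjective Ainf.p_torsionFree
      (AinfE.p_torsionFree ζ _) Ainf.pSum (AinfE.pSep ζ _)
  have hlift2 : Function.Surjective (restrictedMap π : restricted _ p σ →+* restricted _ p σ) :=
    restrictedMap_surjective π hπ (AinfE.p_torsionFree ζ _) htf (AinfE.pSum ζ _) OK.pSep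
  refine OK.satFG.of_nilpotent_thickening (restrictedMap π) hlift2
    (ξ := algebraMap _ _ (q ζ.xi)) (e := e + 1) (fun f ↦ ⟨fun hf ↦ ?_, ?_⟩) ?_
  -- The kernel is computed on a lift to `A_inf⟨σ⟩`, where each coefficient is divisible by `ξ`;
  -- regularity of `p, ξ` makes the quotients tend to zero.
  · obtain ⟨f, rfl⟩ := hlift f
    have h1 : ∀ m, ∃ b, rcoeff m f = ζ.xi * b := fun m ↦ by
      have h2 : theta p K (rcoeff m f) = 0 := by
        have := congrArg (rcoeff m) hf
        rwa [rcoeff_restrictedMap, rcoeff_restrictedMap, map_zero] at this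
      have h3 : rcoeff m f ∈ Ideal.span {ζ.xi} := ζ.ker_theta ▸ h2
      exact Ideal.mem_span_singleton.1 h3
    choose c hc using h1
    refine ⟨restrictedMap q (restrictedMk c fun n ↦ (finite_rcoeff f n).subset fun m hm hy ↦ ?_),
      restricted_ext fun m ↦ ?_⟩
    · obtain ⟨y, hy⟩ := hy
      rw [hc, ← pow_one ζ.xi] at hy
      obtain ⟨z, hz, -⟩ := ζ.xi_pow_mul_dvd_p_pow 1 n hy
      exact hm ⟨z, hz⟩
    · rw [← Algebra.smul_def, map_smul, rcoeff_restrictedMap, rcoeff_restrictedMap, hc, map_mul,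
        smul_eq_mul, rcoeff_restrictedMk]
  · rintro ⟨y, rfl⟩
    rw [map_mul, restrictedMap_algebraMap, hπq, ζ.theta_xi, map_zero, zero_mul]
  · rw [← map_pow, AinfE.xi_pow_eq_zero, map_zero]

end TateSatFG

end TateRes
end

noncomputable section

set_option linter.unusedSectionVars false

namespace TateRes

/-! ### Differences of two homomorphisms of Tate algebras -/

section Difference

variable {A S : Type*} [CommRing A] [CommRing S] {p : ℕ} {σ : Type}

/-- Telescoping along `φ(PX) - ψ(PX) = (φ P - ψ P) ψ X + φ P (φ X - ψ X)`. The group `U` keeps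
control of the coefficients, which a limit argument needs. -/
lemma exists_sub_eq_sum [Fintype σ] (φ ψ : restricted A p σ →+* S)
    (hC : ∀ a, φ (algebraMap A _ a) = ψ (algebraMap A _ a)) (U : AddSubgroup S)
    (hU : ∀ f g, φ f * ψ g ∈ U) (P : MvPolynomial σ A) :
    ∃ a : σ → U, φ (ofPoly A p σ P) - ψ (ofPoly A p σ P) =
      ∑ s, (a s : S) * (φ (rvar s) - ψ (rvar s)) := by
  classical
  -- Unlike `U`, the subgroup generated by the products `φ f * ψ g` is stable under multiplication
  -- by the image of `ψ`, as the induction requires.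
  let W : AddSubgroup S := AddSubgroup.closure {x | ∃ f g, x = φ f * ψ g}
  have hW : W ≤ U := (AddSubgroup.closure_le _).2 (by rintro _ ⟨f, g, rfl⟩; exact hU f g)
  have hWψ : ∀ x ∈ W, ∀ h, x * ψ h ∈ W := fun x hx h ↦ by
    induction hx using AddSubgroup.closure_induction with
    | mem x hx =>
      obtain ⟨f, g, rfl⟩ := hx
      exact AddSubgroup.subset_closure ⟨f, g * h, by rw [map_mul, mul_assoc]⟩
    | zero => rw [zero_mul]; exact zero_mem _
    | add x y _ _ hx hy => rw [add_mul]; exact add_mem hx hy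
    | neg x _ hx => rw [neg_mul]; exact neg_mem hx
  suffices H : ∃ a : σ → W, φ (ofPoly A p σ P) - ψ (ofPoly A p σ P) =
      ∑ s, (a s : S) * (φ (rvar s) - ψ (rvar s)) by
    obtain ⟨a, ha⟩ := H
    exact ⟨fun s ↦ ⟨a s, hW (a s).2⟩, ha⟩
  induction P using MvPolynomial.induction_on with
  | C a =>
    have : ofPoly A p σ (MvPolynomial.C a) = algebraMap _ _ a := (ofPoly A p σ).commutes a
    exact ⟨0, by simp [this, hC]⟩
  | add P Q hP hQ =>
    obtain ⟨a, ha⟩ := hP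
    obtain ⟨b, hb⟩ := hQ
    refine ⟨a + b, ?_⟩
    simp only [map_add, Pi.add_apply, AddSubgroup.coe_add, add_mul, Finset.sum_add_distrib, ← ha,
      ← hb]
    ring
  | mul_X P t hP =>
    obtain ⟨a, ha⟩ := hP
    refine ⟨fun s ↦ ⟨a s * ψ (rvar t), hWψ _ (a s).2 _⟩ +
      if s = t then ⟨φ (ofPoly A p σ P), AddSubgroup.subset_closure ⟨ofPoly A p σ P, 1, by simp⟩⟩
      else 0, ?_⟩
    have h1 : ∀ s, (((if s = t then
        ⟨φ (ofPoly A p σ P), AddSubgroup.subset_closure ⟨ofPoly A p σ P, 1, by simp⟩⟩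
        else 0 : W) : S)) = if s = t then φ (ofPoly A p σ P) else 0 := fun s ↦ by
      split_ifs <;> rfl
    simp only [AddSubgroup.coe_add, h1, add_mul, Finset.sum_add_distrib, ite_mul, zero_mul,
      Finset.sum_ite_eq', Finset.mem_univ, if_true, map_mul, ofPoly_X]
    have h2 : ∑ s, (a s : S) * ψ (rvar t) * (φ (rvar s) - ψ (rvar s)) =
        ψ (rvar t) * ∑ s, (a s : S) * (φ (rvar s) - ψ (rvar s)) := by
      rw [Finset.mul_sum]
      exact Finset.sum_congr rfl fun s _ ↦ by ring
    rw [h2, ← ha]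
    ring

/-- Expand `f = ∑ p^k P_k` and sum the coefficients found for the `P_k`. When `p` is invertible in
`S`, the whole ring is of no use for `p`-adic limits, so the sums are formed in a subgroup `U` and
the identity is checked in a separated subgroup `V`. -/
lemma sub_mem_span_of_restricted [Finite σ] (hA : ∀ x : A, p • x = 0 → x = 0)
    (φ ψ : restricted A p σ →+* S) (hC : ∀ a, φ (algebraMap A _ a) = ψ (algebraMap A _ a))
    (U V : AddSubgroup S) (hU : ∀ f g, φ f * ψ g ∈ U) (hsum : PSum p U) (hsep : PSep p V)
    (hUV : ∀ x ∈ U, ∀ s, x * (φ (rvar s) - ψ (rvar s)) ∈ V) (hV : ∀ f, φ f - ψ f ∈ V)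
    (f : restricted A p σ) :
    φ f - ψ f ∈ Ideal.span (Set.range fun s ↦ φ (rvar s) - ψ (rvar s)) := by
  cases nonempty_fintype σ
  have h := fun f : restricted A p σ ↦ exists_poly_approx hA 1 f
  simp only [pow_one] at h
  choose P b hPb using h
  choose a ha using exists_sub_eq_sum φ ψ hC U hU
  choose t ht using fun s ↦ hsum fun k ↦ a (P (b^[k] f)) s
  have h1 : ∀ f, φ f - ψ f = ∑ s, (a (P f) s : S) * (φ (rvar s) - ψ (rvar s)) +
      p • (φ (b f) - ψ (b f)) := fun f ↦ by
    conv_lhs => rw [hPb f]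
    rw [map_add, map_add, map_nsmul, map_nsmul, ← ha, smul_sub]
    abel
  have h2 : ∀ n, φ f - ψ f = ∑ s, (∑ k ∈ Finset.range n, p ^ k • (a (P (b^[k] f)) s : S)) *
      (φ (rvar s) - ψ (rvar s)) + p ^ n • (φ (b^[n] f) - ψ (b^[n] f)) := fun n ↦ by
    induction n with
    | zero => simp
    | succ n ih =>
      rw [ih, h1 (b^[n] f), Function.iterate_succ_apply']
      simp only [Finset.sum_range_succ, add_mul, Finset.sum_add_distrib, smul_add, smul_mul_assoc,
        Finset.smul_sum, pow_succ, mul_smul]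
      abel
  have h3 : (⟨_, hV f⟩ - ∑ s, ⟨_, hUV _ (t s).2 s⟩ : V) = 0 := hsep _ fun n ↦ by
    choose y hy using fun s ↦ ht s n
    refine ⟨⟨_, hV (b^[n] f)⟩ - ∑ s, ⟨_, hUV _ (y s).2 s⟩, Subtype.ext ?_⟩
    simp only [AddSubgroup.coe_sub, AddSubgroup.val_finsetSum, AddSubgroup.coe_nsmul, hy,
      AddSubgroup.coe_add]
    rw [h2 n]
    simp only [add_mul, Finset.sum_add_distrib, smul_sub, Finset.smul_sum, smul_mul_assoc]
    abel
  have h4 := congrArg Subtype.val h3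
  simp only [AddSubgroup.coe_sub, AddSubgroup.val_finsetSum, AddSubgroup.coe_zero,
    sub_eq_zero] at h4
  rw [h4]
  exact sum_mem fun s _ ↦ Ideal.mul_mem_left _ _ (Ideal.subset_span ⟨s, rfl⟩)

end Difference

/-! ### The properties of Tate algebras used in the construction of resolutions -/

/-- The properties of a family of Tate algebras from which resolutions are constructed: a class of
homomorphisms that are determined by the images of the variables, which can be prescribed in a set
of admissible elements, and the finite generation of sufficiently many ideals. -/
structure TateFamily.Calculus {R : Type u} [CommRing R] (T : TateFamily R) (p : ℕ) where
  strict : ∀ {σ τ : Type}, (T.alg σ →ₐ[R] T.alg τ) → Prop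
  adm : ∀ σ : Type, Set (T.alg σ)
  strict_id : ∀ σ, strict (AlgHom.id R (T.alg σ))
  strict_comp : ∀ {σ τ ρ : Type} {f : T.alg σ →ₐ[R] T.alg τ} {g : T.alg τ →ₐ[R] T.alg ρ},
    strict f → strict g → strict (g.comp f)
  map_adm : ∀ {σ τ : Type} {f : T.alg σ →ₐ[R] T.alg τ}, strict f → ∀ x ∈ adm σ, f x ∈ adm τ
  zero_adm : ∀ σ, 0 ∈ adm σ
  var_adm : ∀ {σ : Type} (s : σ), T.var s ∈ adm σ
  lift : ∀ {σ τ : Type} [Finite σ] [Finite τ] (c : σ → T.alg τ), (∀ s, c s ∈ adm τ) →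
    ∃ f : T.alg σ →ₐ[R] T.alg τ, strict f ∧ ∀ s, f (T.var s) = c s
  sub_mem : ∀ {σ τ : Type} [Finite σ] [Finite τ] {f g : T.alg σ →ₐ[R] T.alg τ}, strict f →
    strict g → ∀ x, f x - g x ∈ Ideal.span (Set.range fun s ↦ f (T.var s) - g (T.var s))
  torsionFree : ∀ {σ : Type} (x : T.alg σ), p • x = 0 → x = 0
  fg_of_saturated : ∀ {σ : Type} [Finite σ] (I : Ideal (T.alg σ)),
    (∀ x, p • x ∈ I → x ∈ I) → I.FG
  inf_fg : ∀ {σ : Type} [Finite σ] {I J : Ideal (T.alg σ)}, I.FG → J.FG → (I ⊓ J).FG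
  exists_adm : ∀ {σ : Type} [Finite σ] {I : Ideal (T.alg σ)}, I.FG →
    ∃ (k : ℕ) (g : Fin k → T.alg σ), (∀ i, g i ∈ adm σ) ∧ Ideal.span (Set.range g) = I

/-! ### The calculus over `A_inf,e` -/

section AinfE

variable {p : ℕ} [Fact p.Prime] {K : Type u} [NormedField K] [IsUltrametricDist K]
  [NormedAlgebra ℚ_[p] K] [CompleteSpace K]

/-- The rings `A_inf,e⟨σ⟩`, with all homomorphisms and all elements. -/
def ainfECalculus (hK : IsPerfectoid p K) (ζ : RootSystem p K) (e : ℕ) :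
    (ainfEFamily ζ e).Calculus p where
  strict _ := True
  adm _ := Set.univ
  strict_id _ := trivial
  strict_comp _ _ := trivial
  map_adm _ _ _ := trivial
  zero_adm _ := trivial
  var_adm _ := trivial
  lift {σ τ} _ _ c _ := by
    obtain ⟨f, hf⟩ := exists_eval (A := AinfE ζ e) (C := restricted (AinfE ζ e) p τ)
      (AinfE.p_torsionFree ζ e) (restricted_pSep (AinfE.pSep ζ e))
      (restricted_pSum (AinfE.p_torsionFree ζ e) (AinfE.pSum ζ e)) c
    exact ⟨f, trivial, hf⟩
  sub_mem {σ τ} _ _ f g _ _ x := by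
    have hsep : PSep p (restricted (AinfE ζ e) p τ) := restricted_pSep (AinfE.pSep ζ e)
    have hsum : PSum p (restricted (AinfE ζ e) p τ) :=
      restricted_pSum (AinfE.p_torsionFree ζ e) (AinfE.pSum ζ e)
    refine sub_mem_span_of_restricted (A := AinfE ζ e) (AinfE.p_torsionFree ζ e) f.toRingHom
      g.toRingHom (fun a ↦ (f.commutes a).trans (g.commutes a).symm) ⊤ ⊤ (fun _ _ ↦ trivial)
      (hsum.of_surjective
        ((AddMonoidHom.id _).codRestrict (⊤ : AddSubgroup _) fun _ ↦ trivial)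
        fun x ↦ ⟨x, rfl⟩)
      (hsep.of_injective (AddSubgroup.subtype ⊤) Subtype.val_injective)
      (fun _ _ _ ↦ trivial) (fun _ ↦ trivial) x
  torsionFree x hx := restricted_torsionFree (AinfE.p_torsionFree ζ e) x hx
  fg_of_saturated I hI := (AinfE.satFG hK ζ e).ideal_fg I hI
  inf_fg hI hJ := (AinfE.satFG hK ζ e).inf_fg
    (restricted_torsionFree (AinfE.p_torsionFree ζ e)) hI hJ
  exists_adm {σ} _ I hI := by
    obtain ⟨k, g, hg⟩ := Submodule.fg_iff_exists_fin_generating_family.1 hI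
    exact ⟨k, g, fun _ ↦ trivial, hg⟩

end AinfE

end TateRes
end

noncomputable section

set_option linter.unusedSectionVars false

namespace TateRes

/-! ### Lattices -/

/-- `A` is a lattice in `S = A[1/p]`. -/
structure IsLattice (p : ℕ) {A S : Type*} [CommRing A] [CommRing S] (ι : A →+* S) : Prop where
  injective : Function.Injective ι
  isUnit : IsUnit (p : S)
  exists_pow_smul : ∀ x, ∃ n g, p ^ n • x = ι g

lemma smul_pow_cancel {p : ℕ} {S : Type*} [CommRing S] (hp : IsUnit (p : S)) {n : ℕ} {x y : S}
    (h : p ^ n • x = p ^ n • y) : x = y := by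
  rw [nsmul_eq_mul, nsmul_eq_mul, Nat.cast_pow] at h
  exact (hp.pow n).mul_left_cancel h

lemma mem_of_smul_pow_mem {p : ℕ} {S : Type*} [CommRing S] (hp : IsUnit (p : S)) {I : Ideal S}
    {n : ℕ} {x : S} (h : p ^ n • x ∈ I) : x ∈ I := by
  rw [nsmul_eq_mul, Nat.cast_pow] at h
  exact (Ideal.unit_mul_mem_iff_mem I (hp.pow n)).1 h

/-- Generators can be scaled into a given set that meets every line. -/
lemma exists_generators_mem {p : ℕ} {S : Type*} [CommRing S] (hp : IsUnit (p : S)) {W : Set S}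
    (hW : ∀ x, ∃ n : ℕ, p ^ n • x ∈ W) {I : Ideal S} (hI : I.FG) :
    ∃ (k : ℕ) (g : Fin k → S), (∀ i, g i ∈ W) ∧ Ideal.span (Set.range g) = I := by
  obtain ⟨k, g, hg⟩ := Submodule.fg_iff_exists_fin_generating_family.1 hI
  choose n hn using hW
  refine ⟨k, fun i ↦ p ^ n (g i) • g i, fun i ↦ hn _, le_antisymm ?_ ?_⟩
  · rw [Ideal.span_le]
    rintro _ ⟨i, rfl⟩
    exact I.smul_of_tower_mem _ (hg ▸ Submodule.subset_span ⟨i, rfl⟩)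
  · rw [← hg]
    refine Submodule.span_le.2 ?_
    rintro _ ⟨i, rfl⟩
    exact mem_of_smul_pow_mem hp (Ideal.subset_span ⟨i, rfl⟩)

/-- The elements `x` such that `p ^ k * x` lies in the lattice. -/
def fractions (p : ℕ) {A S : Type*} [CommRing A] [CommRing S] (ι : A →+* S) (k : ℕ) :
    AddSubgroup S where
  carrier := {x | ∃ g, p ^ k • x = ι g}
  add_mem' := by
    rintro x y ⟨g, hg⟩ ⟨h, hh⟩
    exact ⟨g + h, by rw [smul_add, hg, hh, map_add]⟩
  zero_mem' := ⟨0, by simp⟩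
  neg_mem' := by
    rintro x ⟨g, hg⟩
    exact ⟨-g, by rw [smul_neg, hg, map_neg]⟩

/-- The elements that lie in the lattice up to a nilpotent element. -/
def almostIntegral {A S : Type*} [CommRing A] [CommRing S] (ι : A →+* S) : Subring S :=
  (ι.range.map (Ideal.Quotient.mk (nilradical S))).comap (Ideal.Quotient.mk (nilradical S))

section Lattice

variable {p : ℕ} {A S : Type*} [CommRing A] [CommRing S] {ι : A →+* S}

lemma fractions_mono {k l : ℕ} (hkl : k ≤ l) {x : S} (hx : x ∈ fractions p ι k) :
    x ∈ fractions p ι l := by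
  obtain ⟨g, hg⟩ := hx
  obtain ⟨m, rfl⟩ := Nat.exists_eq_add_of_le' hkl
  exact ⟨p ^ m • g, by rw [pow_add, mul_smul, hg, map_nsmul]⟩

lemma mul_mem_fractions {k l : ℕ} {x y : S} (hx : x ∈ fractions p ι k)
    (hy : y ∈ fractions p ι l) : x * y ∈ fractions p ι (k + l) := by
  obtain ⟨g, hg⟩ := hx
  obtain ⟨h, hh⟩ := hy
  exact ⟨g * h, by rw [map_mul, ← hg, ← hh, smul_mul_smul_comm, pow_add]⟩

lemma mem_almostIntegral {x : S} :
    x ∈ almostIntegral ι ↔ ∃ g, IsNilpotent (x - ι g) := by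
  simp only [almostIntegral, Subring.mem_comap, Subring.mem_map, RingHom.mem_range,
    exists_exists_eq_and]
  refine exists_congr fun g ↦ ?_
  rw [eq_comm, Ideal.Quotient.eq, mem_nilradical]

lemma IsLattice.pSep_fractions (h : IsLattice p ι) (hA : PSep p A) (k : ℕ) :
    PSep p (fractions p ι k) := fun x hx ↦ by
  obtain ⟨g, hg⟩ := x.2
  have h1 : g = 0 := hA _ fun n ↦ by
    obtain ⟨y, hy⟩ := hx n
    obtain ⟨f, hf⟩ := y.2
    refine ⟨f, h.injective ?_⟩
    rw [← hg, map_nsmul, ← hf, hy, smul_comm]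
    rfl
  refine Subtype.ext (smul_pow_cancel h.isUnit (n := k) ?_)
  rw [hg, h1, map_zero, AddSubgroup.coe_zero, smul_zero]

lemma IsLattice.pSum_fractions (h : IsLattice p ι) (hA : PSum p A) (k : ℕ) :
    PSum p (fractions p ι k) := by
  obtain ⟨u, hu⟩ := h.isUnit
  have hu' : ∀ x : S, p ^ k • ((↑(u⁻¹ ^ k) : S) * x) = x := fun x ↦ by
    rw [nsmul_eq_mul, Nat.cast_pow, ← hu, ← mul_assoc, ← Units.val_pow_eq_pow_val, ← Units.val_mul,
      inv_pow, mul_inv_cancel, Units.val_one, one_mul]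
  refine hA.of_surjective (((AddMonoidHom.mulLeft (↑(u⁻¹ ^ k) : S)).comp
    ι.toAddMonoidHom).codRestrict (fractions p ι k) fun g ↦ ⟨g, hu' _⟩) ?_
  rintro ⟨x, g, hg⟩
  exact ⟨g, Subtype.ext (smul_pow_cancel h.isUnit ((hu' _).trans hg.symm))⟩

/-- A ring homomorphism from a lattice extends if `p` is invertible in its target. -/
lemma IsLattice.exists_extension (h : IsLattice p ι) {S' : Type*} [CommRing S'] (φ : A →+* S')
    (hp : IsUnit (p : S')) : ∃ ψ : S →+* S', ∀ g, ψ (ι g) = φ g := by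
  let _ := ι.toAlgebra
  have : IsLocalization.Away (p : A) S := by
    refine IsLocalization.Away.mk _ ?_ (fun x ↦ ?_) fun a b hab ↦ ⟨0, ?_⟩
    · rw [map_natCast]
      exact h.isUnit
    · obtain ⟨n, g, hg⟩ := h.exists_pow_smul x
      refine ⟨n, g, ?_⟩
      rw [map_natCast, mul_comm, ← Nat.cast_pow, ← nsmul_eq_mul]
      exact hg
    · rw [h.injective hab]
  exact ⟨IsLocalization.Away.lift (p : A) (g := φ) (by rwa [map_natCast]),
    fun g ↦ IsLocalization.Away.lift_eq (p : A) _ g⟩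

/-- The contraction of an ideal to the lattice is saturated, because `p` is a unit in `S`, and it
generates the ideal again. -/
lemma IsLattice.isNoetherianRing (h : IsLattice p ι)
    (hA : ∀ I : Ideal A, (∀ x, p • x ∈ I → x ∈ I) → I.FG) : IsNoetherianRing S := by
  refine (isNoetherianRing_iff_ideal_fg S).2 fun I ↦ ?_
  have h1 := (hA (I.comap ι) fun x hx ↦ by
    rw [Ideal.mem_comap, map_nsmul] at hx
    exact mem_of_smul_pow_mem h.isUnit (n := 1) (by rwa [pow_one])).map ι
  convert h1
  refine le_antisymm (fun x hx ↦ ?_) Ideal.map_comap_le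
  obtain ⟨n, g, hg⟩ := h.exists_pow_smul x
  refine mem_of_smul_pow_mem h.isUnit (n := n) ?_
  rw [hg]
  refine Ideal.mem_map_of_mem _ ?_
  rw [Ideal.mem_comap, ← hg]
  exact I.smul_of_tower_mem _ hx

/-- Nilpotent elements can be adjoined to a complete lattice. -/
lemma IsLattice.exists_subring (h : IsLattice p ι) (hsep : PSep p A) (hsum : PSum p A)
    {σ : Type*} [Finite σ] (ν : σ → S) (hν : ∀ s, IsNilpotent (ν s)) :
    ∃ (C : Subring S) (N : ℕ), (∀ g, ι g ∈ C) ∧ (∀ s, ν s ∈ C) ∧ C ≤ almostIntegral ι ∧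
      (∀ x ∈ C, x ∈ fractions p ι N) ∧ PSep p C ∧ PSum p C := by
  let _ := ι.toAlgebra
  let D : Subalgebra A S := Algebra.adjoin A (Set.range ν)
  -- Nilpotent elements are integral, so `D` is a finite `A`-module. Hence one power of `p` clears
  -- all its denominators, and as a quotient of some `A^k` it inherits convergence of series.
  have hfg : D.toSubmodule.FG := fg_adjoin_of_finite (Set.finite_range _) (by
    rintro _ ⟨s, rfl⟩
    obtain ⟨n, hn⟩ := hν s
    exact IsIntegral.of_pow (n := n + 1) n.succ_pos (by
      rw [pow_succ, hn, zero_mul]; exact isIntegral_zero))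
  obtain ⟨k, b, hb⟩ := Submodule.fg_iff_exists_fin_generating_family.1 hfg
  have hbD : ∀ i, b i ∈ D := fun i ↦ by
    rw [← Subalgebra.mem_toSubmodule, ← hb]
    exact Submodule.subset_span ⟨i, rfl⟩
  have hcomb : ∀ x ∈ D, ∃ c : Fin k → A, ∑ i, ι (c i) * b i = x := fun x hx ↦ by
    rw [← Subalgebra.mem_toSubmodule, ← hb, ← Fintype.range_linearCombination] at hx
    exact hx
  choose m f hf using fun i ↦ h.exists_pow_smul (b i)
  obtain ⟨N, hN⟩ : ∃ N, ∀ i, m i ≤ N :=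
    ⟨Finset.univ.sup m, fun i ↦ Finset.le_sup (Finset.mem_univ i)⟩
  have hfrac : ∀ x ∈ D, x ∈ fractions p ι N := fun x hx ↦ by
    obtain ⟨c, rfl⟩ := hcomb x hx
    refine sum_mem fun i _ ↦ ?_
    rw [← zero_add N]
    exact mul_mem_fractions ⟨c i, by rw [pow_zero, one_smul]⟩ (fractions_mono (hN i) ⟨_, hf i⟩)
  refine ⟨D.toSubring, N, fun g ↦ D.algebraMap_mem g,
    fun s ↦ Algebra.subset_adjoin ⟨s, rfl⟩, fun x hx ↦ ?_, hfrac, ?_, ?_⟩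
  · change x ∈ Algebra.adjoin A (Set.range ν) at hx
    induction hx using Algebra.adjoin_induction with
    | mem x hx =>
      obtain ⟨s, rfl⟩ := hx
      exact mem_almostIntegral.2 ⟨0, by rw [map_zero, sub_zero]; exact hν s⟩
    | algebraMap r => exact mem_almostIntegral.2 ⟨r, by
        rw [show ι r = algebraMap A S r from rfl, sub_self]; exact IsNilpotent.zero⟩
    | add x y hx hy h1 h2 => exact add_mem h1 h2
    | mul x y hx hy h1 h2 => exact mul_mem h1 h2
  · exact (h.pSep_fractions hsep N).of_injective
      (((AddSubgroup.subtype D.toSubring.toAddSubgroup).codRestrict (fractions p ι N)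
        fun x ↦ hfrac _ x.2)) fun x y hxy ↦
        Subtype.ext (congrArg (fun z : fractions p ι N ↦ (z : S)) hxy)
  · have h1 : ∀ c : Fin k → A, ∑ i, ι (c i) * b i ∈ D := fun c ↦
      sum_mem fun i _ ↦ D.mul_mem (D.algebraMap_mem (c i)) (hbD i)
    refine (PSum.pi (M := fun _ : Fin k ↦ A) fun _ ↦ hsum).of_surjective
      (N := D.toSubring) { toFun := fun c ↦ ⟨∑ i, ι (c i) * b i, h1 c⟩
                           map_zero' := Subtype.ext (by simp)
                           map_add' := fun c d ↦ Subtype.ext (by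
                            simp [add_mul, Finset.sum_add_distrib]) } ?_
    rintro ⟨x, hx⟩
    obtain ⟨c, hc⟩ := hcomb x hx
    exact ⟨c, Subtype.ext hc⟩

end Lattice

/-! ### Differences of homomorphisms after inverting `p` -/

section LatticeTate

variable {p : ℕ} {A S S' A' : Type*} [CommRing A] [CommRing A'] [CommRing S] [CommRing S']
  {σ : Type}

/-- For two homomorphisms of Tate algebras in which `p` is invertible, the ideal generated by
their difference is generated by the differences on the variables. -/
lemma IsLattice.sub_mem_span [Finite σ] {ι : restricted A p σ →+* S} {ι' : A' →+* S'}
    (h : IsLattice p ι) (h' : IsLattice p ι') (hA : ∀ x : A, p • x = 0 → x = 0)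
    (hsep : PSep p A') (hsum : PSum p A') (φ ψ : S →+* S')
    (hC : ∀ a : A, φ (ι (algebraMap _ _ a)) = ψ (ι (algebraMap _ _ a)))
    (hφ : ∃ N, ∀ f, φ (ι f) ∈ fractions p ι' N) (hψ : ∃ N, ∀ f, ψ (ι f) ∈ fractions p ι' N)
    (x : S) :
    φ x - ψ x ∈ Ideal.span (Set.range fun s ↦ φ (ι (rvar s)) - ψ (ι (rvar s))) := by
  obtain ⟨M, hM⟩ := hφ
  obtain ⟨N, hN⟩ := hψ
  obtain ⟨n, f, hf⟩ := h.exists_pow_smul x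
  have hD : ∀ f, φ (ι f) - ψ (ι f) ∈ fractions p ι' (M + N) := fun f ↦
    sub_mem (fractions_mono (Nat.le_add_right _ _) (hM f))
      (fractions_mono (Nat.le_add_left _ _) (hN f))
  refine mem_of_smul_pow_mem h'.isUnit (n := n) ?_
  rw [smul_sub, ← map_nsmul, ← map_nsmul, hf]
  -- The products `φ f * ψ g` have denominator at most `p ^ (M + N)`, which gives `U`; a further
  -- factor `φ f - ψ f` doubles the exponent, which gives `V`.
  exact sub_mem_span_of_restricted hA (φ.comp ι) (ψ.comp ι) hC (fractions p ι' (M + N))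
    (fractions p ι' ((M + N) + (M + N))) (fun f g ↦ mul_mem_fractions (hM f) (hN g))
    (h'.pSum_fractions hsum _) (h'.pSep_fractions hsep _)
    (fun x hx s ↦ mul_mem_fractions hx (hD _))
    (fun f ↦ fractions_mono (Nat.le_add_left _ _) (hD f)) f

end LatticeTate

end TateRes
end

noncomputable section

set_option linter.unusedSectionVars false

namespace TateRes

/-! ### The Tate algebras over `B_dR,e^+` -/

section BdRETate

variable {p : ℕ} [Fact p.Prime] {K : Type u} [NormedField K] [IsUltrametricDist K]
  [NormedAlgebra ℚ_[p] K] [CompleteSpace K] (ζ : RootSystem p K) (e : ℕ) (σ : Type)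

/-- The power series underlying an element of `B_dR,e^+⟨σ⟩`. -/
def bdRECoe : (bdREFamily ζ e).alg σ →ₐ[BdRE ζ e] MvPowerSeries σ (BdRE ζ e) :=
  (bdRETate ζ e σ).val

/-- The map `A_inf,e⟨σ⟩ → B_dR,e^+⟨σ⟩`. -/
def bdREInt : restricted (AinfE ζ e) p σ →+* (bdREFamily ζ e).alg σ :=
  ((MvPowerSeries.map (ainfEToBdRE ζ e)).comp
    (restricted (AinfE ζ e) p σ).val.toRingHom).codRestrict (bdRETate ζ e σ)
    fun f ↦ Algebra.subset_adjoin ⟨_, f.2, rfl⟩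

variable {ζ e σ}

lemma bdRECoe_injective : Function.Injective (bdRECoe ζ e σ) := Subtype.val_injective

lemma coeff_bdREInt (f : restricted (AinfE ζ e) p σ) (m : σ →₀ ℕ) :
    MvPowerSeries.coeff m (bdRECoe ζ e σ (bdREInt ζ e σ f)) = ainfEToBdRE ζ e (rcoeff m f) :=
  MvPowerSeries.coeff_map (ainfEToBdRE ζ e) m (f : MvPowerSeries σ (AinfE ζ e))

lemma bdREInt_algebraMap (a : AinfE ζ e) :
    bdREInt ζ e σ (algebraMap _ _ a) = algebraMap _ _ (ainfEToBdRE ζ e a) :=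
  bdRECoe_injective (by
    rw [AlgHom.commutes]
    change MvPowerSeries.map (ainfEToBdRE ζ e) (algebraMap (AinfE ζ e)
      (MvPowerSeries σ (AinfE ζ e)) a) = _
    rw [MvPowerSeries.algebraMap_apply, MvPowerSeries.map_C, MvPowerSeries.algebraMap_apply]
    rfl)

lemma bdREInt_rvar (s : σ) : bdREInt ζ e σ (rvar s) = (bdREFamily ζ e).var s :=
  bdRECoe_injective (MvPowerSeries.map_X (ainfEToBdRE ζ e) s)

lemma bdREFamily_isUnit_p : IsUnit (p : (bdREFamily ζ e).alg σ) := by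
  have := (BdRE.isUnit_p ζ e).map (algebraMap (BdRE ζ e) ((bdREFamily ζ e).alg σ))
  rwa [map_natCast] at this

lemma isLattice_bdREInt : IsLattice p (bdREInt ζ e σ) where
  injective f g h := restricted_ext fun m ↦ ainfEToBdRE_injective ζ e (by
    rw [← coeff_bdREInt, ← coeff_bdREInt, h])
  isUnit := bdREFamily_isUnit_p
  exists_pow_smul := by
    have H : ∀ F ∈ bdRETate ζ e σ, ∃ (n : ℕ) (g : restricted (AinfE ζ e) p σ),
        p ^ n • F = bdRECoe ζ e σ (bdREInt ζ e σ g) := fun F hF ↦ by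
      induction hF using Algebra.adjoin_induction with
      | mem F hF =>
        obtain ⟨g, hg, rfl⟩ := hF
        exact ⟨0, ⟨g, hg⟩, by rw [pow_zero, one_smul]; rfl⟩
      | algebraMap r =>
        obtain ⟨n, a, ha⟩ := BdRE.exists_p_pow_smul ζ e r
        refine ⟨n, algebraMap _ _ a, ?_⟩
        rw [bdREInt_algebraMap, AlgHom.commutes, ← ha, map_nsmul]
      | add F G _ _ hF hG =>
        obtain ⟨n, f, hf⟩ := hF
        obtain ⟨m, g, hg⟩ := hG
        refine ⟨n + m, p ^ m • f + p ^ n • g, ?_⟩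
        rw [map_add, map_add, map_nsmul, map_nsmul, map_nsmul, map_nsmul, ← hf, ← hg, smul_add,
          ← mul_smul, ← mul_smul, ← pow_add, ← pow_add, add_comm n m]
      | mul F G _ _ hF hG =>
        obtain ⟨n, f, hf⟩ := hF
        obtain ⟨m, g, hg⟩ := hG
        refine ⟨n + m, f * g, ?_⟩
        rw [map_mul, map_mul, ← hf, ← hg, smul_mul_smul_comm, pow_add]
    intro x
    obtain ⟨n, g, hg⟩ := H _ x.2
    exact ⟨n, g, bdRECoe_injective ((map_nsmul _ _ _).trans hg)⟩

lemma pSep_restricted_ainfE : PSep p (restricted (AinfE ζ e) p σ) :=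
  restricted_pSep (AinfE.pSep ζ e)

lemma pSum_restricted_ainfE : PSum p (restricted (AinfE ζ e) p σ) :=
  restricted_pSum (AinfE.p_torsionFree ζ e) (AinfE.pSum ζ e)

variable {τ ρ : Type}

/-- Bounded homomorphisms that preserve the almost integral elements. -/
def BdREStrict (φ : (bdREFamily ζ e).alg σ →ₐ[BdRE ζ e] (bdREFamily ζ e).alg τ) : Prop :=
  (∃ N, ∀ f, φ (bdREInt ζ e σ f) ∈ fractions p (bdREInt ζ e τ) N) ∧
    ∀ x ∈ almostIntegral (bdREInt ζ e σ), φ x ∈ almostIntegral (bdREInt ζ e τ)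

lemma BdREStrict.comp {φ : (bdREFamily ζ e).alg σ →ₐ[BdRE ζ e] (bdREFamily ζ e).alg τ}
    {ψ : (bdREFamily ζ e).alg τ →ₐ[BdRE ζ e] (bdREFamily ζ e).alg ρ} (hφ : BdREStrict φ)
    (hψ : BdREStrict ψ) : BdREStrict (ψ.comp φ) := by
  refine ⟨?_, fun x hx ↦ hψ.2 _ (hφ.2 _ hx)⟩
  obtain ⟨M, hM⟩ := hφ.1
  obtain ⟨N, hN⟩ := hψ.1
  refine ⟨M + N, fun f ↦ ?_⟩
  obtain ⟨g, hg⟩ := hM f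
  obtain ⟨h, hh⟩ := hN g
  exact ⟨h, by rw [AlgHom.comp_apply, ← hh, ← hg, map_nsmul, ← mul_smul, pow_add, mul_comm]⟩

/-- Write each `c s` as an integral element plus a nilpotent one and adjoin the nilpotents to the
lattice. The resulting subring is complete and bounded, so evaluation takes place there and extends
by inverting `p`. Almost integral elements are preserved because nilpotents go to nilpotents and the
subring is almost integral. -/
lemma BdRE.exists_lift [Finite σ] (c : σ → (bdREFamily ζ e).alg τ)
    (hc : ∀ s, c s ∈ almostIntegral (bdREInt ζ e τ)) :
    ∃ φ : (bdREFamily ζ e).alg σ →ₐ[BdRE ζ e] (bdREFamily ζ e).alg τ,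
      BdREStrict φ ∧ ∀ s, φ ((bdREFamily ζ e).var s) = c s := by
  choose a ha using fun s ↦ mem_almostIntegral.1 (hc s)
  obtain ⟨C, N, hιC, hνC, hCadm, hCN, hCsep, hCsum⟩ :=
    (isLattice_bdREInt (ζ := ζ) (e := e) (σ := τ)).exists_subring
    pSep_restricted_ainfE pSum_restricted_ainfE _ ha
  let ιC : restricted (AinfE ζ e) p τ →+* C := (bdREInt ζ e τ).codRestrict C hιC
  let _ : Algebra (AinfE ζ e) C :=
    (ιC.comp (algebraMap (AinfE ζ e) (restricted (AinfE ζ e) p τ))).toAlgebra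
  obtain ⟨φ₀, hφ₀⟩ := exists_eval (A := AinfE ζ e) (σ := σ) (AinfE.p_torsionFree ζ e) hCsep hCsum
    fun s ↦ ⟨c s, by
      have := add_mem (hνC s) (hιC (a s))
      rwa [sub_add_cancel] at this⟩
  obtain ⟨φ, hφ⟩ := (isLattice_bdREInt (ζ := ζ) (e := e) (σ := σ)).exists_extension
    (C.subtype.comp φ₀.toRingHom) (bdREFamily_isUnit_p (ζ := ζ) (e := e) (σ := τ))
  have hφ' : ∀ f, φ (bdREInt ζ e σ f) ∈ C := fun f ↦ by
    rw [hφ]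
    exact (φ₀ f).2
  have hcomm : ∀ r : BdRE ζ e, φ (algebraMap _ _ r) = algebraMap _ _ r := fun r ↦ by
    obtain ⟨n, b, hb⟩ := BdRE.exists_p_pow_smul ζ e r
    refine smul_pow_cancel (bdREFamily_isUnit_p (ζ := ζ) (e := e) (σ := τ)) (n := n) ?_
    rw [← map_nsmul φ, ← map_nsmul, hb, ← bdREInt_algebraMap, hφ, ← map_nsmul, hb,
      ← bdREInt_algebraMap]
    exact congrArg Subtype.val (φ₀.commutes b)
  refine ⟨{ φ with commutes' := hcomm }, ⟨⟨N, fun f ↦ hCN _ (hφ' f)⟩, fun x hx ↦ ?_⟩, fun s ↦ ?_⟩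
  · obtain ⟨g, hg⟩ := mem_almostIntegral.1 hx
    obtain ⟨h, hh⟩ := mem_almostIntegral.1 (hCadm (hφ' g))
    refine mem_almostIntegral.2 ⟨h, ?_⟩
    have h1 : IsNilpotent (φ (x - bdREInt ζ e σ g)) := hg.map φ
    have h2 := (Commute.all _ _).isNilpotent_add h1 hh
    rwa [map_sub, sub_add_sub_cancel] at h2
  · change φ _ = _
    rw [← bdREInt_rvar, hφ]
    exact congrArg Subtype.val (hφ₀ s)

lemma isNoetherianRing_bdREFamily (hK : IsPerfectoid p K) [Finite σ] :
    IsNoetherianRing ((bdREFamily ζ e).alg σ) :=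
  isLattice_bdREInt.isNoetherianRing (AinfE.satFG hK ζ e).ideal_fg

lemma bdREFamily_var_mem (s : σ) :
    (bdREFamily ζ e).var s ∈ almostIntegral (bdREInt ζ e σ) :=
  mem_almostIntegral.2 ⟨rvar s, by rw [bdREInt_rvar, sub_self]; exact IsNilpotent.zero⟩

lemma BdREStrict.id : BdREStrict (AlgHom.id (BdRE ζ e) ((bdREFamily ζ e).alg σ)) :=
  ⟨⟨0, fun f ↦ ⟨f, by rw [pow_zero, one_smul]; rfl⟩⟩, fun _ hx ↦ hx⟩

lemma BdREStrict.sub_mem [Finite σ]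
    {φ ψ : (bdREFamily ζ e).alg σ →ₐ[BdRE ζ e] (bdREFamily ζ e).alg τ} (hφ : BdREStrict φ)
    (hψ : BdREStrict ψ) (x : (bdREFamily ζ e).alg σ) :
    φ x - ψ x ∈ Ideal.span (Set.range fun s ↦
      φ ((bdREFamily ζ e).var s) - ψ ((bdREFamily ζ e).var s)) := by
  have := isLattice_bdREInt.sub_mem_span (isLattice_bdREInt (ζ := ζ) (e := e) (σ := τ))
    (AinfE.p_torsionFree ζ e) pSep_restricted_ainfE pSum_restricted_ainfE φ.toRingHom ψ.toRingHom
    (fun a ↦ by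
      rw [bdREInt_algebraMap]
      exact (φ.commutes _).trans (ψ.commutes _).symm) hφ.1 hψ.1 x
  simp only [bdREInt_rvar] at this
  exact this

/-- The rings `B_dR,e^+⟨σ⟩`. -/
def bdRECalculus (hK : IsPerfectoid p K) (ζ : RootSystem p K) (e : ℕ) :
    (bdREFamily ζ e).Calculus p where
  strict φ := BdREStrict φ
  adm σ := almostIntegral (bdREInt ζ e σ)
  strict_id _ := BdREStrict.id
  strict_comp := BdREStrict.comp
  map_adm hφ := hφ.2
  zero_adm _ := zero_mem _
  var_adm := bdREFamily_var_mem
  lift c hc := BdRE.exists_lift c hc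
  sub_mem := BdREStrict.sub_mem
  torsionFree x hx := smul_pow_cancel bdREFamily_isUnit_p (n := 1)
    (by rw [pow_one, hx, smul_zero])
  fg_of_saturated I _ := (isNoetherianRing_iff_ideal_fg _).1 (isNoetherianRing_bdREFamily hK) I
  inf_fg _ _ := (isNoetherianRing_iff_ideal_fg _).1 (isNoetherianRing_bdREFamily hK) _
  exists_adm := exists_generators_mem bdREFamily_isUnit_p fun x ↦ by
    obtain ⟨n, g, hg⟩ := isLattice_bdREInt.exists_pow_smul x
    exact ⟨n, mem_almostIntegral.2 ⟨g, by rw [hg, sub_self]; exact IsNilpotent.zero⟩⟩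

end BdRETate

end TateRes
end

noncomputable section

set_option linter.unusedSectionVars false

namespace TateRes

/-! ### Rings complete with respect to a principal ideal -/

section Adic

variable {S S₁ : Type*} [CommRing S] [CommRing S₁]

lemma PSum.pi_linear {a : S} {ι : Type*} (h : PSum a S) : PSum a (ι → S) := fun g ↦ by
  choose s y hs using fun i ↦ h fun k ↦ g k i
  refine ⟨s, fun n ↦ ⟨fun i ↦ y i n, funext fun i ↦ ?_⟩⟩
  rw [hs i n]
  simp [Finset.sum_apply]

/-- A ring that is complete and separated for `(ξ)` is Noetherian if its quotient by `ξ` is. -/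
lemma isNoetherianRing_of_adic [IsNoetherianRing S₁] (π : S →+* S₁) (hπ : Function.Surjective π)
    {ξ : S} (hker : ∀ x, π x = 0 ↔ ∃ y, x = ξ * y) (hsum : PSum ξ S) (hsep : PSep ξ S) :
    IsNoetherianRing S := IsNoetherianRing.of_prime fun P hP ↦ by
  obtain ⟨k, g, hg⟩ := Submodule.fg_iff_exists_fin_generating_family.1
    ((isNoetherianRing_iff_ideal_fg S₁).1 inferInstance (P.map π))
  have hgP : ∀ i, ∃ x ∈ P, π x = g i := fun i ↦
    (Ideal.mem_map_iff_of_surjective π hπ).1 (hg ▸ Submodule.subset_span ⟨i, rfl⟩)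
  choose b hbP hb using hgP
  have happrox : ∀ x ∈ P, ∃ (c : Fin k → S) (y : S), x = ∑ i, c i * b i + ξ * y := fun x hx ↦ by
    have h1 : π x ∈ P.map π := Ideal.mem_map_of_mem _ hx
    rw [← hg, ← Fintype.range_linearCombination] at h1
    obtain ⟨d, hd⟩ := h1
    choose c hc using fun i ↦ hπ (d i)
    obtain ⟨y, hy⟩ := (hker (x - ∑ i, c i * b i)).1 (by
      rw [map_sub, map_sum, sub_eq_zero, ← hd]
      simp [Fintype.linearCombination_apply, hc, hb])
    exact ⟨c, y, by rw [← hy]; ring⟩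
  have hsumP : ∀ c : Fin k → S, ∑ i, c i * b i ∈ P := fun c ↦
    sum_mem fun i _ ↦ P.mul_mem_left _ (hbP i)
  -- By Cohen's theorem only prime ideals matter. If `ξ ∈ P`, then `ξ` and the lifts `b i` generate.
  -- If not, primality puts the error `y` in `P` again, so approximation shows that the `b i` alone
  -- generate.
  by_cases hξ : ξ ∈ P
  · refine Submodule.fg_def.2 ⟨insert ξ (Set.range b), (Set.finite_range b).insert ξ,
      le_antisymm ?_ fun x hx ↦ ?_⟩
    · rw [Submodule.span_le]
      rintro _ (rfl | ⟨i, rfl⟩)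
      exacts [hξ, hbP i]
    · obtain ⟨c, y, rfl⟩ := happrox x hx
      refine add_mem (sum_mem fun i _ ↦ ?_) ?_
      · exact Submodule.smul_mem _ _ (Submodule.subset_span (Or.inr ⟨i, rfl⟩))
      · rw [mul_comm]
        exact Submodule.smul_mem _ _ (Submodule.subset_span (Or.inl rfl))
  · let φ : (Fin k → S) →ₗ[S] P := (Fintype.linearCombination S b).codRestrict P fun c ↦ hsumP c
    have hφ : Function.Surjective φ := by
      refine surjective_of_approx_linear (a := ξ) φ hsum.pi_linear (fun x hx ↦ ?_) ?_
      · exact Subtype.ext (hsep _ fun n ↦ by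
          obtain ⟨y, hy⟩ := hx n
          exact ⟨y, congrArg Subtype.val hy⟩)
      · rintro ⟨x, hx⟩
        obtain ⟨c, y, hy⟩ := happrox x hx
        have hyP : y ∈ P := by
          refine (hP.mem_or_mem ?_).resolve_left hξ
          rw [show ξ * y = x - ∑ i, c i * b i by rw [hy]; ring]
          exact sub_mem hx (hsumP c)
        exact ⟨c, ⟨y, hyP⟩, Subtype.ext hy⟩
    refine Submodule.fg_def.2 ⟨Set.range b, Set.finite_range b, ?_⟩
    rw [← Fintype.range_linearCombination]
    refine le_antisymm ?_ fun x hx ↦ ?_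
    · rintro _ ⟨c, rfl⟩
      exact hsumP c
    · obtain ⟨c, hc⟩ := hφ ⟨x, hx⟩
      exact ⟨c, congrArg Subtype.val hc⟩

/-- Ideals of a complete Noetherian ring are closed. -/
lemma mem_ideal_of_adic [IsNoetherianRing S] {ξ : S} (hsum : PSum ξ S) (hsep : PSep ξ S)
    {I : Ideal S} {x : S} (hx : ∀ n, ∃ i ∈ I, ∃ y, x = i + ξ ^ n * y) : x ∈ I := by
  have hjac : Ideal.span {ξ} ≤ Ideal.jacobson ⊥ := by
    rw [Ideal.span_singleton_le_iff_mem, Ideal.mem_jacobson_bot]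
    intro y
    obtain ⟨z, hz⟩ := surjective_of_approx_linear (a := ξ) (LinearMap.mulLeft S (ξ * y + 1)) hsum
      hsep (fun z ↦ ⟨z, -(y * z), by
        rw [LinearMap.mulLeft_apply, smul_eq_mul]; ring⟩) 1
    exact IsUnit.of_mul_eq_one _ hz
  -- Krull's intersection theorem for the finite module `S ⧸ I`; `ξ` lies in the Jacobson radical
  -- because each `ξ y + 1` is inverted by a geometric series.
  have h1 := Ideal.iInf_pow_smul_eq_bot_of_le_jacobson (M := S ⧸ I) (Ideal.span {ξ}) hjac
  rw [← Ideal.Quotient.eq_zero_iff_mem, ← Submodule.mem_bot S, ← h1, Submodule.mem_iInf]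
  intro n
  obtain ⟨i, hi, y, rfl⟩ := hx n
  rw [map_add, Ideal.Quotient.eq_zero_iff_mem.2 hi, zero_add]
  exact Submodule.smul_mem_smul (Ideal.pow_mem_pow (Ideal.mem_span_singleton_self ξ) n)
    (Submodule.mem_top (x := (Ideal.Quotient.mk I y)))

end Adic

/-! ### The Tate algebras over `B_dR^+` -/

section BdRTate

variable {p : ℕ} [Fact p.Prime] {K : Type u} [NormedField K] [IsUltrametricDist K]
  [NormedAlgebra ℚ_[p] K] [CompleteSpace K] (ζ : RootSystem p K) (e : ℕ) (σ : Type)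

/-- The transition map `A_inf,e+1 → A_inf,e`. -/
def ainfETransition : AinfE ζ (e + 1) →+* AinfE ζ e :=
  Ideal.Quotient.factor (by
    rw [Ideal.span_singleton_le_span_singleton]
    exact pow_dvd_pow _ (Nat.le_succ e))

lemma bdRETransition_ainfEToBdRE (a : AinfE ζ (e + 1)) :
    bdRETransition ζ e (ainfEToBdRE ζ (e + 1) a) = ainfEToBdRE ζ e (ainfETransition ζ e a) := by
  obtain ⟨a, rfl⟩ := Ideal.Quotient.mk_surjective a
  rfl

lemma map_bdRETransition_int (f : restricted (AinfE ζ (e + 1)) p σ) :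
    MvPowerSeries.map (bdRETransition ζ e) (bdRECoe ζ (e + 1) σ (bdREInt ζ (e + 1) σ f)) =
      bdRECoe ζ e σ (bdREInt ζ e σ (restrictedMap (ainfETransition ζ e) f)) :=
  MvPowerSeries.ext fun m ↦ by
    rw [MvPowerSeries.coeff_map, coeff_bdREInt, coeff_bdREInt, rcoeff_restrictedMap,
      bdRETransition_ainfEToBdRE]

lemma map_bdRETransition_mem (x : (bdREFamily ζ (e + 1)).alg σ) :
    MvPowerSeries.map (bdRETransition ζ e) (bdRECoe ζ (e + 1) σ x) ∈ bdRETate ζ e σ := by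
  obtain ⟨n, f, hf⟩ := isLattice_bdREInt.exists_pow_smul x
  obtain ⟨u, hu⟩ := (BdRE.isUnit_p ζ e).pow n
  have h1 : (u : BdRE ζ e) • MvPowerSeries.map (bdRETransition ζ e) (bdRECoe ζ (e + 1) σ x) ∈
      bdRETate ζ e σ := by
    rw [hu, ← Nat.cast_pow, Nat.cast_smul_eq_nsmul, ← map_nsmul, ← map_nsmul, hf,
      map_bdRETransition_int]
    exact (bdREInt ζ e σ (restrictedMap (ainfETransition ζ e) f)).2
  have h2 := (bdRETate ζ e σ).smul_mem h1 (↑u⁻¹ : BdRE ζ e)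
  rwa [← mul_smul, Units.inv_mul, one_smul] at h2

/-- The transition map `B_dR,e+1^+⟨σ⟩ → B_dR,e^+⟨σ⟩`. -/
def bdRETrans : (bdREFamily ζ (e + 1)).alg σ →+* (bdREFamily ζ e).alg σ :=
  ((MvPowerSeries.map (bdRETransition ζ e)).comp
    (bdRECoe ζ (e + 1) σ).toRingHom).codRestrict (bdRETate ζ e σ) (map_bdRETransition_mem ζ e σ)

/-- The projection `B_dR^+⟨σ⟩ → B_dR,e^+⟨σ⟩`. -/
def bdRProj : (bdRFamily ζ).alg σ →+* (bdREFamily ζ e).alg σ :=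
  ((Pi.evalRingHom (fun e : ℕ ↦ MvPowerSeries σ (BdRE ζ e)) e).comp
    (bdRTate ζ σ).val.toRingHom).codRestrict (bdRETate ζ e σ) fun F ↦ F.2.1 e

variable {ζ e σ}

lemma bdRETrans_int (f : restricted (AinfE ζ (e + 1)) p σ) :
    bdRETrans ζ e σ (bdREInt ζ (e + 1) σ f) =
      bdREInt ζ e σ (restrictedMap (ainfETransition ζ e) f) :=
  bdRECoe_injective (map_bdRETransition_int ζ e σ f)

lemma bdRETrans_algebraMap (r : BdRE ζ (e + 1)) :
    bdRETrans ζ e σ (algebraMap _ _ r) = algebraMap _ _ (bdRETransition ζ e r) :=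
  bdRECoe_injective (by
    rw [AlgHom.commutes]
    change MvPowerSeries.map (bdRETransition ζ e) (bdRECoe ζ (e + 1) σ (algebraMap _ _ r)) = _
    rw [AlgHom.commutes, MvPowerSeries.algebraMap_apply, MvPowerSeries.algebraMap_apply,
      Algebra.algebraMap_self, RingHom.id_apply, MvPowerSeries.map_C]
    rfl)

lemma bdRETrans_var (s : σ) :
    bdRETrans ζ e σ ((bdREFamily ζ (e + 1)).var s) = (bdREFamily ζ e).var s :=
  bdRECoe_injective (MvPowerSeries.map_X (bdRETransition ζ e) s)

lemma bdRProj_var (s : σ) : bdRProj ζ e σ ((bdRFamily ζ).var s) = (bdREFamily ζ e).var s := rfl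

lemma bdRProj_algebraMap (r : BdR p K) :
    bdRProj ζ e σ (algebraMap _ _ r) =
      algebraMap (BdRE ζ e) _ (Ideal.Quotient.mk (Ideal.span {ζ.xiBdR ^ e}) r) :=
  bdRECoe_injective (by
    rw [AlgHom.commutes]
    change algebraMap (BdR p K) (∀ e : ℕ, MvPowerSeries σ (BdRE ζ e)) r e = _
    rw [Pi.algebraMap_apply, MvPowerSeries.algebraMap_apply, MvPowerSeries.algebraMap_apply]
    rfl)

lemma bdRETrans_bdRProj (F : (bdRFamily ζ).alg σ) :
    bdRETrans ζ e σ (bdRProj ζ (e + 1) σ F) = bdRProj ζ e σ F :=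
  bdRECoe_injective (F.2.2 e)

lemma bdR_ext {F G : (bdRFamily ζ).alg σ} (h : ∀ e, bdRProj ζ e σ F = bdRProj ζ e σ G) : F = G :=
  Subtype.ext (funext fun e ↦ congrArg (bdRECoe ζ e σ) (h e))

/-- The element of `B_dR^+⟨σ⟩` given by a compatible family. -/
def bdRMk (x : ∀ e, (bdREFamily ζ e).alg σ) (hx : ∀ e, bdRETrans ζ e σ (x (e + 1)) = x e) :
    (bdRFamily ζ).alg σ :=
  ⟨fun e ↦ bdRECoe ζ e σ (x e), fun e ↦ (x e).2, fun e ↦ congrArg (bdRECoe ζ e σ) (hx e)⟩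

@[simp] lemma bdRProj_bdRMk (x : ∀ e, (bdREFamily ζ e).alg σ)
    (hx : ∀ e, bdRETrans ζ e σ (x (e + 1)) = x e) : bdRProj ζ e σ (bdRMk x hx) = x e := rfl

/-- The homomorphism into `B_dR^+⟨σ⟩` given by a compatible family of homomorphisms. -/
def bdRLift {S : Type*} [CommRing S] (φ : ∀ e, S →+* (bdREFamily ζ e).alg σ)
    (hφ : ∀ x e, bdRETrans ζ e σ (φ (e + 1) x) = φ e x) : S →+* (bdRFamily ζ).alg σ :=
  (RingHom.pi fun e ↦ (bdRECoe ζ e σ).toRingHom.comp (φ e)).codRestrict (bdRTate ζ σ)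
    fun x ↦ (bdRMk (fun e ↦ φ e x) (hφ x)).2

variable (ζ σ) in
/-- The map `A_inf⟨σ⟩ → B_dR^+⟨σ⟩`. -/
def bdRInt : restricted (Ainf p K) p σ →+* (bdRFamily ζ).alg σ :=
  bdRLift (fun e ↦ (bdREInt ζ e σ).comp
    (restrictedMap (Ideal.Quotient.mk (Ideal.span {ζ.xi ^ e})))) fun _ _ ↦
      (bdRETrans_int _).trans rfl

lemma bdRProj_bdRInt (f : restricted (Ainf p K) p σ) :
    bdRProj ζ e σ (bdRInt ζ σ f) = bdREInt ζ e σ (restrictedMap (Ideal.Quotient.mk (Ideal.span {ζ.xi ^ e})) f) := rfl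

lemma bdRFamily_isUnit_p : IsUnit (p : (bdRFamily ζ).alg σ) := by
  have := RootSystem.isUnit_p_BdR.map (algebraMap (BdR p K) ((bdRFamily ζ).alg σ))
  rwa [map_natCast] at this

lemma restrictedMap_mk_surjective : Function.Surjective
    (restrictedMap (Ideal.Quotient.mk _) :
      restricted (Ainf p K) p σ →+* restricted (AinfE ζ e) p σ) :=
  restrictedMap_surjective _ Ideal.Quotient.mk_surjective Ainf.p_torsionFree
    (AinfE.p_torsionFree ζ _) Ainf.pSum (AinfE.pSep ζ _)

lemma exists_bdRInt_eq (x : (bdREFamily ζ e).alg σ) :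
    ∃ n f, p ^ n • x = bdRProj ζ e σ (bdRInt ζ σ f) := by
  obtain ⟨n, g, hg⟩ := isLattice_bdREInt.exists_pow_smul x
  obtain ⟨f, rfl⟩ := restrictedMap_mk_surjective g
  exact ⟨n, f, hg⟩

lemma exists_p_pow_smul_eq (n : ℕ) (F : (bdRFamily ζ).alg σ) : ∃ G, p ^ n • G = F := by
  obtain ⟨u, hu⟩ := (bdRFamily_isUnit_p (ζ := ζ) (σ := σ)).pow n
  refine ⟨↑u⁻¹ * F, ?_⟩
  rw [nsmul_eq_mul, Nat.cast_pow, ← hu, Units.mul_inv_cancel_left]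

lemma bdRProj_surjective : Function.Surjective (bdRProj ζ e σ) := fun x ↦ by
  obtain ⟨n, f, hf⟩ := exists_bdRInt_eq x
  obtain ⟨G, hG⟩ := exists_p_pow_smul_eq n (bdRInt ζ σ f)
  exact ⟨G, smul_pow_cancel bdREFamily_isUnit_p (n := n) (by rw [hf, ← hG, map_nsmul])⟩

variable (ζ σ) in
/-- The element `ξ` of `B_dR^+⟨σ⟩`. -/
def tateXi : (bdRFamily ζ).alg σ := algebraMap (BdR p K) _ ζ.xiBdR

lemma bdRProj_tateXi_pow : bdRProj ζ e σ (tateXi ζ σ) ^ e = 0 := by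
  rw [tateXi, bdRProj_algebraMap, ← map_pow, ← map_pow,
    BdRE.mk_eq_zero.2 ⟨1, by rw [mul_one]⟩, map_zero]

lemma bdRProj_eq_zero_of_le {F : (bdRFamily ζ).alg σ} {d : ℕ} (hde : d ≤ e)
    (h : bdRProj ζ e σ F = 0) : bdRProj ζ d σ F = 0 := by
  induction e, hde using Nat.le_induction with
  | base => exact h
  | succ e _ ih => exact ih (by rw [← bdRETrans_bdRProj, h, map_zero])

lemma coe_bdRProj_tateXi_mul (x : (bdREFamily ζ e).alg σ) (m : σ →₀ ℕ) :
    MvPowerSeries.coeff m (bdRECoe ζ e σ (bdRProj ζ e σ (tateXi ζ σ) * x)) =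
      Ideal.Quotient.mk _ ζ.xiBdR * MvPowerSeries.coeff m (bdRECoe ζ e σ x) := by
  rw [tateXi, bdRProj_algebraMap, ← Algebra.smul_def, map_smul, map_smul, smul_eq_mul]

/-- Cancelling `ξ` costs one level of precision, so the conclusion is at level `e` and not at level
`e + 1`. -/
lemma bdRETrans_eq_zero {x : (bdREFamily ζ (e + 1)).alg σ}
    (h : bdRProj ζ (e + 1) σ (tateXi ζ σ) * x = 0) : bdRETrans ζ e σ x = 0 :=
  bdRECoe_injective (MvPowerSeries.ext fun m ↦ by
    have h1 := congrArg (fun y ↦ MvPowerSeries.coeff m (bdRECoe ζ (e + 1) σ y)) h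
    simp only [coe_bdRProj_tateXi_mul, map_zero] at h1
    change MvPowerSeries.coeff m (MvPowerSeries.map (bdRETransition ζ e)
      (bdRECoe ζ (e + 1) σ x)) = _
    rw [MvPowerSeries.coeff_map, map_zero, map_zero]
    obtain ⟨y, hy⟩ := Ideal.Quotient.mk_surjective
      (MvPowerSeries.coeff m (bdRECoe ζ (e + 1) σ x))
    rw [← hy, ← map_mul, BdRE.mk_eq_zero] at h1
    obtain ⟨z, hz⟩ := h1
    rw [← hy]
    exact BdRE.mk_eq_zero.2 (ζ.xiBdR_mul_eq hz))

/-- Level one sees the coefficients modulo `ξ`; the quotients by `ξ` tend to zero by regularity of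
`p, ξ`. -/
lemma restricted_eq_xi_mul {f : restricted (Ainf p K) p σ}
    (h : bdRProj ζ 1 σ (bdRInt ζ σ f) = 0) : ∃ g, f = algebraMap _ _ ζ.xi * g := by
  have h1 : ∀ m, ∃ b, rcoeff m f = ζ.xi * b := fun m ↦ by
    have h2 := coeff_bdREInt (restrictedMap (Ideal.Quotient.mk (Ideal.span {ζ.xi ^ 1})) f) m
    rw [← bdRProj_bdRInt, h, map_zero, map_zero, rcoeff_restrictedMap] at h2
    have h3 := ainfEToBdRE_injective ζ 1 (h2.symm.trans (map_zero _).symm)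
    rw [AinfE.mk_eq_zero, pow_one] at h3
    exact h3
  choose c hc using h1
  refine ⟨restrictedMk c fun n ↦ (finite_rcoeff f n).subset fun m hm hy ↦ ?_,
    restricted_ext fun m ↦ ?_⟩
  · obtain ⟨y, hy⟩ := hy
    rw [hc, ← pow_one ζ.xi] at hy
    obtain ⟨z, hz, -⟩ := ζ.xi_pow_mul_dvd_p_pow 1 n hy
    exact hm ⟨z, hz⟩
  · rw [← Algebra.smul_def, map_smul, hc, smul_eq_mul, rcoeff_restrictedMk]

lemma bdRInt_xi : bdRInt ζ σ (algebraMap _ _ ζ.xi) = tateXi ζ σ := bdR_ext fun e ↦ by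
  rw [bdRProj_bdRInt, restrictedMap_algebraMap, bdREInt_algebraMap, ainfEToBdRE_mk,
    tateXi, bdRProj_algebraMap]
  rfl

lemma exists_bdRProj_eq_xi_mul {F : (bdRFamily ζ).alg σ} (h : bdRProj ζ 1 σ F = 0) (e : ℕ) :
    ∃ H, bdRProj ζ (e + 1) σ F = bdRProj ζ (e + 1) σ (tateXi ζ σ * H) := by
  obtain ⟨n, f, hf⟩ := exists_bdRInt_eq (bdRProj ζ (e + 1) σ F)
  have h1 : bdRProj ζ 1 σ (p ^ n • F - bdRInt ζ σ f) = 0 :=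
    bdRProj_eq_zero_of_le (e := e + 1) (Nat.le_add_left 1 e) (by
      rw [map_sub, map_nsmul, hf, sub_self])
  rw [map_sub, map_nsmul, h, smul_zero, zero_sub, neg_eq_zero] at h1
  obtain ⟨g, rfl⟩ := restricted_eq_xi_mul h1
  obtain ⟨H, hH⟩ := exists_p_pow_smul_eq n (bdRInt ζ σ g)
  refine ⟨H, smul_pow_cancel bdREFamily_isUnit_p (n := n) ?_⟩
  rw [hf, map_mul, bdRInt_xi, ← hH, ← map_nsmul, mul_smul_comm]

/-- A quotient `H e` chosen at level `e + 1` is determined only at level `e`. Its projections to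
level `e` are therefore compatible and define an element of the limit. -/
lemma exists_eq_tateXi_mul {F : (bdRFamily ζ).alg σ} (h : bdRProj ζ 1 σ F = 0) :
    ∃ G, F = tateXi ζ σ * G := by
  choose H hH using exists_bdRProj_eq_xi_mul h
  have key : ∀ e, bdRProj ζ e σ (H (e + 1)) = bdRProj ζ e σ (H e) := fun e ↦ by
    rw [← sub_eq_zero, ← map_sub, ← bdRETrans_bdRProj]
    refine bdRETrans_eq_zero ?_
    rw [← map_mul, mul_sub, map_sub, ← hH, ← bdRETrans_bdRProj, ← hH, bdRETrans_bdRProj, sub_self]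
  refine ⟨bdRMk (fun e ↦ bdRProj ζ e σ (H e)) fun e ↦ ?_, bdR_ext fun e ↦ ?_⟩
  · rw [bdRETrans_bdRProj, key]
  · rw [map_mul, bdRProj_bdRMk, ← bdRETrans_bdRProj F, hH, bdRETrans_bdRProj, map_mul]

lemma bdRProj_eq_zero {F : (bdRFamily ζ).alg σ} :
    bdRProj ζ e σ F = 0 ↔ ∃ G, F = tateXi ζ σ ^ e * G := by
  constructor
  · induction e generalizing F with
    | zero => exact fun _ ↦ ⟨F, by rw [pow_zero, one_mul]⟩
    | succ e ih =>
      intro h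
      obtain ⟨G, rfl⟩ := exists_eq_tateXi_mul (bdRProj_eq_zero_of_le (Nat.le_add_left 1 e) h)
      obtain ⟨G', rfl⟩ := ih (F := G) (by
        rw [← bdRETrans_bdRProj]
        exact bdRETrans_eq_zero (by rwa [← map_mul]))
      exact ⟨G', by rw [pow_succ', mul_assoc]⟩
  · rintro ⟨G, rfl⟩
    rw [map_mul, map_pow, bdRProj_tateXi_pow, zero_mul]

lemma bdRFamily_pSep : PSep (tateXi ζ σ) ((bdRFamily ζ).alg σ) := fun F hF ↦ bdR_ext fun e ↦ by
  obtain ⟨y, hy⟩ := hF e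
  rw [map_zero]
  exact bdRProj_eq_zero.2 ⟨y, hy⟩

/-- At level `e` the series is a finite sum, since `ξ^e = 0` there. -/
lemma bdRFamily_pSum : PSum (tateXi ζ σ) ((bdRFamily ζ).alg σ) := fun g ↦ by
  let s (g : ℕ → (bdRFamily ζ).alg σ) : (bdRFamily ζ).alg σ :=
    bdRMk (fun e ↦ bdRProj ζ e σ (∑ k ∈ Finset.range e, tateXi ζ σ ^ k * g k)) fun e ↦ by
      rw [bdRETrans_bdRProj, Finset.sum_range_succ, map_add, map_mul _ (tateXi ζ σ ^ e), map_pow,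
        bdRProj_tateXi_pow, zero_mul, add_zero]
  refine ⟨s g, fun n ↦ ⟨s fun k ↦ g (n + k), bdR_ext fun e ↦ ?_⟩⟩
  have h1 : bdRProj ζ e σ (∑ k ∈ Finset.range (e + n), tateXi ζ σ ^ k * g k) =
      bdRProj ζ e σ (∑ k ∈ Finset.range e, tateXi ζ σ ^ k * g k) := by
    rw [← sub_eq_zero, ← map_sub, bdRProj_eq_zero, Finset.sum_range_add, add_sub_cancel_left]
    refine ⟨∑ k ∈ Finset.range n, tateXi ζ σ ^ k * g (e + k), ?_⟩
    rw [Finset.mul_sum]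
    exact Finset.sum_congr rfl fun k _ ↦ by ring
  simp only [s, smul_eq_mul]
  rw [bdRProj_bdRMk, map_add, map_mul _ (tateXi ζ σ ^ n), bdRProj_bdRMk, ← h1, add_comm e n,
    Finset.sum_range_add, map_add, ← map_mul, Finset.mul_sum]
  congr 2
  exact Finset.sum_congr rfl fun k _ ↦ by ring

lemma isNoetherianRing_bdRFamily (hK : IsPerfectoid p K) [Finite σ] :
    IsNoetherianRing ((bdRFamily ζ).alg σ) :=
  have := isNoetherianRing_bdREFamily (ζ := ζ) (e := 1) (σ := σ) hK
  isNoetherianRing_of_adic (bdRProj ζ 1 σ) bdRProj_surjective (ξ := tateXi ζ σ)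
    (fun F ↦ by rw [bdRProj_eq_zero, pow_one]) bdRFamily_pSum bdRFamily_pSep

variable {τ ρ : Type}

/-- Homomorphisms that are limits of strict homomorphisms. -/
def BdRStrict (φ : (bdRFamily ζ).alg σ →ₐ[BdR p K] (bdRFamily ζ).alg τ) : Prop :=
  ∀ e, ∃ φₑ : (bdREFamily ζ e).alg σ →ₐ[BdRE ζ e] (bdREFamily ζ e).alg τ,
    BdREStrict φₑ ∧ ∀ F, bdRProj ζ e τ (φ F) = φₑ (bdRProj ζ e σ F)

lemma BdRStrict.comp {φ : (bdRFamily ζ).alg σ →ₐ[BdR p K] (bdRFamily ζ).alg τ}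
    {ψ : (bdRFamily ζ).alg τ →ₐ[BdR p K] (bdRFamily ζ).alg ρ} (hφ : BdRStrict φ)
    (hψ : BdRStrict ψ) : BdRStrict (ψ.comp φ) := fun e ↦ by
  obtain ⟨φₑ, h1, h2⟩ := hφ e
  obtain ⟨ψₑ, h3, h4⟩ := hψ e
  exact ⟨ψₑ.comp φₑ, h1.comp h3, fun F ↦ by
    rw [AlgHom.comp_apply, h4, h2, AlgHom.comp_apply]⟩

/-- The statement at each level places the difference in the ideal up to a multiple of `ξ^e`, and
ideals of the complete Noetherian ring are closed. -/
lemma BdRStrict.sub_mem (hK : IsPerfectoid p K) [Finite σ] [Finite τ]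
    {φ ψ : (bdRFamily ζ).alg σ →ₐ[BdR p K] (bdRFamily ζ).alg τ} (hφ : BdRStrict φ)
    (hψ : BdRStrict ψ) (F : (bdRFamily ζ).alg σ) :
    φ F - ψ F ∈ Ideal.span (Set.range fun s ↦
      φ ((bdRFamily ζ).var s) - ψ ((bdRFamily ζ).var s)) := by
  have := isNoetherianRing_bdRFamily (ζ := ζ) (σ := τ) hK
  refine mem_ideal_of_adic bdRFamily_pSum bdRFamily_pSep fun e ↦ ?_
  obtain ⟨φₑ, h1, h2⟩ := hφ e
  obtain ⟨ψₑ, h3, h4⟩ := hψ e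
  have h5 := h1.sub_mem h3 (bdRProj ζ e σ F)
  simp only [← bdRProj_var, ← h2, ← h4, ← map_sub] at h5
  rw [show (Set.range fun s ↦ bdRProj ζ e τ (φ ((bdRFamily ζ).var s) - ψ ((bdRFamily ζ).var s))) =
    bdRProj ζ e τ '' Set.range fun s ↦ φ ((bdRFamily ζ).var s) - ψ ((bdRFamily ζ).var s) from
    Set.range_comp _ _, ← Ideal.map_span,
    Ideal.mem_map_iff_of_surjective _ bdRProj_surjective] at h5
  obtain ⟨i, hi, h6⟩ := h5
  rw [eq_comm, ← sub_eq_zero, ← map_sub, bdRProj_eq_zero] at h6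
  obtain ⟨G, hG⟩ := h6
  exact ⟨i, hi, G, by rw [← hG]; abel⟩

/-- Both composites are bounded and agree on the variables, so the ideal generated by their
differences is zero. -/
lemma BdREStrict.bdRETrans_comm [Finite σ]
    {φ : (bdREFamily ζ (e + 1)).alg σ →ₐ[BdRE ζ (e + 1)] (bdREFamily ζ (e + 1)).alg τ}
    {ψ : (bdREFamily ζ e).alg σ →ₐ[BdRE ζ e] (bdREFamily ζ e).alg τ} (hφ : BdREStrict φ)
    (hψ : BdREStrict ψ) (h : ∀ s, bdRETrans ζ e τ (φ ((bdREFamily ζ (e + 1)).var s)) =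
      ψ ((bdREFamily ζ e).var s)) (x : (bdREFamily ζ (e + 1)).alg σ) :
    bdRETrans ζ e τ (φ x) = ψ (bdRETrans ζ e σ x) := by
  obtain ⟨M, hM⟩ := hφ.1
  obtain ⟨N, hN⟩ := hψ.1
  have h1 := isLattice_bdREInt.sub_mem_span (isLattice_bdREInt (ζ := ζ) (e := e) (σ := τ))
    (AinfE.p_torsionFree ζ _) pSep_restricted_ainfE pSum_restricted_ainfE
    ((bdRETrans ζ e τ).comp φ.toRingHom) (ψ.toRingHom.comp (bdRETrans ζ e σ))
    (fun a ↦ by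
      change bdRETrans ζ e τ (φ _) = ψ (bdRETrans ζ e σ _)
      rw [bdREInt_algebraMap, φ.commutes, bdRETrans_algebraMap, bdRETrans_algebraMap, ψ.commutes])
    ⟨M, fun f ↦ by
      obtain ⟨g, hg⟩ := hM f
      refine ⟨restrictedMap (ainfETransition ζ e) g, ?_⟩
      rw [← bdRETrans_int, ← hg, map_nsmul]
      rfl⟩
    ⟨N, fun f ↦ by
      change ψ (bdRETrans ζ e σ _) ∈ _
      rw [bdRETrans_int]
      exact hN _⟩ x
  rw [← sub_eq_zero]
  have h2 : ∀ s : σ, ((bdRETrans ζ e τ).comp φ.toRingHom) (bdREInt ζ (e + 1) σ (rvar s)) -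
      (ψ.toRingHom.comp (bdRETrans ζ e σ)) (bdREInt ζ (e + 1) σ (rvar s)) = 0 := fun s ↦ by
    change bdRETrans ζ e τ (φ _) - ψ (bdRETrans ζ e σ _) = 0
    rw [bdREInt_rvar, h, bdRETrans_var, sub_self]
  simp only [h2] at h1
  have h3 : Ideal.span (Set.range fun _ : σ ↦ (0 : (bdREFamily ζ e).alg τ)) = ⊥ :=
    Ideal.span_eq_bot.2 (by rintro _ ⟨s, rfl⟩; rfl)
  rw [h3] at h1
  exact h1

variable (ζ σ) in
/-- The elements all of whose components are almost integral. -/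
def bdRAdm : Set ((bdRFamily ζ).alg σ) :=
  {F | ∀ e, bdRProj ζ e σ F ∈ almostIntegral (bdREInt ζ e σ)}

lemma BdR.exists_lift [Finite σ] (c : σ → (bdRFamily ζ).alg τ) (hc : ∀ s, c s ∈ bdRAdm ζ τ) :
    ∃ φ : (bdRFamily ζ).alg σ →ₐ[BdR p K] (bdRFamily ζ).alg τ,
      BdRStrict φ ∧ ∀ s, φ ((bdRFamily ζ).var s) = c s := by
  choose φ hφ hφc using fun e ↦ BdRE.exists_lift (ζ := ζ) (e := e)
    (fun s ↦ bdRProj ζ e τ (c s)) fun s ↦ hc s e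
  have hcomm : ∀ (F : (bdRFamily ζ).alg σ) (e : ℕ), bdRETrans ζ e τ
      (φ (e + 1) (bdRProj ζ (e + 1) σ F)) = φ e (bdRProj ζ e σ F) := fun F e ↦ by
    rw [(hφ (e + 1)).bdRETrans_comm (hφ e) (fun s ↦ by rw [hφc, hφc, bdRETrans_bdRProj]),
      bdRETrans_bdRProj]
  let ψ : (bdRFamily ζ).alg σ →ₐ[BdR p K] (bdRFamily ζ).alg τ :=
    { bdRLift (fun e ↦ (φ e).toRingHom.comp (bdRProj ζ e σ)) hcomm with
      commutes' := fun r ↦ bdR_ext fun e ↦ by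
        change φ e (bdRProj ζ e σ _) = _
        rw [bdRProj_algebraMap, AlgHom.commutes, bdRProj_algebraMap] }
  exact ⟨ψ, fun e ↦ ⟨φ e, hφ e, fun F ↦ rfl⟩, fun s ↦ bdR_ext fun e ↦ hφc e s⟩

/-- One power of `p` serves all levels, although the denominators at level `e` may grow with `e`: it
is enough to clear them modulo `ξ`, because the remaining error is a multiple of `ξ` and hence
nilpotent at each level. This is why admissibility is integrality up to nilpotents. -/
lemma exists_p_pow_smul_mem_bdRAdm (F : (bdRFamily ζ).alg σ) :
    ∃ n : ℕ, p ^ n • F ∈ bdRAdm ζ σ := by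
  obtain ⟨n, f, hf⟩ := exists_bdRInt_eq (bdRProj ζ 1 σ F)
  obtain ⟨G, hG⟩ := exists_eq_tateXi_mul (F := p ^ n • F - bdRInt ζ σ f) (by
    rw [map_sub, map_nsmul, hf, sub_self])
  refine ⟨n, fun e ↦ mem_almostIntegral.2 ⟨restrictedMap (Ideal.Quotient.mk _) f, e, ?_⟩⟩
  rw [← bdRProj_bdRInt, ← map_sub, hG, map_mul, mul_pow, bdRProj_tateXi_pow, zero_mul]

/-- The rings `B_dR^+⟨σ⟩`. -/
def bdRCalculus (hK : IsPerfectoid p K) (ζ : RootSystem p K) : (bdRFamily ζ).Calculus p where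
  strict φ := BdRStrict φ
  adm σ := bdRAdm ζ σ
  strict_id _ _ := ⟨_, BdREStrict.id, fun _ ↦ rfl⟩
  strict_comp := BdRStrict.comp
  map_adm hφ F hF e := by
    obtain ⟨φₑ, h1, h2⟩ := hφ e
    rw [h2]
    exact h1.2 _ (hF e)
  zero_adm σ e := by
    rw [map_zero]
    exact zero_mem _
  var_adm s _ := bdREFamily_var_mem s
  lift c hc := BdR.exists_lift c hc
  sub_mem := BdRStrict.sub_mem hK
  torsionFree x hx := smul_pow_cancel bdRFamily_isUnit_p (n := 1)
    (by rw [pow_one, hx, smul_zero])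
  fg_of_saturated I _ := (isNoetherianRing_iff_ideal_fg _).1 (isNoetherianRing_bdRFamily hK) I
  inf_fg _ _ := (isNoetherianRing_iff_ideal_fg _).1 (isNoetherianRing_bdRFamily hK) _
  exists_adm := exists_generators_mem bdRFamily_isUnit_p exists_p_pow_smul_mem_bdRAdm

end BdRTate

end TateRes
end

noncomputable section

set_option linter.unusedSectionVars false

namespace TateRes

/-! ### A criterion for an augmentation to be a quasi-isomorphism -/

section Augmentation

open AlgebraicTopology Simplicial

variable {R : Type u} [CommRing R]

/-- The augmentation of a simplicial module is a resolution, in terms of elements. -/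
structure IsAcyclicAugmentation (M : SimplicialObject (ModuleCat.{u} R)) (N : ModuleCat.{u} R)
    (f : M _⦋0⦌ ⟶ N) : Prop where
  surjective : Function.Surjective f
  exists_zero : ∀ z : M _⦋0⦌, f z = 0 → ∃ y : M _⦋1⦌, M.δ 0 y = z ∧ M.δ 1 y = 0
  exists_succ : ∀ (n : ℕ) (z : M _⦋n + 1⦌), (∀ i, M.δ i z = 0) →
    ∃ y : M _⦋n + 2⦌, M.δ 0 y = z ∧ ∀ i : Fin (n + 2), M.δ i.succ y = 0

lemma alternatingFace_d_apply (M : SimplicialObject (ModuleCat.{u} R)) (n : ℕ) (y : M _⦋n + 1⦌)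
    (hy : ∀ i : Fin (n + 1), M.δ i.succ y = 0) :
    (AlternatingFaceMapComplex.obj M).d (n + 1) n y = M.δ 0 y := by
  have h1 : ((-1 : ℤ) ^ ((0 : Fin (n + 2)) : ℕ)) = 1 := by simp
  rw [AlternatingFaceMapComplex.obj_d_eq, Fin.sum_univ_succ, h1, one_smul]
  have h2 : (∑ i : Fin (n + 1), (-1 : ℤ) ^ ((i.succ : Fin (n + 2)) : ℕ) • M.δ i.succ).hom y = 0 := by
    rw [ModuleCat.hom_sum, LinearMap.sum_apply]
    refine Finset.sum_eq_zero fun i _ ↦ ?_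
    rw [ModuleCat.hom_zsmul, LinearMap.smul_apply]
    have : (M.δ i.succ).hom y = 0 := hy i
    rw [this, smul_zero]
  change (M.δ 0 + _).hom y = _
  rw [ModuleCat.hom_add, LinearMap.add_apply, h2, add_zero]

/-- The Dold–Kan projector is homotopic to the identity, so the cycle `z` is homologous to its
projection `w`. The higher faces of `w` vanish, and so does its `0`-th face, which equals its
differential. The hypothesis on the augmentation fills `w`. -/
lemma exists_d_eq (M : SimplicialObject (ModuleCat.{u} R)) (N : ModuleCat.{u} R)
    (f : M _⦋0⦌ ⟶ N) (h : IsAcyclicAugmentation M N f) (n : ℕ) (z : M _⦋n + 1⦌)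
    (hz : (AlternatingFaceMapComplex.obj M).d (n + 1) n z = 0) :
    ∃ y : M _⦋n + 2⦌, (AlternatingFaceMapComplex.obj M).d (n + 2) (n + 1) y = z := by
  let H := DoldKan.homotopyPInftyToId M
  have h1 := H.comm (n + 1)
  rw [Homotopy.dNext_succ_chainComplex, Homotopy.prevD_chainComplex] at h1
  let w : M _⦋n + 1⦌ := (DoldKan.PInfty (X := M)).f (n + 1) z
  let v : M _⦋n + 2⦌ := H.hom (n + 1) (n + 2) z
  let d : M _⦋n + 2⦌ ⟶ M _⦋n + 1⦌ := (AlternatingFaceMapComplex.obj M).d (n + 2) (n + 1)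
  have h2 : w = d v + z := by
    have h3 := congrArg (fun g ↦ g.hom z) h1
    simp only [ModuleCat.hom_add, LinearMap.add_apply, ModuleCat.hom_comp,
      LinearMap.comp_apply] at h3
    have h4 : ((AlternatingFaceMapComplex.obj M).d (n + 1) n).hom z = 0 := hz
    rw [h4, map_zero, zero_add] at h3
    exact h3
  have hw : ∀ i : Fin (n + 1), M.δ i.succ w = 0 := fun i ↦ by
    have h3 := DoldKan.HigherFacesVanish.of_P (X := M) (n + 1) n i (by omega)
    have h4 := congrArg (fun g ↦ g.hom z) h3
    change M.δ i.succ ((DoldKan.PInfty (X := M)).f (n + 1) z) = 0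
    rw [DoldKan.PInfty_f]
    exact h4
  have hdw : (AlternatingFaceMapComplex.obj M).d (n + 1) n w = 0 := by
    have h3 := congrArg (fun g ↦ g.hom z) ((DoldKan.PInfty (X := M)).comm (n + 1) n)
    simp only [ModuleCat.hom_comp, LinearMap.comp_apply] at h3
    have h4 : ((AlternatingFaceMapComplex.obj M).d (n + 1) n).hom z = 0 := hz
    rw [h4, map_zero] at h3
    exact h3
  have hw' : ∀ i, M.δ i w = 0 := fun i ↦ by
    cases i using Fin.cases with
    | zero => rw [← alternatingFace_d_apply M n w hw, hdw]
    | succ i => exact hw i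
  obtain ⟨y, hy, hy'⟩ := h.exists_succ n w hw'
  have h5 : d y = d v + z := by
    rw [← h2, ← hy]
    exact alternatingFace_d_apply M (n + 1) y hy'
  refine ⟨y - v, ?_⟩
  change d (y - v) = z
  rw [map_sub, h5, add_sub_cancel_left]

lemma quasiIso_augmentation (X : SimplicialObject.Augmented (ModuleCat.{u} R))
    (h : IsAcyclicAugmentation X.left X.right (X.hom.app (Opposite.op ⦋0⦌))) :
    QuasiIso (AlternatingFaceMapComplex.ε.app X) := by
  refine ⟨fun n ↦ ?_⟩
  rcases n with _ | n
  · rw [ChainComplex.quasiIsoAt₀_iff, ShortComplex.quasiIso_iff_of_zeros']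
    · refine ⟨(ShortComplex.moduleCat_exact_iff _).2 fun z hz ↦ ?_, ?_⟩
      · obtain ⟨y, hy, hy'⟩ := h.exists_zero z hz
        refine ⟨y, ?_⟩
        change (AlternatingFaceMapComplex.obj X.left).d 1 0 y = z
        rw [alternatingFace_d_apply X.left 0 y, hy]
        intro i
        rw [show i = 0 from Fin.eq_zero i]
        exact hy'
      · exact (ModuleCat.epi_iff_surjective _).2 h.surjective
    · exact (AlternatingFaceMapComplex.obj X.left).shape 0 0 (by simp)
    · exact HomologicalComplex.single_obj_d (ComplexShape.down ℕ) 0 X.right 1 0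
    · exact HomologicalComplex.single_obj_d (ComplexShape.down ℕ) 0 X.right 0 0
  · rw [quasiIsoAt_iff_exactAt' _ _ (ChainComplex.exactAt_succ_single_obj _ _),
      HomologicalComplex.exactAt_iff' _ (n + 2) (n + 1) n (by simp) (by simp),
      ShortComplex.moduleCat_exact_iff]
    exact fun z hz ↦ exists_d_eq X.left X.right _ h n z hz

/-- A simplicial module with acyclic augmentation is quasi-isomorphic to a constant one. -/
lemma isSimplicialQuasiIso_of_acyclic {M : SimplicialObject (ModuleCat.{u} R)}
    {N : ModuleCat.{u} R} (f : M ⟶ (SimplicialObject.const _).obj N)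
    (h : IsAcyclicAugmentation M N (f.app (Opposite.op ⦋0⦌))) : IsSimplicialQuasiIso f := by
  let X : SimplicialObject.Augmented (ModuleCat.{u} R) := ⟨M, N, f⟩
  let Y : SimplicialObject.Augmented (ModuleCat.{u} R) := ⟨(SimplicialObject.const _).obj N, N, 𝟙 _⟩
  let g : X ⟶ Y := { left := f, right := 𝟙 N }
  -- In a constant simplicial module the faces are identities, so only zero has vanishing faces. Two
  -- out of three then reduces the claim to the augmentation of `X`.
  have hY : QuasiIso (AlternatingFaceMapComplex.ε.app Y) := quasiIso_augmentation Y
    ⟨Function.surjective_id, fun z hz ↦ ⟨0, by rw [map_zero]; exact hz.symm, map_zero _⟩,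
      fun n z hz ↦ ⟨0, by rw [map_zero]; exact (hz 0).symm, fun i ↦ map_zero _⟩⟩
  have hX : QuasiIso (AlternatingFaceMapComplex.ε.app X) := quasiIso_augmentation X h
  have hg := AlternatingFaceMapComplex.ε.naturality g
  have h1 : QuasiIso ((alternatingFaceMapComplex _).map f ≫ AlternatingFaceMapComplex.ε.app Y) := by
    change QuasiIso ((SimplicialObject.Augmented.drop ⋙ alternatingFaceMapComplex _).map g ≫ _)
    rw [hg]
    change QuasiIso (_ ≫ (ChainComplex.single₀ _).map (𝟙 N))
    rw [CategoryTheory.Functor.map_id, Category.comp_id]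
    exact hX
  exact quasiIso_of_comp_right _ (AlternatingFaceMapComplex.ε.app Y)

end Augmentation

end TateRes
end

noncomputable section

set_option linter.unusedSectionVars false

namespace TateRes

/-! ### Free pairs over finite sets of variables -/

section Free

variable {R : Type u} [CommRing R] {T : TateFamily R} {p : ℕ}

/-- A finite set of variables with a distinguished subset, whose elements generate the ideal of the
associated pair. -/
structure TateFamily.Calculus.Vars (H : T.Calculus p) where
  V : Type
  [finite : Finite V]
  Y : Set V

attribute [instance] TateFamily.Calculus.Vars.finite

variable {H : T.Calculus p}

/-- The ideal generated by the distinguished variables. -/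
def TateFamily.Calculus.Vars.ideal (a : H.Vars) : Ideal (T.alg a.V) :=
  Ideal.span (T.var '' a.Y)

/-- Strict homomorphisms that preserve the ideals. -/
@[ext]
structure TateFamily.Calculus.Vars.Hom (a b : H.Vars) where
  toAlgHom : T.alg a.V →ₐ[R] T.alg b.V
  strict : H.strict toAlgHom
  map_mem : ∀ x ∈ a.ideal, toAlgHom x ∈ b.ideal

instance : Category H.Vars where
  Hom := TateFamily.Calculus.Vars.Hom
  id a := ⟨AlgHom.id R _, H.strict_id _, fun _ hx ↦ hx⟩
  comp f g := ⟨g.toAlgHom.comp f.toAlgHom, H.strict_comp f.strict g.strict,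
    fun x hx ↦ g.map_mem _ (f.map_mem x hx)⟩

variable {a b c : H.Vars}

/-- The homomorphism of algebras underlying a morphism. -/
def app (f : a ⟶ b) : T.alg a.V →ₐ[R] T.alg b.V := f.toAlgHom

lemma app_mem (f : a ⟶ b) {x : T.alg a.V} (hx : x ∈ a.ideal) : app f x ∈ b.ideal := f.map_mem x hx

@[simp] lemma app_id (x : T.alg a.V) : app (𝟙 a) x = x := rfl

@[simp] lemma app_comp (f : a ⟶ b) (g : b ⟶ c) (x : T.alg a.V) :
    app (f ≫ g) x = app g (app f x) := rfl

lemma app_adm (f : a ⟶ b) {x : T.alg a.V} (hx : x ∈ H.adm a.V) : app f x ∈ H.adm b.V :=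
  H.map_adm f.strict x hx

lemma app_sub_mem (f g : a ⟶ b) (x : T.alg a.V) :
    app f x - app g x ∈ Ideal.span (Set.range fun v ↦ app f (T.var v) - app g (T.var v)) :=
  H.sub_mem f.strict g.strict x

lemma vars_hom_ext {f g : a ⟶ b} (h : ∀ v, app f (T.var v) = app g (T.var v)) : f = g := by
  refine TateFamily.Calculus.Vars.Hom.ext (AlgHom.ext fun x ↦ ?_)
  have h1 := app_sub_mem f g x
  simp only [h, sub_self] at h1
  have h2 : Ideal.span (Set.range fun _ : a.V ↦ (0 : T.alg b.V)) = ⊥ :=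
    Ideal.span_eq_bot.2 (by rintro _ ⟨s, rfl⟩; rfl)
  rw [h2, Ideal.mem_bot, sub_eq_zero] at h1
  exact h1

lemma var_mem_ideal {v : a.V} (hv : v ∈ a.Y) : T.var v ∈ a.ideal := Ideal.subset_span ⟨v, hv, rfl⟩

lemma exists_ofVars (x : a.V → T.alg b.V) (hx : ∀ v, x v ∈ H.adm b.V)
    (hY : ∀ v ∈ a.Y, x v ∈ b.ideal) : ∃ f : a ⟶ b, ∀ v, app f (T.var v) = x v := by
  obtain ⟨f, hf, hfx⟩ := H.lift x hx
  refine ⟨⟨f, hf, fun y hy ↦ ?_⟩, hfx⟩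
  have : a.ideal ≤ b.ideal.comap f.toRingHom := Ideal.span_le.2 (by
    rintro _ ⟨v, hv, rfl⟩
    change f _ ∈ b.ideal
    rw [hfx]
    exact hY v hv)
  exact this hy

/-- The morphism with given values on the variables. -/
def ofVars (x : a.V → T.alg b.V) (hx : ∀ v, x v ∈ H.adm b.V) (hY : ∀ v ∈ a.Y, x v ∈ b.ideal) :
    a ⟶ b := (exists_ofVars x hx hY).choose

@[simp] lemma app_ofVars (x : a.V → T.alg b.V) (hx : ∀ v, x v ∈ H.adm b.V)
    (hY : ∀ v ∈ a.Y, x v ∈ b.ideal) (v : a.V) : app (ofVars x hx hY) (T.var v) = x v :=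
  (exists_ofVars x hx hY).choose_spec v

end Free

/-! ### Partial resolutions and the attachment of cells -/

section Stage

open Simplicial Opposite

variable {R : Type u} [CommRing R] {T : TateFamily R} {p : ℕ} {H : T.Calculus p}

/-- The action of a morphism of the simplex category on a simplicial object. -/
def act (S : SimplicialObject H.Vars) {m n : SimplexCategory} (α : m ⟶ n) :
    T.alg (S.obj (op n)).V →ₐ[R] T.alg (S.obj (op m)).V := app (S.map α.op)

section

variable (S : SimplicialObject H.Vars) {m n k : SimplexCategory}

lemma act_id (x : T.alg (S.obj (op m)).V) : act S (𝟙 m) x = x := by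
  rw [act, op_id, S.map_id, app_id]

lemma act_comp (α : m ⟶ n) (β : n ⟶ k) (x : T.alg (S.obj (op k)).V) :
    act S (α ≫ β) x = act S α (act S β x) := by
  rw [act, op_comp, S.map_comp, app_comp]; rfl

lemma act_mem (α : m ⟶ n) {x : T.alg (S.obj (op n)).V} (hx : x ∈ (S.obj (op n)).ideal) :
    act S α x ∈ (S.obj (op m)).ideal := app_mem _ hx

lemma act_app {S S' : SimplicialObject H.Vars} (f : S ⟶ S') (α : m ⟶ n)
    (x : T.alg (S.obj (op n)).V) :
    act S' α (app (f.app (op n)) x) = app (f.app (op m)) (act S α x) := by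
  rw [act, act, ← app_comp, ← app_comp, f.naturality]

end

variable {Q : AlgPair R}

variable (H Q) in
/-- A simplicial object with an augmentation to `Q`. -/
structure Stage where
  S : SimplicialObject H.Vars
  f : T.alg (S _⦋0⦌).V →ₐ[R] Q.alg
  f_mem : ∀ x ∈ (S _⦋0⦌).ideal, f x ∈ Q.ideal
  f_act : ∀ (m : SimplexCategory) (g₁ g₂ : ⦋0⦌ ⟶ m) (x : T.alg (S.obj (op m)).V),
    f (act S g₁ x) = f (act S g₂ x)

/-- The elements of degree `n` whose faces, or whose image under the augmentation if `n = 0`,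
vanish. -/
def Stage.cycles (s : Stage H Q) (n : ℕ) : Ideal (T.alg (s.S _⦋n⦌).V) where
  carrier := {z | (∀ (m : SimplexCategory) (τ : m ⟶ ⦋n⦌), m.len < n → act s.S τ z = 0) ∧
    ∀ τ : ⦋0⦌ ⟶ ⦋n⦌, s.f (act s.S τ z) = 0}
  add_mem' {x y} hx hy := ⟨fun m τ h ↦ by rw [map_add, hx.1 m τ h, hy.1 m τ h, add_zero],
    fun τ ↦ by rw [map_add, map_add, hx.2, hy.2, add_zero]⟩
  zero_mem' := ⟨fun m τ h ↦ map_zero _, fun τ ↦ by rw [map_zero, map_zero]⟩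
  smul_mem' c x hx := ⟨fun m τ h ↦ by rw [smul_eq_mul, map_mul, hx.1 m τ h, mul_zero],
    fun τ ↦ by rw [smul_eq_mul, map_mul, map_mul, hx.2, mul_zero]⟩

/-- A map that misses a vertex factors through the opposite face, where a cycle vanishes. In degree
zero no map misses the only vertex. -/
lemma Stage.act_eq_zero {s : Stage H Q} {n : ℕ} {z : T.alg (s.S _⦋n⦌).V} (hz : z ∈ s.cycles n)
    {m : SimplexCategory} (τ : m ⟶ ⦋n⦌) {j : Fin (n + 1)} (hj : ∀ x, τ.toOrderHom x ≠ j) :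
    act s.S τ z = 0 := by
  obtain ⟨m⟩ := m
  rcases n with _ | n
  · exact absurd (Subsingleton.elim (α := Fin 1) _ _) (hj 0)
  · rw [← SimplexCategory.factor_δ_spec τ j hj, act_comp, hz.1 _ _ (Nat.lt_succ_self n), map_zero]

/-- Cells of dimension `n + 1` to be attached along cycles. -/
structure Stage.Cells (s : Stage H Q) (n : ℕ) where
  G : Type
  [finite : Finite G]
  Y : Set G
  z : G → T.alg (s.S _⦋n⦌).V
  adm : ∀ g, z g ∈ H.adm _
  mem : ∀ g ∈ Y, z g ∈ (s.S _⦋n⦌).ideal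
  cyc : ∀ g, z g ∈ s.cycles n

attribute [instance] Stage.Cells.finite

instance finite_simplexCategory_hom (m n : SimplexCategory) : Finite (m ⟶ n) :=
  Finite.of_injective (fun α : m ⟶ n ↦ (α.toOrderHom : Fin (m.len + 1) → Fin (n.len + 1)))
    fun _ _ h ↦ SimplexCategory.Hom.ext _ _ (OrderHom.ext _ _ h)

namespace Stage.Cells

variable {s : Stage H Q} {n : ℕ} (C : s.Cells n) {m m' : SimplexCategory}

/-- The variables of degree `m` after attaching the cells. -/
def obj (m : SimplexCategory) : H.Vars where
  V := (s.S.obj (op m)).V ⊕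
    ({β : m ⟶ ⦋n + 1⦌ // Function.Surjective β.toOrderHom} × C.G)
  Y := Sum.elim (s.S.obj (op m)).Y fun x ↦ x.2 ∈ C.Y

lemma inl_mem_Y {v : (s.S.obj (op m)).V} :
    (Sum.inl v : (C.obj m).V) ∈ (C.obj m).Y ↔ v ∈ (s.S.obj (op m)).Y := Iff.rfl

lemma inr_mem_Y {x : {β : m ⟶ ⦋n + 1⦌ // Function.Surjective β.toOrderHom} × C.G} :
    (Sum.inr x : (C.obj m).V) ∈ (C.obj m).Y ↔ x.2 ∈ C.Y := Iff.rfl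

/-- The inclusion of the old variables. -/
def incl (m : SimplexCategory) : s.S.obj (op m) ⟶ C.obj m :=
  ofVars (b := C.obj m) (fun v ↦ T.var (σ := (C.obj m).V) (Sum.inl v)) (fun _ ↦ H.var_adm _)
    fun _ hv ↦ var_mem_ideal (a := C.obj m) (C.inl_mem_Y.2 hv)

/-- The retraction that sends the new variables to zero. -/
def retr (m : SimplexCategory) : C.obj m ⟶ s.S.obj (op m) :=
  ofVars (a := C.obj m) (Sum.elim T.var fun _ ↦ 0)
    (by rintro (v | x); exacts [H.var_adm v, H.zero_adm _])
    (by rintro (v | x) hv; exacts [var_mem_ideal (C.inl_mem_Y.1 hv), zero_mem _])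

@[simp] lemma app_incl_var (v : (s.S.obj (op m)).V) :
    app (C.incl m) (T.var v) = T.var (σ := (C.obj m).V) (Sum.inl v) := app_ofVars _ _ _ _

@[simp] lemma app_retr_inl (v : (s.S.obj (op m)).V) :
    app (C.retr m) (T.var (σ := (C.obj m).V) (Sum.inl v)) = T.var v := app_ofVars _ _ _ _

lemma incl_retr : C.incl m ≫ C.retr m = 𝟙 _ := vars_hom_ext fun v ↦ by
  rw [app_comp, app_incl_var, app_retr_inl, app_id]

lemma app_retr_incl (x : T.alg (s.S.obj (op m)).V) :
    app (C.retr m) (app (C.incl m) x) = x := by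
  rw [← app_comp, incl_retr, app_id]

open Classical in
/-- The element attached to a cell and a not necessarily surjective map to its simplex. -/
def cell (β : m ⟶ ⦋n + 1⦌) (g : C.G) : T.alg (C.obj m).V :=
  -- A surjection labels a possibly degenerate copy of the cell. A map that misses `0` factors
  -- through the face opposite to `0`, which is glued to `z g`, and `σ 0` recovers the
  -- factorization. Any other non-surjective map lands in a face containing `0`; these faces are
  -- glued to zero.
  if h : Function.Surjective β.toOrderHom then T.var (σ := (C.obj m).V) (Sum.inr (⟨β, h⟩, g))
  else if ∀ x, β.toOrderHom x ≠ 0 then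
    app (C.incl m) (act s.S (β ≫ SimplexCategory.σ 0) (C.z g))
  else 0

lemma cell_of_surjective {β : m ⟶ ⦋n + 1⦌} (h : Function.Surjective β.toOrderHom) (g : C.G) :
    C.cell β g = T.var (σ := (C.obj m).V) (Sum.inr (⟨β, h⟩, g)) := dif_pos h

lemma cell_of_ne {β : m ⟶ ⦋n + 1⦌} (h : ∀ x, β.toOrderHom x ≠ 0) (g : C.G) :
    C.cell β g = app (C.incl m) (act s.S (β ≫ SimplexCategory.σ 0) (C.z g)) := by
  rw [cell, dif_neg (fun hs ↦ by obtain ⟨x, hx⟩ := hs 0; exact h x hx), if_pos h]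

lemma cell_eq_zero {β : m ⟶ ⦋n + 1⦌} (h : ¬ Function.Surjective β.toOrderHom)
    (h0 : ∃ x, β.toOrderHom x = 0) (g : C.G) : C.cell β g = 0 := by
  obtain ⟨x, hx⟩ := h0
  rw [cell, dif_neg h, if_neg fun h ↦ h x hx]

lemma cell_cases (β : m ⟶ ⦋n + 1⦌) : Function.Surjective β.toOrderHom ∨
    (∀ x, β.toOrderHom x ≠ 0) ∨
    (¬ Function.Surjective β.toOrderHom ∧ ∃ x, β.toOrderHom x = 0) := by
  by_cases h : Function.Surjective β.toOrderHom
  · exact Or.inl h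
  · by_cases h0 : ∃ x, β.toOrderHom x = 0
    · exact Or.inr (Or.inr ⟨h, h0⟩)
    · exact Or.inr (Or.inl (not_exists.1 h0))

lemma cell_adm (β : m ⟶ ⦋n + 1⦌) (g : C.G) : C.cell β g ∈ H.adm (C.obj m).V := by
  obtain h | h | ⟨h, h'⟩ := cell_cases β
  · rw [C.cell_of_surjective h]
    exact H.var_adm _
  · rw [C.cell_of_ne h]
    exact app_adm _ (app_adm _ (C.adm g))
  · rw [C.cell_eq_zero h h']
    exact H.zero_adm _

lemma cell_mem (β : m ⟶ ⦋n + 1⦌) {g : C.G} (hg : g ∈ C.Y) : C.cell β g ∈ (C.obj m).ideal := by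
  obtain h | h | ⟨h, h'⟩ := cell_cases β
  · rw [C.cell_of_surjective h]
    exact var_mem_ideal (a := C.obj m) (C.inr_mem_Y.2 hg)
  · rw [C.cell_of_ne h]
    exact app_mem _ (act_mem _ _ (C.mem g hg))
  · rw [C.cell_eq_zero h h']
    exact zero_mem _

/-- The action of the simplex category after attaching the cells. -/
def map (α : m' ⟶ m) : C.obj m ⟶ C.obj m' :=
  ofVars (a := C.obj m) (b := C.obj m')
    (Sum.elim (fun v ↦ app (C.incl m') (act s.S α (T.var v))) fun x ↦ C.cell (α ≫ x.1.1) x.2)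
    (by
      rintro (v | x)
      · exact app_adm _ (app_adm _ (H.var_adm v))
      · exact C.cell_adm _ _)
    (by
      rintro (v | x) hv
      · exact app_mem _ (act_mem _ _ (var_mem_ideal (C.inl_mem_Y.1 hv)))
      · exact C.cell_mem _ (C.inr_mem_Y.1 hv))

lemma app_map_inl (α : m' ⟶ m) (v : (s.S.obj (op m)).V) :
    app (C.map α) (T.var (σ := (C.obj m).V) (Sum.inl v)) =
      app (C.incl m') (act s.S α (T.var v)) := app_ofVars _ _ _ _

lemma incl_map (α : m' ⟶ m) : C.incl m ≫ C.map α = s.S.map α.op ≫ C.incl m' :=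
  vars_hom_ext fun v ↦ by
    rw [app_comp, app_incl_var, app_map_inl, app_comp]
    rfl

lemma app_map_incl (α : m' ⟶ m) (x : T.alg (s.S.obj (op m)).V) :
    app (C.map α) (app (C.incl m) x) = app (C.incl m') (act s.S α x) := by
  rw [← app_comp, incl_map, app_comp]
  rfl

/-- Functoriality of the attachment. The case that needs the cycle condition is that of `β` hitting
`0` but missing some `j + 1`, while `α ≫ β` misses `0`. The gluing rule then gives a value of `z g`
along a map missing `j`, which has to be zero. -/
lemma app_map_cell (α : m' ⟶ m) (β : m ⟶ ⦋n + 1⦌) (g : C.G) :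
    app (C.map α) (C.cell β g) = C.cell (α ≫ β) g := by
  have hcomp : ∀ x, (α ≫ β).toOrderHom x = β.toOrderHom (α.toOrderHom x) := fun _ ↦ rfl
  obtain h | h | ⟨h, h'⟩ := cell_cases β
  · rw [C.cell_of_surjective h]
    exact app_ofVars _ _ _ _
  · rw [C.cell_of_ne h, C.cell_of_ne fun x ↦ by rw [hcomp]; exact h _, app_map_incl, ← act_comp,
      Category.assoc]
  · rw [C.cell_eq_zero h h', map_zero]
    have hns : ¬ Function.Surjective (α ≫ β).toOrderHom := fun hs ↦ h fun y ↦ by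
      obtain ⟨x, hx⟩ := hs y
      exact ⟨_, hx⟩
    by_cases h0 : ∃ x, (α ≫ β).toOrderHom x = 0
    · rw [C.cell_eq_zero hns h0]
    · have h0' := not_exists.1 h0
      obtain ⟨i, hi⟩ := not_forall.1 h
      have hi' := not_exists.1 hi
      have hi0 : i ≠ 0 := by
        rintro rfl
        exact hi h'
      obtain ⟨j, rfl⟩ := Fin.exists_succ_eq.2 hi0
      rw [C.cell_of_ne h0', s.act_eq_zero (C.cyc g) _ (j := j), map_zero]
      intro x hx
      obtain ⟨y, hy⟩ := Fin.exists_succ_eq.2 (h0' x)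
      have h1 : ((α ≫ β) ≫ SimplexCategory.σ 0).toOrderHom x =
          Fin.predAbove 0 ((α ≫ β).toOrderHom x) := rfl
      rw [h1, ← hy, Fin.predAbove_zero_succ] at hx
      exact hi' _ ((hcomp x).symm.trans (by rw [← hy, hx]))

lemma map_id : C.map (𝟙 m) = 𝟙 (C.obj m) := vars_hom_ext (a := C.obj m) (by
  rintro (v | ⟨⟨β, h⟩, g⟩)
  · rw [app_map_inl, act_id, app_incl_var, app_id]
  · rw [← C.cell_of_surjective h, app_map_cell, Category.id_comp, app_id])

lemma map_comp {m'' : SimplexCategory} (α : m'' ⟶ m') (β : m' ⟶ m) :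
    C.map (α ≫ β) = C.map β ≫ C.map α := vars_hom_ext (a := C.obj m) (by
  rintro (v | ⟨⟨γ, h⟩, g⟩)
  · rw [app_comp, app_map_inl, app_map_inl, app_map_incl, act_comp]
  · rw [← C.cell_of_surjective h, app_comp, app_map_cell, app_map_cell, app_map_cell,
      Category.assoc])

/-- The simplicial object obtained by attaching the cells. -/
def simplicial : SimplicialObject H.Vars where
  obj m := C.obj m.unop
  map α := C.map α.unop
  map_id _ := C.map_id
  map_comp α β := C.map_comp β.unop α.unop

/-- A map from the `0`-simplex to `⦋n + 1⦌` is never onto, so its value is zero or a vertex of the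
cycle `z g`, which the augmentation kills. -/
lemma f_retr_cell (γ : ⦋0⦌ ⟶ ⦋n + 1⦌) (g : C.G) : s.f (app (C.retr ⦋0⦌) (C.cell γ g)) = 0 := by
  obtain h | h | ⟨h, h'⟩ := cell_cases γ
  · have := Fintype.card_le_of_surjective _ h
    simp at this
  · rw [C.cell_of_ne h, app_retr_incl]
    exact (C.cyc g).2 _
  · rw [C.cell_eq_zero h h', map_zero, map_zero]

/-- The stage obtained by attaching the cells. -/
def stage : Stage H Q where
  S := C.simplicial
  f := s.f.comp (app (C.retr ⦋0⦌))
  f_mem x hx := s.f_mem _ (app_mem _ hx)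
  f_act m g₁ g₂ x := by
    let I : Ideal (T.alg (C.obj ⦋0⦌).V) := RingHom.ker (s.f.comp (app (C.retr ⦋0⦌)))
    have h1 : act C.simplicial g₁ x - act C.simplicial g₂ x ∈ I := by
      -- The difference of the two actions lies in the ideal generated by the differences on
      -- variables, so it suffices to compare them on old variables and on cells.
      refine Ideal.span_le.2 ?_ (app_sub_mem (C.map g₁) (C.map g₂) x)
      rintro _ ⟨v, rfl⟩
      change (s.f.comp (app (C.retr ⦋0⦌))) _ = 0
      dsimp only
      rw [map_sub, sub_eq_zero, AlgHom.comp_apply, AlgHom.comp_apply]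
      rcases v with v | ⟨⟨β, h⟩, g⟩
      · rw [app_map_inl, app_map_inl, app_retr_incl, app_retr_incl, s.f_act]
      · rw [← C.cell_of_surjective h, app_map_cell, app_map_cell, f_retr_cell, f_retr_cell]
    exact (RingHom.sub_mem_ker_iff _).1 h1

/-- The inclusion of simplicial objects. -/
def inclusion : s.S ⟶ C.stage.S where
  app m := C.incl m.unop
  naturality _ _ α := (C.incl_map α.unop).symm

lemma stage_f_incl (x : T.alg (s.S _⦋0⦌).V) :
    C.stage.f (app (C.inclusion.app (op ⦋0⦌)) x) = s.f x := by
  change s.f (app (C.retr ⦋0⦌) (app (C.incl ⦋0⦌) x)) = _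
  rw [app_retr_incl]

/-- There is no surjection `m ⟶ ⦋n + 1⦌` when the dimension of `m` is at most `n`, so no variable is
added in these degrees. -/
lemma retr_incl (hm : m.len ≤ n) : C.retr m ≫ C.incl m = 𝟙 (C.obj m) :=
  vars_hom_ext (a := C.obj m) (by
    rintro (v | ⟨⟨β, h⟩, g⟩)
    · rw [app_comp, app_retr_inl, app_incl_var, app_id]
    · have := Fintype.card_le_of_surjective _ h
      simp at this
      omega)

lemma isIso_inclusion (hm : m.len ≤ n) : IsIso (C.inclusion.app (op m)) :=
  ⟨C.retr m, C.incl_retr, C.retr_incl hm⟩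

/-- The new cells fill the generators, and a coefficient `a` is carried along as its degeneracy `σ
0`, because `δ 0 ≫ σ 0` is the identity. The other faces vanish by multiplicativity. The ideal `J`
records fillings within the ideal of the pair. -/
lemma exists_filling (W : Set C.G) (J : Ideal (T.alg (C.obj ⦋n + 1⦌).V))
    (hJ : ∀ g ∈ W, C.cell (𝟙 _) g ∈ J) {x : T.alg (s.S _⦋n⦌).V} (hx : x ∈ Ideal.span (C.z '' W)) :
    ∃ y ∈ J, app (C.map (SimplexCategory.δ 0)) y = app (C.incl ⦋n⦌) x ∧
      ∀ i : Fin (n + 1), app (C.map (SimplexCategory.δ i.succ)) y = 0 := by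
  induction hx using Submodule.span_induction with
  | mem x hx =>
    obtain ⟨g, hg, rfl⟩ := hx
    refine ⟨_, hJ g hg, ?_, fun i ↦ ?_⟩
    · rw [app_map_cell, Category.comp_id, cell_of_ne]
      · rw [show SimplexCategory.δ (0 : Fin (n + 2)) ≫ SimplexCategory.σ 0 = 𝟙 _ from
          SimplexCategory.δ_comp_σ_self' rfl, act_id]
      · exact fun x ↦ Fin.succAbove_ne 0 x
    · rw [app_map_cell, Category.comp_id]
      refine C.cell_eq_zero (β := SimplexCategory.δ i.succ) (fun h ↦ ?_) ⟨0, ?_⟩ g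
      · obtain ⟨x, hx⟩ := h i.succ
        exact Fin.succAbove_ne i.succ x hx
      · exact Fin.succAbove_ne_zero_zero (Fin.succ_ne_zero i)
  | zero => exact ⟨0, zero_mem _, by rw [map_zero, map_zero], fun i ↦ map_zero _⟩
  | add x x' _ _ hx hx' =>
    obtain ⟨y, hy, h1, h2⟩ := hx
    obtain ⟨y', hy', h1', h2'⟩ := hx'
    exact ⟨y + y', add_mem hy hy', by rw [map_add, map_add, h1, h1'], fun i ↦ by
      rw [map_add, h2, h2', add_zero]⟩
  | smul a x _ hx =>
    obtain ⟨y, hy, h1, h2⟩ := hx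
    refine ⟨app (C.map (SimplexCategory.σ 0)) (app (C.incl ⦋n⦌) a) * y,
      J.mul_mem_left _ hy, ?_, fun i ↦ by rw [map_mul, h2, mul_zero]⟩
    rw [map_mul, h1, ← app_comp, ← map_comp, show SimplexCategory.δ (0 : Fin (n + 2)) ≫
      SimplexCategory.σ 0 = 𝟙 _ from SimplexCategory.δ_comp_σ_self' rfl, map_id, app_id,
      smul_eq_mul, map_mul]

end Stage.Cells

end Stage

end TateRes
end

noncomputable section

set_option linter.unusedSectionVars false

namespace TateRes

/-! ### The resolution as a colimit of stages -/

section Resolution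

open Simplicial Opposite Limits

variable {R : Type u} [CommRing R] {T : TateFamily R} {p : ℕ} {H : T.Calculus p} {Q : AlgPair R}

lemma TateFamily.Calculus.Vars.ideal_fg (a : H.Vars) : a.ideal.FG :=
  Submodule.fg_def.2 ⟨T.var '' a.Y, Set.toFinite _, rfl⟩

lemma Stage.mem_cycles_zero {s : Stage H Q} {z : T.alg (s.S _⦋0⦌).V} :
    z ∈ s.cycles 0 ↔ s.f z = 0 := by
  refine ⟨fun h ↦ ?_, fun h ↦ ⟨fun m τ hm ↦ absurd hm (Nat.not_lt_zero _), fun τ ↦ ?_⟩⟩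
  · have := h.2 (𝟙 _)
    rwa [act_id] at this
  · rw [s.f_act _ τ (𝟙 _), act_id, h]

lemma Stage.mem_cycles_succ {s : Stage H Q} {n : ℕ} {z : T.alg (s.S _⦋n + 1⦌).V} :
    z ∈ s.cycles (n + 1) ↔ ∀ i, act s.S (SimplexCategory.δ i) z = 0 := by
  refine ⟨fun h i ↦ h.1 _ _ (Nat.lt_succ_self n), fun h ↦ ?_⟩
  have key : ∀ (m : SimplexCategory) (τ : m ⟶ ⦋n + 1⦌), m.len < n + 1 → act s.S τ z = 0 := by
    rintro ⟨m⟩ τ hm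
    have h1 : ¬ Function.Surjective τ.toOrderHom := fun hs ↦ by
      have := Fintype.card_le_of_surjective _ hs
      simp at this hm
      omega
    obtain ⟨j, hj⟩ := not_forall.1 h1
    rw [← SimplexCategory.factor_δ_spec τ j (not_exists.1 hj), act_comp, h, map_zero]
  exact ⟨key, fun τ ↦ by rw [key _ τ n.succ_pos, map_zero]⟩

/-- In positive degree the cycles are the common kernel of maps into `p`-torsion free rings, hence
saturated. In degree zero the target is `B`, and finite generation comes from the presentation
instead. -/
lemma Stage.cycles_succ_fg (s : Stage H Q) (n : ℕ) : (s.cycles (n + 1)).FG :=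
  H.fg_of_saturated _ fun x hx ↦ by
    rw [mem_cycles_succ] at hx ⊢
    exact fun i ↦ H.torsionFree _ (by rw [← map_nsmul, hx i])

/-- All cycles of degree `n` are boundaries of elements of `s'`, in a way that is compatible with
the ideals. -/
def Stage.Fills (s s' : Stage H Q) (ι : s.S ⟶ s'.S) (n : ℕ) : Prop :=
  ∀ z ∈ s.cycles n, ∃ y : T.alg (s'.S _⦋n + 1⦌).V,
    (z ∈ (s.S _⦋n⦌).ideal → y ∈ (s'.S _⦋n + 1⦌).ideal) ∧
    act s'.S (SimplexCategory.δ 0) y = app (ι.app (op ⦋n⦌)) z ∧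
    ∀ i : Fin (n + 1), act s'.S (SimplexCategory.δ i.succ) y = 0

/-- Two families of cells are attached: one along generators of the cycles and a distinguished one
along generators of the cycles in the ideal. The second family makes the ideals a resolution as
well. -/
lemma Stage.exists_cells (s : Stage H Q) (n : ℕ) :
    ∃ C : s.Cells n, (s.cycles n).FG → s.Fills C.stage C.inclusion n := by
  by_cases h : (s.cycles n).FG
  · obtain ⟨k, g, hg, hgs⟩ := H.exists_adm h
    obtain ⟨l, b, hb, hbs⟩ := H.exists_adm (H.inf_fg h (s.S _⦋n⦌).ideal_fg)
    have hg' : ∀ i, g i ∈ s.cycles n := fun i ↦ hgs ▸ Ideal.subset_span ⟨i, rfl⟩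
    have hb' : ∀ i, b i ∈ s.cycles n ⊓ (s.S _⦋n⦌).ideal := fun i ↦
      hbs ▸ Ideal.subset_span ⟨i, rfl⟩
    let C : s.Cells n :=
      { G := Fin k ⊕ Fin l
        Y := Set.range Sum.inr
        z := Sum.elim g b
        adm := by rintro (i | i); exacts [hg i, hb i]
        mem := by rintro _ ⟨i, rfl⟩; exact (hb' i).2
        cyc := by rintro (i | i); exacts [hg' i, (hb' i).1] }
    refine ⟨C, fun _ z hz ↦ ?_⟩
    by_cases hzI : z ∈ (s.S _⦋n⦌).ideal
    · obtain ⟨y, hy, h1, h2⟩ := C.exists_filling C.Y _ (fun g hg ↦ C.cell_mem _ hg) (x := z) (by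
        have h3 : z ∈ s.cycles n ⊓ (s.S _⦋n⦌).ideal := ⟨hz, hzI⟩
        rw [← hbs] at h3
        refine Ideal.span_mono ?_ h3
        rintro _ ⟨i, rfl⟩
        exact ⟨Sum.inr i, ⟨i, rfl⟩, rfl⟩)
      exact ⟨y, fun _ ↦ hy, h1, h2⟩
    · obtain ⟨y, -, h1, h2⟩ := C.exists_filling Set.univ ⊤ (fun _ _ ↦ trivial) (x := z) (by
        rw [← hgs] at hz
        refine Ideal.span_mono ?_ hz
        rintro _ ⟨i, rfl⟩
        exact ⟨Sum.inl i, trivial, rfl⟩)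
      exact ⟨y, fun h ↦ absurd h hzI, h1, h2⟩
  -- Nothing is attached if the cycles are not finitely generated, so that the sequence of stages is
  -- defined for every initial stage.
  · exact ⟨{ G := Empty, Y := ∅, z := Empty.elim, adm := by rintro ⟨⟩, mem := by rintro ⟨⟩,
             cyc := by rintro ⟨⟩ }, fun h' ↦ absurd h' h⟩

section Sequence

variable (s₀ : Stage H Q)

/-- The sequence of partial resolutions. -/
def stageSeq : ℕ → Stage H Q :=
  Nat.rec s₀ fun n s ↦ (s.exists_cells n).choose.stage

/-- The transition maps of the sequence of partial resolutions. -/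
def stageSeqMap (n : ℕ) : (stageSeq s₀ n).S ⟶ (stageSeq s₀ (n + 1)).S :=
  ((stageSeq s₀ n).exists_cells n).choose.inclusion

lemma fills_stageSeq {n : ℕ} (h : ((stageSeq s₀ n).cycles n).FG) :
    (stageSeq s₀ n).Fills (stageSeq s₀ (n + 1)) (stageSeqMap s₀ n) n :=
  ((stageSeq s₀ n).exists_cells n).choose_spec h

/-- The diagram of partial resolutions. -/
def stageDiagram : ℕ ⥤ (SimplexCategoryᵒᵖ ⥤ H.Vars) := Functor.ofSequence (stageSeqMap s₀)

/-- Passing from stage `j` to stage `j + 1` adds variables only in degrees above `j`, so each degree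
is eventually constant. This makes the colimit exist with finitely many variables in each degree. -/
lemma isIso_stageDiagram_map {m : SimplexCategoryᵒᵖ} {k j : ℕ} (hk : m.unop.len ≤ k) (hkj : k ≤ j) :
    IsIso (((stageDiagram s₀).map (homOfLE hkj)).app m) := by
  induction j, hkj using Nat.le_induction with
  | base =>
    rw [show homOfLE (le_refl k) = 𝟙 k from rfl, CategoryTheory.Functor.map_id]
    infer_instance
  | succ j hkj ih =>
    have h1 : homOfLE (hkj.trans (Nat.le_succ j)) = homOfLE hkj ≫ homOfLE (Nat.le_succ j) := rfl
    have h2 : (stageDiagram s₀).map (homOfLE (Nat.le_succ j)) = stageSeqMap s₀ j :=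
      Functor.ofSequence_map_homOfLE_succ (stageSeqMap s₀) j
    have h3 : IsIso ((stageSeqMap s₀ j).app m) :=
      ((stageSeq s₀ j).exists_cells j).choose.isIso_inclusion (hk.trans hkj)
    rw [h1, Functor.map_comp, NatTrans.comp_app, h2]
    exact IsIso.comp_isIso' ih h3

lemma isEventuallyConstantFrom_stageDiagram {m : SimplexCategoryᵒᵖ} {k : ℕ} (hk : m.unop.len ≤ k) :
    (stageDiagram s₀ ⋙ (evaluation _ _).obj m).IsEventuallyConstantFrom k := fun _ f ↦
  isIso_stageDiagram_map s₀ hk (leOfHom f)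

instance hasColimit_stageDiagram_flip (m : SimplexCategoryᵒᵖ) :
    HasColimit ((stageDiagram s₀).flip.obj m) :=
  (isEventuallyConstantFrom_stageDiagram s₀ (m := m) le_rfl).hasColimit

/-- The maps from the partial resolutions to their colimit. -/
def stageι (k : ℕ) : (stageSeq s₀ k).S ⟶ (colimit (stageDiagram s₀) : SimplexCategoryᵒᵖ ⥤ H.Vars) :=
  colimit.ι (stageDiagram s₀) k

lemma stageSeqMap_stageι (k : ℕ) : stageSeqMap s₀ k ≫ stageι s₀ (k + 1) = stageι s₀ k := by
  have h := colimit.w (stageDiagram s₀) (homOfLE (Nat.le_succ k))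
  rw [show (stageDiagram s₀).map (homOfLE (Nat.le_succ k)) = stageSeqMap s₀ k from
    Functor.ofSequence_map_homOfLE_succ (stageSeqMap s₀) k] at h
  exact h

lemma isIso_stageι {m : SimplexCategory} {k : ℕ} (hk : m.len ≤ k) :
    IsIso ((stageι s₀ k).app (op m)) := by
  exact (isEventuallyConstantFrom_stageDiagram s₀ (m := op m) hk).isIso_ι_of_isColimit
    (isColimitOfPreserves ((evaluation _ _).obj (op m)) (colimit.isColimit (stageDiagram s₀)))

lemma bijective_app_of_isIso {a b : H.Vars} (f : a ⟶ b) [IsIso f] : Function.Bijective (app f) :=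
  Function.bijective_iff_has_inverse.2 ⟨app (inv f),
    fun x ↦ by rw [← app_comp, IsIso.hom_inv_id, app_id],
    fun x ↦ by rw [← app_comp, IsIso.inv_hom_id, app_id]⟩

/-- The inverse of `stageι` in low degrees. -/
def stageInv (k : ℕ) (m : SimplexCategory) (hk : m.len ≤ k) :
    (colimit (stageDiagram s₀) : SimplexCategoryᵒᵖ ⥤ H.Vars).obj (op m) ⟶
      (stageSeq s₀ k).S.obj (op m) :=
  have := isIso_stageι s₀ hk
  inv ((stageι s₀ k).app (op m))

lemma app_stageι_stageInv {k : ℕ} {m : SimplexCategory} (hk : m.len ≤ k)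
    (x : T.alg ((colimit (stageDiagram s₀) : SimplexCategoryᵒᵖ ⥤ H.Vars).obj (op m)).V) :
    app ((stageι s₀ k).app (op m)) (app (stageInv s₀ k m hk) x) = x := by
  have := isIso_stageι s₀ hk
  rw [← app_comp, stageInv, IsIso.inv_hom_id, app_id]

lemma app_stageInv_stageι {k : ℕ} {m : SimplexCategory} (hk : m.len ≤ k)
    (x : T.alg ((stageSeq s₀ k).S.obj (op m)).V) :
    app (stageInv s₀ k m hk) (app ((stageι s₀ k).app (op m)) x) = x := by
  have := isIso_stageι s₀ hk
  rw [← app_comp, stageInv, IsIso.hom_inv_id, app_id]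

/-- The map from the colimit to the first stage in degree zero. -/
def stageInvZero : (colimit (stageDiagram s₀) : SimplexCategoryᵒᵖ ⥤ H.Vars).obj (op ⦋0⦌) ⟶
    s₀.S _⦋0⦌ := stageInv s₀ 0 ⦋0⦌ le_rfl

lemma app_stageι_succ (k : ℕ) (m : SimplexCategory)
    (x : T.alg ((stageSeq s₀ k).S.obj (op m)).V) :
    app ((stageι s₀ (k + 1)).app (op m)) (app ((stageSeqMap s₀ k).app (op m)) x) =
      app ((stageι s₀ k).app (op m)) x := by
  rw [← stageSeqMap_stageι s₀ k, NatTrans.comp_app, app_comp]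

lemma stageInv_stageι_f (k : ℕ) (x : T.alg ((stageSeq s₀ k).S _⦋0⦌).V) :
    s₀.f (app (stageInvZero s₀) (app ((stageι s₀ k).app (op ⦋0⦌)) x)) =
      (stageSeq s₀ k).f x := by
  induction k with
  | zero => exact congrArg s₀.f (app_stageInv_stageι s₀ (k := 0) (m := ⦋0⦌) le_rfl x)
  | succ k ih =>
    have h1 : IsIso ((stageSeqMap s₀ k).app (op ⦋0⦌)) :=
      ((stageSeq s₀ k).exists_cells k).choose.isIso_inclusion (Nat.zero_le k)
    obtain ⟨x, rfl⟩ := (bijective_app_of_isIso ((stageSeqMap s₀ k).app (op ⦋0⦌))).2 x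
    rw [app_stageι_succ, ih]
    exact (((stageSeq s₀ k).exists_cells k).choose.stage_f_incl x).symm

/-- The colimit of the partial resolutions. -/
def stageColimit : Stage H Q where
  S := (colimit (stageDiagram s₀) : SimplexCategoryᵒᵖ ⥤ H.Vars)
  f := s₀.f.comp (app (stageInvZero s₀))
  f_mem x hx := s₀.f_mem _ (app_mem (stageInvZero s₀) hx)
  f_act m g₁ g₂ x := by
    obtain ⟨x, rfl⟩ : ∃ y, app ((stageι s₀ m.len).app (op m)) y = x :=
      ⟨_, app_stageι_stageInv s₀ le_rfl x⟩
    rw [AlgHom.comp_apply, AlgHom.comp_apply, act_app (stageι s₀ m.len),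
      act_app (stageι s₀ m.len), stageInv_stageι_f, stageInv_stageι_f, Stage.f_act]

lemma stageColimit_f (k : ℕ) (x : T.alg ((stageSeq s₀ k).S _⦋0⦌).V) :
    (stageColimit s₀).f (app ((stageι s₀ k).app (op ⦋0⦌)) x) = (stageSeq s₀ k).f x :=
  stageInv_stageι_f s₀ k x

/-- A cycle of degree `n` comes from stage `n`, where the degrees up to `n` are already final, so it
is a cycle there. Stage `n + 1` fills it. -/
lemma fills_stageColimit (h : (s₀.cycles 0).FG) (n : ℕ) :
    (stageColimit s₀).Fills (stageColimit s₀) (𝟙 _) n := by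
  intro z hz
  obtain ⟨w, rfl⟩ : ∃ w, app ((stageι s₀ n).app (op ⦋n⦌)) w = z :=
    ⟨_, app_stageι_stageInv s₀ (k := n) (m := ⦋n⦌) le_rfl z⟩
  have hw : w ∈ (stageSeq s₀ n).cycles n := by
    refine ⟨fun m τ hm ↦ ?_, fun τ ↦ ?_⟩
    · have h1 := hz.1 m τ hm
      have h2 : act (stageColimit s₀).S τ (app ((stageι s₀ n).app (op ⦋n⦌)) w) = _ :=
        act_app (stageι s₀ n) τ w
      rw [h2] at h1
      rw [← app_stageInv_stageι s₀ hm.le (act (stageSeq s₀ n).S τ w)]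
      exact (congrArg _ h1).trans (map_zero _)
    · have h1 := hz.2 τ
      have h2 : act (stageColimit s₀).S τ (app ((stageι s₀ n).app (op ⦋n⦌)) w) = _ :=
        act_app (stageι s₀ n) τ w
      rw [h2] at h1
      exact (stageColimit_f s₀ n _).symm.trans h1
  have hfg : ((stageSeq s₀ n).cycles n).FG := by
    rcases n with _ | n
    exacts [h, (stageSeq s₀ (n + 1)).cycles_succ_fg n]
  obtain ⟨y, hy, h1, h2⟩ := fills_stageSeq s₀ hfg w hw
  refine ⟨app ((stageι s₀ (n + 1)).app (op ⦋n + 1⦌)) y, fun hzI ↦ ?_, ?_, fun i ↦ ?_⟩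
  · refine app_mem _ (hy ?_)
    rw [← app_stageInv_stageι s₀ (k := n) (m := ⦋n⦌) le_rfl w]
    exact app_mem (stageInv s₀ n ⦋n⦌ le_rfl) hzI
  · refine (act_app (stageι s₀ (n + 1)) _ y).trans ?_
    rw [h1, app_stageι_succ]
    rfl
  · refine (act_app (stageι s₀ (n + 1)) _ y).trans ?_
    rw [h2]
    exact map_zero _

end Sequence

/-! ### Resolutions of pairs -/

/-- The pair of a set of variables. -/
def toAlgPair : H.Vars ⥤ AlgPair R where
  obj a := ⟨T.alg a.V, a.ideal⟩
  map f := ⟨app f, f.map_mem⟩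

lemma toAlgPair_iso (a : H.Vars) : ∃ (X Y : Type) (_ : Finite X) (_ : Finite Y),
    Nonempty (toAlgPair.obj a ≅ T.pair X Y) := by
  classical
  let e : a.V ≃ {v // v ∉ a.Y} ⊕ a.Y := (Equiv.sumCompl (· ∉ a.Y)).symm.trans
    (Equiv.sumCongr (Equiv.refl _) (Equiv.subtypeEquivRight fun _ ↦ not_not))
  let b : H.Vars := ⟨{v // v ∉ a.Y} ⊕ a.Y, Set.range Sum.inr⟩
  have he : ∀ v, v ∈ a.Y ↔ e v ∈ b.Y := fun v ↦ by
    obtain ⟨w, rfl⟩ := e.symm.surjective v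
    rw [e.apply_symm_apply]
    rcases w with w | w
    · exact iff_of_false w.2 (by rintro ⟨_, h⟩; cases h)
    · exact iff_of_true w.2 ⟨w, rfl⟩
  let f : a ⟶ b := ofVars (fun v ↦ T.var (e v)) (fun v ↦ H.var_adm _)
    fun v hv ↦ var_mem_ideal ((he v).1 hv)
  let g : b ⟶ a := ofVars (fun v ↦ T.var (e.symm v)) (fun v ↦ H.var_adm _)
    fun v hv ↦ var_mem_ideal ((he _).2 (by rwa [e.apply_symm_apply]))
  let i : a ≅ b := ⟨f, g, vars_hom_ext fun v ↦ by
      rw [app_comp, app_ofVars, app_ofVars, e.symm_apply_apply, app_id],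
    vars_hom_ext fun v ↦ by
      rw [app_comp, app_ofVars, app_ofVars, e.apply_symm_apply, app_id]⟩
  have hb : toAlgPair.obj b = T.pair {v // v ∉ a.Y} a.Y := by
    have : b.ideal = (T.pair {v // v ∉ a.Y} a.Y).ideal :=
      congrArg Ideal.span (Set.range_comp _ _).symm
    change (⟨T.alg _, b.ideal⟩ : AlgPair R) = _
    rw [this]
    rfl
  exact ⟨_, _, inferInstance, inferInstance, ⟨toAlgPair.mapIso i ≪≫ eqToIso hb⟩⟩

/-- The simplicial pair of a stage. -/
def Stage.pair (s : Stage H Q) : SimplicialObject (AlgPair R) := s.S ⋙ toAlgPair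

/-- The augmentation of the simplicial pair of a stage. -/
def Stage.augmentation (s : Stage H Q) : s.pair ⟶ (SimplicialObject.const (AlgPair R)).obj Q where
  app m := ⟨s.f.comp (act s.S (SimplexCategory.const ⦋0⦌ m.unop 0)),
    fun x hx ↦ s.f_mem _ (act_mem _ _ hx)⟩
  naturality m m' α := AlgPair.Hom.ext (AlgHom.ext fun x ↦ by
    change s.f (act s.S _ (act s.S α.unop x)) = s.f (act s.S _ x)
    exact (congrArg s.f (act_comp s.S _ _ x).symm).trans (s.f_act _ _ _ x))

lemma Stage.augmentation_zero (s : Stage H Q) (x : T.alg (s.S _⦋0⦌).V) :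
    s.f (act s.S (SimplexCategory.const ⦋0⦌ ⦋0⦌ 0) x) = s.f x := by
  rw [s.f_act _ _ (𝟙 _), act_id]

/-- One family of fillings proves both acyclicity statements, since the filling of a cycle in the
ideal lies in the ideal. -/
lemma Stage.hasResolution (s : Stage H Q) (hf : Function.Surjective s.f)
    (hI : ∀ x ∈ Q.ideal, ∃ y ∈ (s.S _⦋0⦌).ideal, s.f y = x) (h : ∀ n, s.Fills s (𝟙 _) n) :
    T.HasResolution Q := by
  refine ⟨s.pair, s.augmentation, fun n ↦ toAlgPair_iso _, ?_, ?_⟩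
  · refine isSimplicialQuasiIso_of_acyclic (N := ModuleCat.of R Q.alg)
      (Functor.whiskerRight s.augmentation (algFunctor R)) ⟨fun x ↦ ?_, fun z hz ↦ ?_, fun n z hz ↦ ?_⟩
    · obtain ⟨y, hy⟩ := hf x
      exact ⟨y, (s.augmentation_zero y).trans hy⟩
    · obtain ⟨y, -, h1, h2⟩ := h 0 z (Stage.mem_cycles_zero.2 ((s.augmentation_zero z).symm.trans hz))
      exact ⟨y, h1, h2 0⟩
    · obtain ⟨y, -, h1, h2⟩ := h (n + 1) z (Stage.mem_cycles_succ.2 hz)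
      exact ⟨y, h1, h2⟩
  · refine isSimplicialQuasiIso_of_acyclic (N := ModuleCat.of R (Q.ideal.restrictScalars R))
      (Functor.whiskerRight s.augmentation (idealFunctor R))
      ⟨fun x ↦ ?_, fun z hz ↦ ?_, fun n z hz ↦ ?_⟩
    · obtain ⟨y, hy, hyx⟩ := hI x.1 x.2
      exact ⟨⟨y, hy⟩, Subtype.ext ((s.augmentation_zero y).trans hyx)⟩
    · obtain ⟨y, hy, h1, h2⟩ := h 0 z.1 (Stage.mem_cycles_zero.2
        ((s.augmentation_zero z.1).symm.trans (congrArg Subtype.val hz)))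
      exact ⟨⟨y, hy z.2⟩, Subtype.ext h1, Subtype.ext (h2 0)⟩
    · obtain ⟨y, hy, h1, h2⟩ := h (n + 1) z.1 (Stage.mem_cycles_succ.2 fun i ↦
        congrArg Subtype.val (hz i))
      exact ⟨⟨y, hy z.2⟩, Subtype.ext h1, fun i ↦ Subtype.ext (h2 i)⟩

/-- The first stage: a pair of Tate algebras that surjects onto a given pair. -/
lemma exists_initial_stage (H : T.Calculus p) {B : Type u} [CommRing B] [Algebra R B] (I : Ideal B)
    (hB : T.IsTopFinitelyPresented B) (hI : I.FG) :
    ∃ s : Stage H (⟨B, I⟩ : AlgPair R), Function.Surjective s.f ∧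
      (∀ x ∈ I, ∃ y ∈ (s.S _⦋0⦌).ideal, s.f y = x) ∧ (s.cycles 0).FG := by
  obtain ⟨n, f, hf, hker⟩ := hB
  obtain ⟨l, b, hb⟩ := Submodule.fg_iff_exists_fin_generating_family.1 hI
  choose c hc using fun i ↦ hf (b i)
  -- The lifts `c` of generators of `I` need not be admissible values for variables, so they are
  -- replaced by admissible generators of the ideal that they span.
  obtain ⟨k, g, hg, hgc⟩ := H.exists_adm (I := Ideal.span (Set.range c))
    (Submodule.fg_def.2 ⟨_, Set.finite_range c, rfl⟩)
  have hIg : I = Ideal.span (Set.range fun i ↦ f (g i)) := by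
    have h1 : Ideal.map f (Ideal.span (Set.range c)) = I := by
      rw [Ideal.map_span, ← Set.range_comp, ← hb, show ⇑f ∘ c = b from funext hc]
    rw [← h1, ← hgc, Ideal.map_span, ← Set.range_comp]
    rfl
  let a : H.Vars := ⟨Fin n ⊕ Fin k, Set.range Sum.inr⟩
  obtain ⟨u, hu, hux⟩ := H.lift (σ := Fin n ⊕ Fin k) (τ := Fin n) (Sum.elim T.var g)
    (by rintro (i | i); exacts [H.var_adm i, hg i])
  obtain ⟨j, hj, hjx⟩ := H.lift (σ := Fin n) (τ := Fin n ⊕ Fin k) (fun i ↦ T.var (Sum.inl i))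
    fun i ↦ H.var_adm _
  -- The inclusion `j` of the first variables is a section of `u`: the difference ideal of `u.comp
  -- j` and the identity is zero. This gives surjectivity of `u`.
  have huj : ∀ x, u (j x) = x := fun x ↦ by
    have h1 := H.sub_mem (H.strict_comp hj hu) (H.strict_id (Fin n)) x
    have h2 : Ideal.span (Set.range fun i ↦ (u.comp j) (T.var i) -
        (AlgHom.id R (T.alg (Fin n))) (T.var i)) = ⊥ := Ideal.span_eq_bot.2 (by
      rintro _ ⟨i, rfl⟩
      dsimp only
      rw [AlgHom.comp_apply, hjx, hux, AlgHom.id_apply, Sum.elim_inl, sub_self])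
    rw [h2, Ideal.mem_bot, sub_eq_zero] at h1
    exact h1
  have hus : Function.Surjective u := fun x ↦ ⟨j x, huj x⟩
  have hfu : ∀ i, (f.comp u) (T.var (Sum.inr i)) = f (g i) := fun i ↦ by
    rw [AlgHom.comp_apply, hux, Sum.elim_inr]
  have hmap : Ideal.map (f.comp u) a.ideal = I := by
    rw [TateFamily.Calculus.Vars.ideal, Ideal.map_span, hIg, ← Set.range_comp, ← Set.range_comp]
    exact congrArg Ideal.span (congrArg Set.range (funext hfu))
  let s : Stage H (⟨B, I⟩ : AlgPair R) :=
    { S := (SimplicialObject.const _).obj a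
      f := f.comp u
      f_mem := fun x hx ↦ by
        change (f.comp u) x ∈ I
        rw [← hmap]
        exact Ideal.mem_map_of_mem (f.comp u) hx
      f_act := fun _ _ _ _ ↦ rfl }
  refine ⟨s, hf.comp hus, fun x hx ↦ ?_, ?_⟩
  · rw [← hmap, Ideal.mem_map_iff_of_surjective (f.comp u) (hf.comp hus)] at hx
    exact hx
  · have h1 : s.cycles 0 = RingHom.ker (f.toRingHom.comp u.toRingHom) :=
      Ideal.ext fun z ↦ Stage.mem_cycles_zero
    rw [h1]
    -- The kernel is an extension of `ker f`, finitely generated by the presentation of `B`, by `ker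
    -- u`, which is saturated because the target of `u` is `p`-torsion free.
    refine Ideal.fg_ker_comp _ _ (H.fg_of_saturated _ fun x hx ↦ H.torsionFree _ ?_) hker hus
    rw [← map_nsmul]
    exact hx

/-- Resolutions exist over every family of Tate algebras with a calculus. -/
theorem TateFamily.Calculus.hasResolution (H : T.Calculus p) {B : Type u} [CommRing B]
    [Algebra R B] (I : Ideal B) (hB : T.IsTopFinitelyPresented B) (hI : I.FG) :
    T.HasResolution ⟨B, I⟩ := by
  obtain ⟨s, hf, hfI, hfg⟩ := exists_initial_stage H I hB hI
  refine (stageColimit s).hasResolution (fun x ↦ ?_) (fun x hx ↦ ?_) (fills_stageColimit s hfg)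
  · obtain ⟨y, hy⟩ := hf x
    exact ⟨_, (stageColimit_f s 0 y).trans hy⟩
  · obtain ⟨y, hy, hyx⟩ := hfI x hx
    exact ⟨_, app_mem ((stageι s 0).app (op ⦋0⦌)) hy, (stageColimit_f s 0 y).trans hyx⟩

end Resolution

end TateRes
end

/-! ### The three base rings -/

open TateRes in
theorem mainTheorem5 (p : ℕ) [Fact p.Prime]
    (K : Type u) [NormedField K] [IsUltrametricDist K] [NormedAlgebra ℚ_[p] K] [CompleteSpace K]
    (hK : IsPerfectoid p K) (ζ : RootSystem p K) :
    (∀ (e : ℕ) (B : Type u) [CommRing B] [Algebra (AinfE ζ e) B] (I : Ideal B),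
      (ainfEFamily ζ e).IsTopFinitelyPresented B → I.FG →
      (∀ x : B ⧸ I, (p : B ⧸ I) * x = 0 → x = 0) →
      (ainfEFamily ζ e).HasResolution ⟨B, I⟩) ∧
    (∀ (e : ℕ) (B : Type u) [CommRing B] [Algebra (BdRE ζ e) B] (I : Ideal B),
      (bdREFamily ζ e).IsTopFinitelyPresented B → I.FG →
      (bdREFamily ζ e).HasResolution ⟨B, I⟩) ∧
    (∀ (B : Type u) [CommRing B] [Algebra (BdR p K) B] (I : Ideal B),
      (bdRFamily ζ).IsTopFinitelyPresented B → I.FG →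
      (bdRFamily ζ).HasResolution ⟨B, I⟩) := by
  refine ⟨fun e B _ _ I hB hI _ ↦ (ainfECalculus hK ζ e).hasResolution I hB hI,
    fun e B _ _ I hB hI ↦ (bdRECalculus hK ζ e).hasResolution I hB hI,
    fun B _ _ I hB hI ↦ (bdRCalculus hK ζ).hasResolution I hB hI⟩
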